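/- Let $\Omega=(a,b)\times(c,d)$ with $a<b$, $c<d$, let $\Gamma_1$ be the union of its bottom and top sides, and identify the left side with the right side of $\Omega$ (periodicity). Let $\alpha,\beta,\lambda>0$ and $\rho>0$. Let $\mathcal T_h$ be a partition of $\Omega$ into finitely many disjoint open triangles whose closures cover $\overline\Omega$, let $h=\max_{K\in\mathcal T_h}\operatorname{diam}K$, and assume that $\mathcal T_h$ is quasi-uniform with constant $\rho$, i.e. every triangle contains a disc of diameter $\rho h$. Let $V^p=\{v\in L^2(\Omega): v|_K\in\mathbb P^p(K)\ \forall K\in\mathcal T_h\}$, where $\mathbb P^p(K)$ is the set of polynomials of total degree at most $p$. Let $\mathcal E^0$ be the set of interior edges (the nondegenerate segments $\overline K\cap\overline{K'}$, $K\ne K'$), $\mathcal E^{\Gamma_2}$ the set of periodic edges (the nondegenerate intersections, after the identification, of a triangle side on the left with a triangle side on the right boundary of $\Omega$), $\mathcal E^{\Gamma_1}$ the set of triangle sides contained in $\Gamma_1$, and $\mathcal R$ the set of end points of the edges in $\mathcal E^{\Gamma_1}$, corners being identified by periodicity. On $e\in\mathcal E^0\cup\mathcal E^{\Gamma_2}$,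 with adjacent triangles $K^\pm$ and unit normals $\mathbf n^\pm$ pointing out of $K^\pm$, put $[v]=v^+\mathbf n^++v^-\mathbf n^-$ and $\{\nabla v\}=\frac12(\nabla v^++\nabla v^-)$. At $r\in\mathcal R$, with adjacent edges $e^\pm\in\mathcal E^{\Gamma_1}$ and unit tangents $\mathbf n_r^\pm$ pointing out of $e^\pm$, put $[v]=v|_{e^+}(r)\,\mathbf n_r^++v|_{e^-}(r)\,\mathbf n_r^-$ and $\{\nabla_\Gamma v\}=\frac12(\nabla_\Gamma v|_{e^+}(r)+\nabla_\Gamma v|_{e^-}(r))$, where $\nabla_\Gamma v=(\mathbf I-\mathbf n\otimes\mathbf n)\nabla v$ is the tangential gradient. For $\gamma>0$ let $\sigma=\gamma/h$. Inner products and norms over a set of edges or of points are sums over that set, and $\mathcal E:=\mathcal E^0\cup\mathcal E^{\Gamma_2}$. Define $$\begin{aligned}\mathcal A_h(v,w)={}&\sum_{K}(\nabla v,\nabla w)_{L^2(K)}-([v],\{\nabla w\})_{\mathcal E}-([w],\{\nabla v\})_{\mathcal E}+\sigma([v],[w])_{\mathcal E}+\alpha(v,w)_{L^2(\Gamma_1)}\\&+\beta\Big((\nabla_\Gamma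 v,\nabla_\Gamma w)_{\mathcal E^{\Gamma_1}}-([v],\{\nabla_\Gamma w\})_{\mathcal R}-([w],\{\nabla_\Gamma v\})_{\mathcal R}+\sigma([v],[w])_{\mathcal R}\Big),\end{aligned}$$ $$\begin{aligned}|||v|||^2={}&\sum_K\|\nabla v\|^2_{L^2(K)}+\sigma\|[v]\|^2_{\mathcal E}+\tfrac1\sigma\|\{\nabla v\}\|^2_{\mathcal E}+\alpha\|v\|^2_{L^2(\Gamma_1)}\\&+\beta\|\nabla_\Gamma v\|^2_{\mathcal E^{\Gamma_1}}+\beta\sigma\|[v]\|^2_{\mathcal R}+\tfrac{\beta}{\sigma}\|\{\nabla_\Gamma v\}\|^2_{\mathcal R},\end{aligned}$$ and $\|v\|^2_{L^2_\lambda(\Omega,\Gamma_1)}=\|v\|^2_{L^2(\Omega)}+\lambda\|v\|^2_{L^2(\Gamma_1)}$. Then there is a constant $C>0$, depending only on $\Omega,\alpha,\beta,\lambda,\rho$, such that for every integer $p\ge1$ there is $\gamma_0>0$ with the following property. Let $\gamma\ge\gamma_0$, let $\mathcal T_h$ be any partition of $\Omega$ as above, let $T>0$, $f\in L^2(0,T;L^2(\Omega))$,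 $g\in L^2(0,T;L^2(\Gamma_1))$, $u_{h0}\in V^p$, and let $u_h\in H^1(0,T;V^p)$ satisfy $u_h(0)=u_{h0}$ and, for almost every $t\in(0,T]$, $$(\partial_tu_h,v_h)_{L^2(\Omega)}+\lambda(\partial_tu_h,v_h)_{L^2(\Gamma_1)}+\mathcal A_h(u_h,v_h)=(f,v_h)_{L^2(\Omega)}+(g,v_h)_{L^2(\Gamma_1)}\qquad\forall v_h\in V^p.$$ Then $$\|u_h(T)\|^2_{L^2_\lambda(\Omega,\Gamma_1)}+\int_0^T|||u_h|||^2\,dt\le C\Big(\|u_{h0}\|^2_{L^2_\lambda(\Omega,\Gamma_1)}+\int_0^T\big(\|f\|^2_{L^2(\Omega)}+\|g\|^2_{L^2(\Gamma_1)}\big)\,dt\Big).$$ -/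

import Mathlib

open MeasureTheory

noncomputable section

namespace DynBC

/-- The Euclidean plane. -/
abbrev Plane : Type := EuclideanSpace ℝ (Fin 2)

/-- The rectangle `(a,b) × (c,d)`. -/
structure Rect where
  a : ℝ
  b : ℝ
  c : ℝ
  d : ℝ
  hab : a < b
  hcd : c < d

namespace Rect

variable (R : Rect)

/-- The open rectangle `Ω`. -/
def Ω : Set Plane := {x | R.a < x 0 ∧ x 0 < R.b ∧ R.c < x 1 ∧ x 1 < R.d}

/-- The bottom and top sides (dynamic boundary condition). -/
def Γ₁ : Set Plane := {x | R.a ≤ x 0 ∧ x 0 ≤ R.b ∧ (x 1 = R.c ∨ x 1 = R.d)}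

/-- The left side; it is identified with the right side. -/
def Γ₂minus : Set Plane := {x | x 0 = R.a ∧ R.c ≤ x 1 ∧ x 1 ≤ R.d}

/-- The right side. -/
def Γ₂plus : Set Plane := {x | x 0 = R.b ∧ R.c ≤ x 1 ∧ x 1 ≤ R.d}

/-- The translation vector that identifies the left side with the right side. -/
def period : Plane := !₂[R.b - R.a, 0]

/-- Arc length on `Γ₁`. -/
def μΓ₁ : Measure Plane :=
  (volume.restrict (Set.Ioo R.a R.b)).map (fun s : ℝ => (!₂[s, R.c] : Plane)) +
    (volume.restrict (Set.Ioo R.a R.b)).map (fun s : ℝ => (!₂[s, R.d] : Plane))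

end Rect

/-- A partition of the rectangle into finitely many triangles: the triangles are nondegenerate,
their interiors are pairwise disjoint and the closed triangles fill the closed rectangle. -/
structure Mesh (R : Rect) where
  n : ℕ
  vert : Fin n → Fin 3 → Plane
  nondegenerate : ∀ K, AffineIndependent ℝ (vert K)
  disjoint_interior : ∀ K L, K ≠ L →
    Disjoint (interior (convexHull ℝ (Set.range (vert K))))
      (interior (convexHull ℝ (Set.range (vert L))))
  cover : ⋃ K, convexHull ℝ (Set.range (vert K)) = closure R.Ω

namespace Mesh

variable {R : Rect} (M : Mesh R)

/-- The closed triangle with index `K`. -/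
def cell (K : Fin M.n) : Set Plane := convexHull ℝ (Set.range (M.vert K))

/-- The mesh size, the largest diameter of a triangle. -/
def h : ℝ := ⨆ K, Metric.diam (M.cell K)

/-- Quasi-uniformity with constant `ρ`: each triangle contains a disc of diameter `ρ h`. -/
def QuasiUniform (ρ : ℝ) : Prop :=
  ∀ K, ∃ z : Plane, Metric.ball z (ρ * M.h / 2) ⊆ M.cell K

/-- A side of a triangle of the mesh: the pair `(K, i)` stands for the side of `K` opposite to
the vertex `i`, with end points the vertices `i + 1` and `i + 2`. -/
abbrev Side : Type := Fin M.n × Fin 3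

def endA (s : M.Side) : Plane := M.vert s.1 (s.2 + 1)

def endB (s : M.Side) : Plane := M.vert s.1 (s.2 + 2)

/-- The closed segment of a side. -/
def seg (s : M.Side) : Set Plane := segment ℝ (M.endA s) (M.endB s)

/-- The component orthogonal to the side of the vector from the opposite vertex to the side. -/
def normalDir (s : M.Side) : Plane :=
  (M.endA s - M.vert s.1 s.2) -
    (inner ℝ (M.endA s - M.vert s.1 s.2) (M.endB s - M.endA s) /
      ‖M.endB s - M.endA s‖ ^ 2) • (M.endB s - M.endA s)

/-- The unit normal to the side `s`, pointing out of the triangle that `s` belongs to. -/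
def normal (s : M.Side) : Plane := ‖M.normalDir s‖⁻¹ • M.normalDir s

/-- The integral of `φ` over a side with respect to arc length. -/
def sideIntegral (s : M.Side) (φ : Plane → ℝ) : ℝ :=
  dist (M.endA s) (M.endB s) *
    ∫ r in (0 : ℝ)..1, φ (AffineMap.lineMap (M.endA s) (M.endB s) r)

open Classical in
/-- The integral of `φ` with respect to arc length over `{x ∈ s : x + τ ∈ s'}`. For `τ = 0` this
is the intersection of two sides, for the period `τ` it is the intersection of a side on the left
with a side on the right after the identification. -/
def edgeIntegral (τ : Plane) (s s' : M.Side) (φ : Plane → ℝ) : ℝ :=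
  M.sideIntegral s (fun x => if x + τ ∈ M.seg s' then φ x else 0)

/-- Pairs of sides of two different triangles, each unordered pair once. The interior edges are
the intersections of these sides; pairs that meet in at most one point contribute nothing to the
integrals. -/
def interiorPairs : Finset (M.Side × M.Side) := Finset.univ.filter (fun q => q.1.1 < q.2.1)

open Classical in
/-- Pairs of a side on the left and a side on the right boundary. The periodic edges are the
intersections of these sides after the identification. -/
def periodicPairs : Finset (M.Side × M.Side) :=
  Finset.univ.filter (fun q => M.seg q.1 ⊆ R.Γ₂minus ∧ M.seg q.2 ⊆ R.Γ₂plus)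

/-- The sum of edge integrals over all interior edges and all periodic edges. The integrand is
given the shift (`0` or the period) and the two sides. -/
def skeletonSum (φ : Plane → M.Side → M.Side → Plane → ℝ) : ℝ :=
  (∑ q ∈ M.interiorPairs, M.edgeIntegral 0 q.1 q.2 (φ 0 q.1 q.2)) +
    (∑ q ∈ M.periodicPairs, M.edgeIntegral R.period q.1 q.2 (φ R.period q.1 q.2))

open Classical in
/-- The boundary edges on `Γ₁`. -/
def Γ₁Sides : Finset M.Side := Finset.univ.filter (fun s => M.seg s ⊆ R.Γ₁)

/-- The left end point of an edge on `Γ₁`. -/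
def leftEnd (s : M.Side) : Plane := !₂[min (M.endA s 0) (M.endB s 0), M.endA s 1]

/-- The right end point of an edge on `Γ₁`. -/
def rightEnd (s : M.Side) : Plane := !₂[max (M.endA s 0) (M.endB s 0), M.endA s 1]

open Classical in
/-- The ridges: a ridge is given by the pair of edges on `Γ₁` that share it. It is the right end
point of the first edge and, up to the identification of the corners, the left end point of the
second. -/
def ridges : Finset (M.Side × M.Side) :=
  (M.Γ₁Sides ×ˢ M.Γ₁Sides).filter (fun q =>
    M.rightEnd q.1 = M.leftEnd q.2 ∨
      (M.rightEnd q.1 0 = R.b ∧ M.rightEnd q.1 = M.leftEnd q.2 + R.period))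

/-- The space `V^p`: one polynomial of total degree at most `p` in two variables on each triangle.
(A class in `L²(Ω)` that is polynomial on each triangle is the same thing.) -/
abbrev V (p : ℕ) : Type := Fin M.n → MvPolynomial.restrictTotalDegree (Fin 2) ℝ p

variable {M} {p : ℕ}

/-- The value at `x` of the polynomial on the triangle `K`. -/
def val (v : M.V p) (K : Fin M.n) (x : Plane) : ℝ :=
  MvPolynomial.eval (fun i => x i) (v K : MvPolynomial (Fin 2) ℝ)

/-- The gradient at `x` of the polynomial on the triangle `K`. -/
def grad (v : M.V p) (K : Fin M.n) (x : Plane) : Plane :=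
  !₂[MvPolynomial.eval (fun i => x i) (MvPolynomial.pderiv 0 (v K : MvPolynomial (Fin 2) ℝ)),
    MvPolynomial.eval (fun i => x i) (MvPolynomial.pderiv 1 (v K : MvPolynomial (Fin 2) ℝ))]

/-- The tangential gradient `(I - n ⊗ n) ∇v` on a side. -/
def tgrad (v : M.V p) (s : M.Side) (x : Plane) : Plane :=
  grad v s.1 x - (inner ℝ (M.normal s) (grad v s.1 x) : ℝ) • M.normal s

/-- The jump `v⁺ n⁺ + v⁻ n⁻` on an interior or periodic edge. -/
def jump (v : M.V p) (τ : Plane) (s s' : M.Side) (x : Plane) : Plane :=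
  val v s.1 x • M.normal s + val v s'.1 (x + τ) • M.normal s'

/-- The average of the gradient on an interior or periodic edge. -/
def avgGrad (v : M.V p) (τ : Plane) (s s' : M.Side) (x : Plane) : Plane :=
  (1 / 2 : ℝ) • (grad v s.1 x + grad v s'.1 (x + τ))

/-- The jump at a ridge; the unit tangents pointing out of the first and out of the second edge
are `(1, 0)` and `(-1, 0)`. -/
def ridgeJump (v : M.V p) (q : M.Side × M.Side) : Plane :=
  val v q.1.1 (M.rightEnd q.1) • (!₂[1, 0] : Plane) +
    val v q.2.1 (M.leftEnd q.2) • (!₂[-1, 0] : Plane)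

/-- The average of the tangential gradient at a ridge. -/
def ridgeAvg (v : M.V p) (q : M.Side × M.Side) : Plane :=
  (1 / 2 : ℝ) • (tgrad v q.1 (M.rightEnd q.1) + tgrad v q.2 (M.leftEnd q.2))

/-- `(v, w)_{L²(Ω)}`. -/
def innerΩ (v w : M.V p) : ℝ := ∑ K, ∫ x in M.cell K, val v K x * val w K x

/-- `(v, w)_{L²(Γ₁)}`. -/
def innerΓ₁ (v w : M.V p) : ℝ :=
  ∑ s ∈ M.Γ₁Sides, M.sideIntegral s (fun x => val v s.1 x * val w s.1 x)

/-- `(f, w)_{L²(Ω)}` for a function `f` on `Ω`. -/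
def loadΩ (f : Plane → ℝ) (w : M.V p) : ℝ := ∑ K, ∫ x in M.cell K, f x * val w K x

/-- `(g, w)_{L²(Γ₁)}` for a function `g` on `Γ₁`. -/
def loadΓ₁ (g : Plane → ℝ) (w : M.V p) : ℝ :=
  ∑ s ∈ M.Γ₁Sides, M.sideIntegral s (fun x => g x * val w s.1 x)

/-- The interior penalty form in the bulk, with penalty parameter `σ`. -/
def bulkForm (σ : ℝ) (v w : M.V p) : ℝ :=
  (∑ K, ∫ x in M.cell K, (inner ℝ (grad v K x) (grad w K x) : ℝ))
    - M.skeletonSum (fun τ s s' x => inner ℝ (jump v τ s s' x) (avgGrad w τ s s' x))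
    - M.skeletonSum (fun τ s s' x => inner ℝ (jump w τ s s' x) (avgGrad v τ s s' x))
    + σ * M.skeletonSum (fun τ s s' x => inner ℝ (jump v τ s s' x) (jump w τ s s' x))

/-- The interior penalty form on `Γ₁`, with penalty parameter `σ`. -/
def boundaryForm (σ : ℝ) (v w : M.V p) : ℝ :=
  (∑ s ∈ M.Γ₁Sides, M.sideIntegral s (fun x => inner ℝ (tgrad v s x) (tgrad w s x)))
    - (∑ q ∈ M.ridges, (inner ℝ (ridgeJump v q) (ridgeAvg w q) : ℝ))
    - (∑ q ∈ M.ridges, (inner ℝ (ridgeJump w q) (ridgeAvg v q) : ℝ))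
    + σ * (∑ q ∈ M.ridges, (inner ℝ (ridgeJump v q) (ridgeJump w q) : ℝ))

/-- The discrete bilinear form, with `σ = γ / h`. -/
def dgForm (α β γ : ℝ) (v w : M.V p) : ℝ :=
  bulkForm (γ / M.h) v w + α * innerΓ₁ v w + β * boundaryForm (γ / M.h) v w

/-- The square of the bulk part of the energy norm. -/
def bulkNormSq (σ : ℝ) (v : M.V p) : ℝ :=
  (∑ K, ∫ x in M.cell K, ‖grad v K x‖ ^ 2)
    + σ * M.skeletonSum (fun τ s s' x => ‖jump v τ s s' x‖ ^ 2)
    + 1 / σ * M.skeletonSum (fun τ s s' x => ‖avgGrad v τ s s' x‖ ^ 2)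

/-- The square of the energy norm, with `σ = γ / h`. -/
def energyNormSq (α β γ : ℝ) (v : M.V p) : ℝ :=
  bulkNormSq (γ / M.h) v + α * innerΓ₁ v v
    + β * (∑ s ∈ M.Γ₁Sides, M.sideIntegral s (fun x => ‖tgrad v s x‖ ^ 2))
    + β * (γ / M.h) * (∑ q ∈ M.ridges, ‖ridgeJump v q‖ ^ 2)
    + β / (γ / M.h) * (∑ q ∈ M.ridges, ‖ridgeAvg v q‖ ^ 2)

/-- `‖v‖²` in `L²_λ(Ω, Γ₁)`. -/
def lambdaNormSq (lam : ℝ) (v : M.V p) : ℝ := innerΩ v v + lam * innerΓ₁ v v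

/-- `u` is a solution on `[0, T]` of the semi-discrete problem with data `f`, `g` and initial
value `u₀`: it belongs to `H¹(0, T; V^p)` (its coefficients are integrals of the square integrable
coefficients of `w = ∂ₜ u`), starts at `u₀`, and satisfies the variational equation for almost
every time. -/
def IsSemidiscreteSolution (α β lam γ T : ℝ) (f g : ℝ → Plane → ℝ) (u₀ : M.V p)
    (u : ℝ → M.V p) : Prop :=
  ∃ w : ℝ → M.V p,
    (∀ K m, MemLp (fun t => MvPolynomial.coeff m (w t K : MvPolynomial (Fin 2) ℝ)) 2
      (volume.restrict (Set.Ioc 0 T))) ∧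
    (∀ t ∈ Set.Icc 0 T, ∀ K m,
      MvPolynomial.coeff m (u t K : MvPolynomial (Fin 2) ℝ) =
        MvPolynomial.coeff m (u₀ K : MvPolynomial (Fin 2) ℝ) +
          (∫ r in (0 : ℝ)..t, MvPolynomial.coeff m (w r K : MvPolynomial (Fin 2) ℝ))) ∧
    ∀ᵐ t ∂(volume.restrict (Set.Ioc 0 T)), ∀ v : M.V p,
      innerΩ (w t) v + lam * innerΓ₁ (w t) v + dgForm α β γ (u t) v =
        loadΩ (f t) v + loadΓ₁ (g t) v

end Mesh

end DynBC

end

/-! ### Inverse estimates for polynomials -/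

namespace DynBC

/-! The estimate is an energy argument: test the equation with the solution itself. The mass form is
symmetric, so the time derivative contributes half the derivative of the squared `L²_λ` norm;
coercivity contributes half the squared energy norm; the loads are absorbed by Young's inequality.
The absorption goes entirely into the energy norm, so no Gronwall argument is needed and the
constant is independent of `T`. Two discrete facts carry this.

Coercivity (`exists_dgForm_coercive`). Young's inequality splits the consistency terms into jumps
with weight `σ` and averages with weight `1/σ`. By an inverse estimate, the squared gradient of a
polynomial at a point of a triangle is at most `C h⁻²` times its integral over the triangle;
integration over an edge of length at most `h` leaves `h⁻¹`, which `1/σ = h/γ` turns into the small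
factor `C/γ`. On `Γ₁` the same happens one dimension lower, with ridges in place of edges. Hanging
nodes are allowed, and the number of sides that meet a given one is bounded by packing the inscribed
discs. The degree `p` enters only here, hence only through `γ₀`.

Broken Poincaré inequality (`QuasiUniform.poincare`). The energy norm must control the `L²(Ω)` norm
with a constant free of `p` and `γ`. Almost every vertical line avoids all vertices, and its
sections by the triangles are stacked from the bottom side upwards. Descending to the bottom, where
the `α` term controls the trace, a function changes by integrals of its gradient and by jumps. The
line meets at most `C/h` triangles, so Cauchy-Schwarz costs `1/h` on the jumps, which is available
in the energy norm once `γ ≥ 1`. Fubini sums over the lines.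

In time, the coefficients of the solution are primitives of integrable functions, so the product
rule holds almost everywhere and integrates (`IsBilin.integral_eq`). -/

theorem exists_sq_le_of_posDef {E Y : Type*} [AddCommGroup E] [Module ℝ E] [FiniteDimensional ℝ E]
    (B : LinearMap.BilinForm ℝ E) (hsymm : ∀ v w, B v w = B w v) (hpos : ∀ v, v ≠ 0 → 0 < B v v)
    (ℓ : Y → E →ₗ[ℝ] ℝ) (hℓ : ∀ v, ∃ c, ∀ y, |ℓ y v| ≤ c) :
    ∃ C : ℝ, 0 < C ∧ ∀ y v, (ℓ y v) ^ 2 ≤ C * B v v := by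
  have hnn : ∀ v, 0 ≤ B v v := fun v => by
    rcases eq_or_ne v 0 with rfl | h
    · simp
    · exact (hpos v h).le
  have hleft : LinearMap.SeparatingLeft B := fun v hv => by
    by_contra h
    exact (hpos v h).ne' (hv v)
  have hnd : B.Nondegenerate :=
    ⟨hleft, fun v hv => hleft v fun w => (hsymm v w).trans (hv w)⟩
  have hcs : ∀ v w, (B v w) ^ 2 ≤ B v v * B w w := fun v w => by
    have := B.apply_mul_apply_le_of_forall_zero_le hnn v w
    rw [hsymm w v] at this
    rw [sq]; exact this
  let b := Module.finBasis ℝ E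
  choose c hc using hℓ
  -- `(B.toDual hnd).symm (b.coord i)` is the Riesz representative of the `i`-th coordinate;
  -- Cauchy-Schwarz for `B` then bounds each coordinate of `v` by `B v v`, uniformly in `y`.
  let D : ℝ := ∑ i, c (b i) ^ 2 * B ((B.toDual hnd).symm (b.coord i)) ((B.toDual hnd).symm (b.coord i))
  have hD : 0 ≤ D := Finset.sum_nonneg fun i _ => mul_nonneg (sq_nonneg _) (hnn _)
  refine ⟨Module.finrank ℝ E * D + 1, by positivity, fun y v => ?_⟩
  have h1 : ℓ y v = ∑ i, b.repr v i * ℓ y (b i) := by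
    conv_lhs => rw [← b.sum_repr v]
    rw [map_sum]
    exact Finset.sum_congr rfl fun i _ => by rw [map_smul, smul_eq_mul]
  have h2 : (ℓ y v) ^ 2 ≤ Module.finrank ℝ E * ∑ i, (b.repr v i * ℓ y (b i)) ^ 2 := by
    rw [h1]
    have := sq_sum_le_card_mul_sum_sq (s := Finset.univ) (f := fun i => b.repr v i * ℓ y (b i))
    simpa using this
  have h3 : ∑ i, (b.repr v i * ℓ y (b i)) ^ 2 ≤ D * B v v := by
    rw [Finset.sum_mul]
    refine Finset.sum_le_sum fun i _ => ?_
    have h4 : b.repr v i = B ((B.toDual hnd).symm (b.coord i)) v := by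
      rw [LinearMap.BilinForm.apply_toDual_symm_apply]; rfl
    have h5 : (ℓ y (b i)) ^ 2 ≤ c (b i) ^ 2 := sq_le_sq' (abs_le.1 (hc _ y)).1 (abs_le.1 (hc _ y)).2
    have h6 := hcs ((B.toDual hnd).symm (b.coord i)) v
    rw [mul_pow, h4, mul_comm (_ ^ 2), mul_assoc]
    exact mul_le_mul h5 h6 (sq_nonneg _) (sq_nonneg _)
  have h7 : (Module.finrank ℝ E : ℝ) * ∑ i, (b.repr v i * ℓ y (b i)) ^ 2
      ≤ Module.finrank ℝ E * (D * B v v) := by gcongr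
  nlinarith [hnn v]

/-- Equivalence of norms in finite dimension, in the form used twice below: the form is the `L²`
product and the functionals are point evaluations on a compact set. -/
theorem exists_sq_le_integral {E X Y : Type*} [AddCommGroup E] [Module ℝ E]
    [FiniteDimensional ℝ E] [MeasurableSpace X] (μ : Measure X) (ev : E →ₗ[ℝ] X → ℝ)
    (h_int : ∀ v w, Integrable (fun x => ev v x * ev w x) μ)
    (hpos : ∀ v, v ≠ 0 → 0 < ∫ x, ev v x ^ 2 ∂μ)
    (ℓ : Y → E →ₗ[ℝ] ℝ) (hℓ : ∀ v, ∃ c, ∀ y, |ℓ y v| ≤ c) :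
    ∃ C : ℝ, 0 < C ∧ ∀ y v, (ℓ y v) ^ 2 ≤ C * ∫ x, ev v x ^ 2 ∂μ := by
  let B : LinearMap.BilinForm ℝ E := LinearMap.mk₂ ℝ (fun v w => ∫ x, ev v x * ev w x ∂μ)
    (fun v v' w => by
      rw [← integral_add (h_int v w) (h_int v' w)]
      simp [add_mul])
    (fun c v w => by
      rw [smul_eq_mul, ← integral_const_mul]
      simp [mul_assoc])
    (fun v w w' => by
      rw [← integral_add (h_int v w) (h_int v w')]
      simp [mul_add])
    (fun c v w => by
      rw [smul_eq_mul, ← integral_const_mul]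
      simp [mul_left_comm])
  have hB : ∀ v w, B v w = ∫ x, ev v x * ev w x ∂μ := fun v w => rfl
  have hB' : ∀ v, B v v = ∫ x, ev v x ^ 2 ∂μ := fun v => by simp only [hB, sq]
  obtain ⟨C, hC, h⟩ := exists_sq_le_of_posDef B (fun v w => by simp only [hB, mul_comm])
    (fun v hv => by rw [hB']; exact hpos v hv) ℓ hℓ
  exact ⟨C, hC, fun y v => by rw [← hB']; exact h y v⟩

/-- Inverse estimate in one dimension. -/
theorem exists_polynomial_sq_le (p : ℕ) : ∃ C : ℝ, 0 < C ∧ ∀ q : Polynomial ℝ, q.natDegree ≤ p →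
    ∀ y ∈ Set.Icc (0 : ℝ) 1, (q.eval y) ^ 2 ≤ C * ∫ r in (0 : ℝ)..1, (q.eval r) ^ 2 := by
  have : FiniteDimensional ℝ (Polynomial.degreeLT ℝ (p + 1)) :=
    Module.Finite.equiv (Polynomial.degreeLTEquiv ℝ (p + 1)).symm
  let ev : Polynomial.degreeLT ℝ (p + 1) →ₗ[ℝ] ℝ → ℝ :=
    { toFun := fun q r => (q : Polynomial ℝ).eval r
      map_add' := fun q q' => by ext; simp
      map_smul' := fun c q => by ext; simp }
  obtain ⟨C, hC, h⟩ := exists_sq_le_integral (E := Polynomial.degreeLT ℝ (p + 1))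
    (Y := Set.Icc (0 : ℝ) 1)
    (volume.restrict (Set.Ioc (0 : ℝ) 1)) ev
    (fun v w => by
      have : Continuous fun r : ℝ => (v : Polynomial ℝ).eval r * (w : Polynomial ℝ).eval r := by
        fun_prop
      exact (this.integrableOn_Icc (a := 0) (b := 1)).mono_set Set.Ioc_subset_Icc_self)
    (fun v hv => by
      have hcont : Continuous fun r : ℝ => (v : Polynomial ℝ).eval r ^ 2 := by fun_prop
      rw [← intervalIntegral.integral_of_le zero_le_one]
      by_contra hle
      have h0 : ∫ r in (0 : ℝ)..1, (v : Polynomial ℝ).eval r ^ 2 = 0 :=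
        le_antisymm (not_lt.1 hle)
          (intervalIntegral.integral_nonneg zero_le_one fun _ _ => sq_nonneg _)
      apply hv
      apply Subtype.ext
      apply Polynomial.eq_zero_of_infinite_isRoot
      -- A continuous square with zero integral vanishes on the whole interval, so the polynomial
      -- has infinitely many roots.
      refine (Set.Ioo_infinite (zero_lt_one' ℝ)).mono fun r hr => ?_
      by_contra hne
      have : 0 < ∫ r in (0 : ℝ)..1, (v : Polynomial ℝ).eval r ^ 2 :=
        intervalIntegral.integral_pos zero_lt_one hcont.continuousOn (fun _ _ => sq_nonneg _)
          ⟨r, Set.Ioo_subset_Icc_self hr, by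
            have : (v : Polynomial ℝ).eval r ≠ 0 := hne
            positivity⟩
      exact this.ne' h0)
    (fun y => LinearMap.proj (y : ℝ) ∘ₗ ev)
    (fun v => by
      have hcont : Continuous fun r : ℝ => (v : Polynomial ℝ).eval r := by fun_prop
      obtain ⟨c, hc⟩ := (isCompact_Icc (a := (0 : ℝ)) (b := 1)).exists_bound_of_continuousOn
        hcont.continuousOn
      exact ⟨c, fun y => hc y y.2⟩)
  refine ⟨C, hC, fun q hq y hy => ?_⟩
  have hq' : q ∈ Polynomial.degreeLT ℝ (p + 1) := by
    rw [Polynomial.mem_degreeLT]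
    exact lt_of_le_of_lt Polynomial.degree_le_natDegree (by exact_mod_cast Nat.lt_succ_of_le hq)
  have := h ⟨y, hy⟩ ⟨q, hq'⟩
  rw [← intervalIntegral.integral_of_le zero_le_one] at this
  exact this

theorem continuous_eval_plane (q : MvPolynomial (Fin 2) ℝ) :
    Continuous fun x : Plane => MvPolynomial.eval (fun i => x i) q :=
  (MvPolynomial.continuous_eval q).comp (by fun_prop)

/-- The square `(0, r/2)²` lies in the disc, and a polynomial that vanishes on a product of infinite
sets is zero. -/
theorem eq_zero_of_eval_ball_eq_zero (q : MvPolynomial (Fin 2) ℝ) {r : ℝ} (hr : 0 < r)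
    (h : ∀ x ∈ Metric.ball (0 : Plane) r, MvPolynomial.eval (fun i => x i) q = 0) : q = 0 := by
  refine MvPolynomial.funext_set (fun _ => Set.Ioo 0 (r / 2))
    (fun _ => Set.Ioo_infinite (by positivity)) fun x hx => ?_
  rw [map_zero]
  have := h (WithLp.toLp 2 x) ?_
  · simpa using this
  · have h0 := hx 0 (Set.mem_univ _)
    have h1 := hx 1 (Set.mem_univ _)
    simp only [Set.mem_Ioo] at h0 h1
    rw [mem_ball_zero_iff, EuclideanSpace.norm_eq, Real.sqrt_lt' hr]
    simp only [Fin.sum_univ_two, Real.norm_eq_abs, sq_abs]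
    nlinarith

/-- Inverse estimate on the unit disc. -/
theorem exists_mvPolynomial_sq_le_unit (p : ℕ) {ρ : ℝ} (hρ : 0 < ρ) : ∃ C : ℝ, 0 < C ∧
    ∀ q : MvPolynomial (Fin 2) ℝ, q.totalDegree ≤ p → ∀ y ∈ Metric.closedBall (0 : Plane) 1,
      (MvPolynomial.eval (fun i => y i) q) ^ 2 ≤
        C * ∫ x in Metric.ball (0 : Plane) ρ, (MvPolynomial.eval (fun i => x i) q) ^ 2 := by
  let E := MvPolynomial.restrictTotalDegree (Fin 2) ℝ p
  let ev : E →ₗ[ℝ] Plane → ℝ :=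
    { toFun := fun q x => MvPolynomial.eval (fun i => x i) (q : MvPolynomial (Fin 2) ℝ)
      map_add' := fun q q' => by ext; simp
      map_smul' := fun c q => by ext; simp }
  obtain ⟨C, hC, h⟩ := exists_sq_le_integral (E := E)
    (Y := Metric.closedBall (0 : Plane) 1)
    (volume.restrict (Metric.ball (0 : Plane) ρ)) ev
    (fun v w => by
      have := (continuous_eval_plane (v : MvPolynomial (Fin 2) ℝ)).mul
        (continuous_eval_plane (w : MvPolynomial (Fin 2) ℝ))
      exact (this.continuousOn.integrableOn_compact (isCompact_closedBall _ ρ)).mono_set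
        Metric.ball_subset_closedBall)
    (fun v hv => by
      have hcont := (continuous_eval_plane (v : MvPolynomial (Fin 2) ℝ)).pow 2
      have h_int : IntegrableOn (fun x => ev v x ^ 2) (Metric.ball (0 : Plane) ρ) :=
        (hcont.continuousOn.integrableOn_compact (isCompact_closedBall _ ρ)).mono_set
          Metric.ball_subset_closedBall
      by_contra hle
      apply hv
      apply Subtype.ext
      refine eq_zero_of_eval_ball_eq_zero _ hρ fun x hx => ?_
      have h0 : ∫ x in Metric.ball (0 : Plane) ρ, ev v x ^ 2 = 0 :=
        le_antisymm (not_lt.1 hle) (integral_nonneg fun _ => sq_nonneg _)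
      rw [integral_eq_zero_iff_of_nonneg (fun _ => sq_nonneg _) h_int] at h0
      have := Measure.eqOn_open_of_ae_eq h0 Metric.isOpen_ball hcont.continuousOn
        continuousOn_const hx
      exact pow_eq_zero_iff (two_ne_zero) |>.1 this)
    (fun y => LinearMap.proj (y : Plane) ∘ₗ ev)
    (fun v => by
      obtain ⟨c, hc⟩ := (isCompact_closedBall (0 : Plane) 1).exists_bound_of_continuousOn
        (continuous_eval_plane (v : MvPolynomial (Fin 2) ℝ)).continuousOn
      exact ⟨c, fun y => hc y y.2⟩)
  refine ⟨C, hC, fun q hq y hy => ?_⟩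
  exact h ⟨y, hy⟩ ⟨q, (MvPolynomial.mem_restrictTotalDegree _ _ _).2 hq⟩

theorem totalDegree_aeval_le {σ τ : Type*} {m n : ℕ} (F : MvPolynomial σ ℝ)
    (hF : F.totalDegree ≤ m) (f : σ → MvPolynomial τ ℝ) (hf : ∀ i, (f i).totalDegree ≤ n) :
    (MvPolynomial.aeval f F).totalDegree ≤ m * n := by
  rw [MvPolynomial.aeval_def, MvPolynomial.eval₂]
  apply MvPolynomial.totalDegree_finsetSum_le
  intro d hd
  refine (MvPolynomial.totalDegree_mul _ _).trans ?_
  rw [MvPolynomial.algebraMap_eq, MvPolynomial.totalDegree_C, zero_add]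
  refine (MvPolynomial.totalDegree_finsetProd _ _).trans ?_
  calc ∑ i ∈ d.support, (f i ^ d i).totalDegree ≤ ∑ i ∈ d.support, d i * n := by
        refine Finset.sum_le_sum fun i _ => ?_
        exact (MvPolynomial.totalDegree_pow _ _).trans (Nat.mul_le_mul_left _ (hf i))
    _ = (∑ i ∈ d.support, d i) * n := by rw [Finset.sum_mul]
    _ ≤ m * n := Nat.mul_le_mul_right _ (le_trans (Finset.le_sup (f := fun s => s.sum fun _ e => e) hd) hF)

theorem eval_aeval_affine (z x : Plane) (h : ℝ) (q : MvPolynomial (Fin 2) ℝ) :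
    MvPolynomial.eval (fun i => x i) (MvPolynomial.aeval
      (fun i => (MvPolynomial.C (z i) + MvPolynomial.C h * MvPolynomial.X i :
        MvPolynomial (Fin 2) ℝ)) q) = MvPolynomial.eval (fun i => (z + h • x) i) q := by
  induction q using MvPolynomial.induction_on with
  | C a => simp
  | add a b ha hb => rw [map_add, map_add, map_add, ha, hb]
  | mul_X a i ha =>
    rw [map_mul, map_mul, map_mul, ha]
    simp

/-- Inverse estimate on a set that contains a disc of diameter `ρ h` and has diameter at most
`h`. -/
theorem exists_mvPolynomial_sq_le (p : ℕ) {ρ : ℝ} (hρ : 0 < ρ) : ∃ C : ℝ, 0 < C ∧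
    ∀ q : MvPolynomial (Fin 2) ℝ, q.totalDegree ≤ p → ∀ h : ℝ, 0 < h → ∀ (z : Plane) (K : Set Plane),
      IsCompact K → Metric.ball z (ρ * h / 2) ⊆ K → K ⊆ Metric.closedBall z h → ∀ y ∈ K,
      (MvPolynomial.eval (fun i => y i) q) ^ 2 ≤
        C / h ^ 2 * ∫ x in K, (MvPolynomial.eval (fun i => x i) q) ^ 2 := by
  obtain ⟨C, hC, H⟩ := exists_mvPolynomial_sq_le_unit p (half_pos hρ)
  refine ⟨C, hC, fun q hq h hh z K hK hzK hKz y hy => ?_⟩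
  -- Rescaling by `x ↦ z + h x` keeps the degree, sends the unit disc onto the disc of radius `h`
  -- and the disc of radius `ρ / 2` onto the one inside `K`. The Jacobian of this map is the source
  -- of `h ^ 2` in the constant.
  let q' : MvPolynomial (Fin 2) ℝ :=
    MvPolynomial.aeval (fun i => MvPolynomial.C (z i) + MvPolynomial.C h * MvPolynomial.X i) q
  have hq' : q'.totalDegree ≤ p := by
    have := totalDegree_aeval_le (n := 1) q hq
      (fun i => (MvPolynomial.C (z i) + MvPolynomial.C h * MvPolynomial.X i :
        MvPolynomial (Fin 2) ℝ)) (fun i => by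
        refine (MvPolynomial.totalDegree_add _ _).trans (max_le (by simp) ?_)
        refine (MvPolynomial.totalDegree_mul _ _).trans ?_
        simp)
    rwa [mul_one] at this
  have hev : ∀ x : Plane, MvPolynomial.eval (fun i => x i) q' =
      MvPolynomial.eval (fun i => (z + h • x) i) q :=
    fun x => eval_aeval_affine z x h q
  have hy' : h⁻¹ • (y - z) ∈ Metric.closedBall (0 : Plane) 1 := by
    have := hKz hy
    rw [mem_closedBall_iff_norm] at this
    rw [mem_closedBall_zero_iff, norm_smul, norm_inv, Real.norm_of_nonneg hh.le,
      inv_mul_le_iff₀ hh]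
    simpa using this
  have key := H q' hq' _ hy'
  simp only [hev] at key
  rw [smul_smul, mul_inv_cancel₀ hh.ne', one_smul, add_sub_cancel] at key
  refine key.trans ?_
  rw [div_mul_eq_mul_div, mul_div_assoc]
  refine mul_le_mul_of_nonneg_left ?_ hC.le
  have h1 := Measure.setIntegral_comp_smul_of_pos (volume : Measure Plane)
    (fun x : Plane => MvPolynomial.eval (fun i => (z + x) i) q ^ 2) (Metric.ball 0 (ρ / 2)) hh
  rw [h1, finrank_euclideanSpace, Fintype.card_fin, smul_eq_mul,
    div_eq_inv_mul (∫ x in K, MvPolynomial.eval (fun i => x i) q ^ 2)]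
  refine mul_le_mul_of_nonneg_left ?_ (inv_nonneg.2 (sq_nonneg h))
  rw [smul_ball hh.ne' (0 : Plane), smul_zero, Real.norm_of_nonneg hh.le]
  have h2 : ∫ x in Metric.ball (0 : Plane) (h * (ρ / 2)), MvPolynomial.eval (fun i => (z + x) i) q ^ 2
      = ∫ x in Metric.ball z (ρ * h / 2), MvPolynomial.eval (fun i => x i) q ^ 2 := by
    have hmp := (measurePreserving_add_left (volume : Measure Plane) z)
    rw [← hmp.setIntegral_preimage_emb (measurableEmbedding_addLeft z)
      (fun x => MvPolynomial.eval (fun i => x i) q ^ 2) (Metric.ball z (ρ * h / 2))]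
    have hset : (fun x => z + x) ⁻¹' Metric.ball z (ρ * h / 2) =
        Metric.ball (0 : Plane) (h * (ρ / 2)) := by
      ext x
      simp only [Set.mem_preimage, mem_ball_iff_norm, add_sub_cancel_left, sub_zero]
      rw [show ρ * h / 2 = h * (ρ / 2) by ring]
    rw [hset]
  rw [h2]
  refine setIntegral_mono_set ?_ (Filter.Eventually.of_forall fun _ => sq_nonneg _)
    hzK.eventuallyLE
  exact ((continuous_eval_plane q).pow 2).continuousOn.integrableOn_compact hK

theorem totalDegree_pderiv_le {σ : Type*} (i : σ) (q : MvPolynomial σ ℝ) :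
    (MvPolynomial.pderiv i q).totalDegree ≤ q.totalDegree := by
  classical
  refine Finset.sup_le fun m hm => ?_
  have h1 : m + Finsupp.single i 1 ∈ q.support := by
    rw [MvPolynomial.mem_support_iff, MvPolynomial.coeff_pderiv] at hm
    rw [MvPolynomial.mem_support_iff]
    exact left_ne_zero_of_mul hm
  refine le_trans ?_ (MvPolynomial.le_totalDegree h1)
  rw [Finsupp.sum_add_index' (fun _ => rfl) (fun _ _ _ => rfl)]
  exact Nat.le_add_right _ _

end DynBC

/-! ### Geometry of the mesh -/

namespace DynBC

namespace Mesh

variable {R : Rect} (M : Mesh R)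

/-- The affine basis formed by the vertices of a triangle. -/
noncomputable def cellBasis (K : Fin M.n) : AffineBasis (Fin 3) ℝ Plane :=
  ⟨M.vert K, M.nondegenerate K, by
    rw [(M.nondegenerate K).affineSpan_eq_top_iff_card_eq_finrank_add_one]
    simp⟩

/-- The barycentric coordinates on a triangle. -/
noncomputable def bary (K : Fin M.n) (i : Fin 3) : Plane →ᵃ[ℝ] ℝ := (M.cellBasis K).coord i

theorem bary_vert_self (K : Fin M.n) (i : Fin 3) : M.bary K i (M.vert K i) = 1 :=
  (M.cellBasis K).coord_apply_eq i

theorem bary_vert_of_ne (K : Fin M.n) {i j : Fin 3} (h : i ≠ j) : M.bary K i (M.vert K j) = 0 :=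
  (M.cellBasis K).coord_apply_ne h

theorem sum_bary (K : Fin M.n) (x : Plane) : ∑ i, M.bary K i x = 1 :=
  (M.cellBasis K).sum_coord_apply_eq_one x

theorem sum_bary_smul_vert (K : Fin M.n) (x : Plane) : ∑ i, M.bary K i x • M.vert K i = x :=
  (M.cellBasis K).linear_combination_coord_eq_self x

theorem mem_cell_iff {K : Fin M.n} {x : Plane} : x ∈ M.cell K ↔ ∀ i, 0 ≤ M.bary K i x := by
  have := (M.cellBasis K).convexHull_eq_nonneg_coord
  unfold cell
  change x ∈ convexHull ℝ (Set.range (M.cellBasis K)) ↔ _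
  rw [this]; rfl

theorem mem_interior_cell_iff {K : Fin M.n} {x : Plane} :
    x ∈ interior (M.cell K) ↔ ∀ i, 0 < M.bary K i x := by
  have := (M.cellBasis K).interior_convexHull
  unfold cell
  change x ∈ interior (convexHull ℝ (Set.range (M.cellBasis K))) ↔ _
  rw [this]; rfl

theorem bary_add (K : Fin M.n) (i : Fin 3) (x w : Plane) :
    M.bary K i (x + w) = M.bary K i x + (M.bary K i).linear w := by
  have := (M.bary K i).map_vadd x w
  simpa [add_comm] using this

theorem bary_linear_sub (K : Fin M.n) (i : Fin 3) (x y : Plane) :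
    (M.bary K i).linear (x - y) = M.bary K i x - M.bary K i y := by
  have := (M.bary K i).linearMap_vsub x y
  simpa using this

theorem continuous_bary (K : Fin M.n) (i : Fin 3) : Continuous (M.bary K i) :=
  (M.bary K i).continuous_of_finiteDimensional

theorem isCompact_cell (K : Fin M.n) : IsCompact (M.cell K) :=
  (Set.finite_range _).isCompact_convexHull ℝ

theorem convex_cell (K : Fin M.n) : Convex ℝ (M.cell K) := convex_convexHull ℝ _

theorem measurableSet_cell (K : Fin M.n) : MeasurableSet (M.cell K) :=
  (M.isCompact_cell K).measurableSet

theorem vert_mem_cell (K : Fin M.n) (i : Fin 3) : M.vert K i ∈ M.cell K :=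
  subset_convexHull ℝ _ ⟨i, rfl⟩

theorem endA_mem_cell (s : M.Side) : M.endA s ∈ M.cell s.1 := M.vert_mem_cell _ _

theorem endB_mem_cell (s : M.Side) : M.endB s ∈ M.cell s.1 := M.vert_mem_cell _ _

theorem seg_subset_cell (s : M.Side) : M.seg s ⊆ M.cell s.1 :=
  (M.convex_cell s.1).segment_subset (M.endA_mem_cell s) (M.endB_mem_cell s)

theorem isClosed_seg (s : M.Side) : IsClosed (M.seg s) := by
  unfold seg
  rw [segment_eq_image_lineMap]
  exact (isCompact_Icc.image AffineMap.lineMap_continuous).isClosed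

theorem sum_fin_three {A : Type*} [AddCommMonoid A] (f : Fin 3 → A) (i : Fin 3) :
    ∑ j, f j = f i + f (i + 1) + f (i + 2) := by
  rw [Fin.sum_univ_three]
  fin_cases i
  · rfl
  · change _ = f 1 + f 2 + f 0
    abel
  · change _ = f 2 + f 0 + f 1
    abel

theorem fin_three_ne_add_one (i : Fin 3) : i ≠ i + 1 := by fin_cases i <;> decide
theorem fin_three_ne_add_two (i : Fin 3) : i ≠ i + 2 := by fin_cases i <;> decide
theorem fin_three_add_one_ne_add_two (i : Fin 3) : i + 1 ≠ i + 2 := by fin_cases i <;> decide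

theorem bary_endA (s : M.Side) : M.bary s.1 s.2 (M.endA s) = 0 :=
  M.bary_vert_of_ne _ (fin_three_ne_add_one _)

theorem bary_endB (s : M.Side) : M.bary s.1 s.2 (M.endB s) = 0 :=
  M.bary_vert_of_ne _ (fin_three_ne_add_two _)

theorem mem_seg_iff {s : M.Side} {x : Plane} :
    x ∈ M.seg s ↔ x ∈ M.cell s.1 ∧ M.bary s.1 s.2 x = 0 := by
  constructor
  · intro hx
    refine ⟨M.seg_subset_cell s hx, ?_⟩
    unfold seg at hx
    rw [segment_eq_image_lineMap] at hx
    obtain ⟨r, -, rfl⟩ := hx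
    rw [AffineMap.apply_lineMap, bary_endA, bary_endB]
    simp
  · rintro ⟨hx, h0⟩
    rw [mem_cell_iff] at hx
    have h1 := M.sum_bary s.1 x
    have h2 := M.sum_bary_smul_vert s.1 x
    rw [sum_fin_three _ s.2, h0, zero_add] at h1
    rw [sum_fin_three _ s.2, h0, zero_smul, zero_add] at h2
    exact ⟨_, _, hx _, hx _, h1, h2⟩

theorem eq_vert_of_bary_eq_zero {K : Fin M.n} {x : Plane} {i j : Fin 3} (hij : i ≠ j)
    (hi : M.bary K i x = 0) (hj : M.bary K j x = 0) : ∃ k, x = M.vert K k := by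
  have h1 := M.sum_bary K x
  have h2 := M.sum_bary_smul_vert K x
  rw [Fin.sum_univ_three] at h1 h2
  fin_cases i <;> fin_cases j <;> simp at hij hi hj <;> simp [hi, hj] at h1 h2
  all_goals first
    | exact ⟨0, by rw [h1, one_smul] at h2; exact h2.symm⟩
    | exact ⟨1, by rw [h1, one_smul] at h2; exact h2.symm⟩
    | exact ⟨2, by rw [h1, one_smul] at h2; exact h2.symm⟩

/-! ### Outer normals and barycentric coordinates. -/

theorem inner_normalDir_tangent (s : M.Side) :
    (inner ℝ (M.normalDir s) (M.endB s - M.endA s) : ℝ) = 0 := by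
  have hne : M.endB s - M.endA s ≠ 0 := sub_ne_zero.2 fun h =>
    fin_three_add_one_ne_add_two s.2 ((M.nondegenerate s.1).injective h).symm
  have : ‖M.endB s - M.endA s‖ ^ 2 ≠ 0 := by positivity
  unfold normalDir
  rw [inner_sub_left, inner_smul_left, real_inner_self_eq_norm_sq]
  simp [div_mul_cancel₀ _ this]

theorem inner_normalDir_sub_vert (s : M.Side) :
    (inner ℝ (M.normalDir s) (M.endA s - M.vert s.1 s.2) : ℝ) = ‖M.normalDir s‖ ^ 2 := by
  have h := M.inner_normalDir_tangent s
  have h2 : M.endA s - M.vert s.1 s.2 = M.normalDir s +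
      (inner ℝ (M.endA s - M.vert s.1 s.2) (M.endB s - M.endA s) /
      ‖M.endB s - M.endA s‖ ^ 2) • (M.endB s - M.endA s) := by
    unfold normalDir; abel
  conv_lhs => rw [h2]
  rw [inner_add_right, inner_smul_right, h, real_inner_self_eq_norm_sq]
  simp

/-- Along this vector the barycentric coordinate of the opposite vertex drops from 1 to 0, because
its tangential part does not change that coordinate. -/
theorem normalDir_ne_zero (s : M.Side) : M.normalDir s ≠ 0 := by
  intro h
  have h1 : (M.bary s.1 s.2).linear (M.normalDir s) = -1 := by
    unfold normalDir
    rw [map_sub, map_smul, bary_linear_sub, bary_linear_sub, bary_endA, bary_endB, bary_vert_self]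
    simp
  rw [h, map_zero] at h1
  norm_num at h1

/-- Both sides are linear in `w`, and they agree on the tangent of the side and on the vector from
the opposite vertex to the side, which span the plane. -/
theorem bary_linear (s : M.Side) (w : Plane) :
    (M.bary s.1 s.2).linear w = -(inner ℝ (M.normalDir s) w : ℝ) / ‖M.normalDir s‖ ^ 2 := by
  have hn : ‖M.normalDir s‖ ^ 2 ≠ 0 := by
    have := norm_ne_zero_iff.2 (M.normalDir_ne_zero s)
    positivity
  set C := M.vert s.1 s.2 with hC
  have h1 := M.sum_bary s.1 (C + w)
  have h2 := M.sum_bary_smul_vert s.1 (C + w)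
  rw [sum_fin_three _ s.2] at h1 h2
  set a := M.bary s.1 s.2 (C + w) with ha
  set b := M.bary s.1 (s.2 + 1) (C + w)
  set c := M.bary s.1 (s.2 + 2) (C + w)
  have hw : w = (b + c) • (M.endA s - C) + c • (M.endB s - M.endA s) := by
    have e : w = a • C + b • M.endA s + c • M.endB s - (a + b + c) • C := by
      rw [h1, one_smul]
      change w = (a • M.vert s.1 s.2 + b • M.vert s.1 (s.2 + 1) + c • M.vert s.1 (s.2 + 2)) - C
      rw [h2]; abel
    rw [e]; module
  have h3 : (M.bary s.1 s.2).linear w = -(b + c) := by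
    have := M.bary_add s.1 s.2 C w
    rw [hC, bary_vert_self, ← hC, ← ha] at this
    linarith
  have h4 : (inner ℝ (M.normalDir s) w : ℝ) = (b + c) * ‖M.normalDir s‖ ^ 2 := by
    rw [hw, inner_add_right, inner_smul_right, inner_smul_right, inner_normalDir_tangent, hC,
      inner_normalDir_sub_vert]
    ring
  rw [h3, h4, ← neg_mul, mul_div_cancel_right₀ _ hn]

theorem norm_normal (s : M.Side) : ‖M.normal s‖ = 1 := by
  unfold normal
  rw [norm_smul, norm_inv, norm_norm, inv_mul_cancel₀ (norm_ne_zero_iff.2 (M.normalDir_ne_zero s))]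

theorem bary_linear_pos_iff (s : M.Side) (w : Plane) :
    0 < (M.bary s.1 s.2).linear w ↔ (inner ℝ (M.normal s) w : ℝ) < 0 := by
  have hn : 0 < ‖M.normalDir s‖ := norm_pos_iff.2 (M.normalDir_ne_zero s)
  rw [bary_linear, lt_div_iff₀ (by positivity), zero_mul, neg_pos]
  unfold normal
  rw [inner_smul_left]
  simp [mul_neg_iff, hn, not_lt.2 hn.le]

/-- From a relatively interior point of a side, an inward direction leads into the interior. -/
theorem eventually_add_smul_mem_interior {s : M.Side} {x w : Plane}
    (hx : M.bary s.1 s.2 x = 0) (hx' : ∀ j, j ≠ s.2 → 0 < M.bary s.1 j x)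
    (hw : (inner ℝ (M.normal s) w : ℝ) < 0) :
    ∀ᶠ ε in nhdsWithin (0 : ℝ) (Set.Ioi 0), x + ε • w ∈ interior (M.cell s.1) := by
  simp_rw [mem_interior_cell_iff]
  rw [Filter.eventually_all]
  intro j
  by_cases hj : j = s.2
  · subst hj
    filter_upwards [self_mem_nhdsWithin] with ε hε
    rw [bary_add, hx, zero_add, map_smul, smul_eq_mul]
    exact mul_pos hε ((M.bary_linear_pos_iff s w).2 hw)
  · have hc : Continuous fun ε : ℝ => M.bary s.1 j (x + ε • w) :=
      (M.continuous_bary _ _).comp (by fun_prop)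
    have : ∀ᶠ ε in nhds (0 : ℝ), 0 < M.bary s.1 j (x + ε • w) :=
      hc.continuousAt.eventually_const_lt (by simpa using hx' j hj)
    exact this.filter_mono nhdsWithin_le_nhds

/-- The normals of two sides of different triangles that meet in a relatively interior point are
opposite. -/
theorem normal_eq_neg {s s' : M.Side} (hss : s.1 ≠ s'.1) {x : Plane}
    (hx : M.bary s.1 s.2 x = 0) (hx' : ∀ j, j ≠ s.2 → 0 < M.bary s.1 j x)
    (hy : M.bary s'.1 s'.2 x = 0) (hy' : ∀ j, j ≠ s'.2 → 0 < M.bary s'.1 j x) :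
    M.normal s' = -M.normal s := by
  by_contra hne
  have h1 : (inner ℝ (M.normal s) (M.normal s') : ℝ) ≠ -1 := by
    intro h
    apply hne
    have := (inner_eq_neg_one_iff_of_norm_eq_one (𝕜 := ℝ) (M.norm_normal s) (M.norm_normal s')).1 h
    rw [this, neg_neg]
  have h2 : -1 ≤ (inner ℝ (M.normal s) (M.normal s') : ℝ) := by
    have := neg_le_of_abs_le (abs_real_inner_le_norm (M.normal s) (M.normal s'))
    rwa [norm_normal, norm_normal, mul_one] at this
  have h3 : -1 < (inner ℝ (M.normal s) (M.normal s') : ℝ) := lt_of_le_of_ne h2 (Ne.symm h1)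
  -- Unless the unit normals are opposite, the direction `-(n + n')` points strictly into both
  -- triangles, so their interiors would meet.
  have e1 := M.eventually_add_smul_mem_interior hx hx' (w := -(M.normal s + M.normal s'))
    (by rw [inner_neg_right, inner_add_right, real_inner_self_eq_norm_sq, norm_normal]; linarith)
  have e2 := M.eventually_add_smul_mem_interior hy hy' (w := -(M.normal s + M.normal s'))
    (by rw [inner_neg_right, inner_add_right, real_inner_self_eq_norm_sq, norm_normal,
          real_inner_comm]; linarith)
  obtain ⟨ε, hε⟩ := (e1.and e2).exists
  exact Set.disjoint_left.1 (M.disjoint_interior s.1 s'.1 hss) hε.1 hε.2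

/-! ### Sizes and counting -/

theorem closure_Ω_nonempty (R : Rect) : (closure R.Ω).Nonempty := by
  refine ⟨!₂[(R.a + R.b) / 2, (R.c + R.d) / 2], subset_closure ?_⟩
  have := R.hab
  have := R.hcd
  simp only [Rect.Ω, Set.mem_ofPred_eq]
  refine ⟨?_, ?_, ?_, ?_⟩ <;> simp <;> linarith

theorem nonempty_cells : Nonempty (Fin M.n) := by
  have := closure_Ω_nonempty R
  rw [← M.cover] at this
  obtain ⟨x, hx⟩ := this
  obtain ⟨K, -⟩ := Set.mem_iUnion.1 hx
  exact ⟨K⟩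

theorem diam_cell_le (K : Fin M.n) : Metric.diam (M.cell K) ≤ M.h :=
  le_ciSup (f := fun K => Metric.diam (M.cell K)) (Set.finite_range _).bddAbove K

theorem dist_le_h {K : Fin M.n} {x y : Plane} (hx : x ∈ M.cell K) (hy : y ∈ M.cell K) :
    dist x y ≤ M.h :=
  (Metric.dist_le_diam_of_mem (M.isCompact_cell K).isBounded hx hy).trans (M.diam_cell_le K)

theorem h_pos : 0 < M.h := by
  obtain ⟨K⟩ := M.nonempty_cells
  refine lt_of_lt_of_le ?_ (M.dist_le_h (M.vert_mem_cell K 0) (M.vert_mem_cell K 1))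
  exact dist_pos.2 ((M.nondegenerate K).injective.ne (by decide))

theorem bary_le_one {K : Fin M.n} {x : Plane} (hx : x ∈ M.cell K) (i : Fin 3) :
    M.bary K i x ≤ 1 := by
  rw [← M.sum_bary K x]
  exact Finset.single_le_sum (f := fun i => M.bary K i x)
    (fun j _ => M.mem_cell_iff.1 hx j) (Finset.mem_univ i)

variable {M}

/-- The sides of a quasi-uniform mesh are not short. -/
theorem QuasiUniform.le_dist {ρ : ℝ} (hM : M.QuasiUniform ρ) (hρ : 0 < ρ) (s : M.Side) :
    ρ * M.h / 2 ≤ dist (M.endA s) (M.endB s) := by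
  obtain ⟨z, hz⟩ := hM s.1
  have hr : 0 < ρ * M.h / 2 := by have := M.h_pos; positivity
  set r := ρ * M.h / 2
  have hl : 0 < ‖M.endB s - M.endA s‖ := norm_pos_iff.2 <| sub_ne_zero.2 fun h =>
    fin_three_add_one_ne_add_two s.2 ((M.nondegenerate s.1).injective h).symm
  rw [dist_comm, dist_eq_norm]
  set l := ‖M.endB s - M.endA s‖
  have hmem : ∀ ε : ℝ, |ε| < r / l → z + ε • (M.endB s - M.endA s) ∈ M.cell s.1 := fun ε hε => by
    apply hz
    rw [mem_ball_iff_norm, add_sub_cancel_left, norm_smul, Real.norm_eq_abs]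
    rwa [lt_div_iff₀ hl] at hε
  have hrl : 0 < r / l := by positivity
  -- Between these two points of the disc, on a line parallel to the side, the barycentric
  -- coordinate of the first end point varies by `r / l`. It stays in `[0, 1]` on the triangle,
  -- hence `r ≤ l`.
  have h1 := hmem (r / l / 2) (by rw [abs_of_pos (by positivity)]; linarith)
  have h2 := hmem (-(r / l / 2)) (by rw [abs_neg, abs_of_pos (by positivity)]; linarith)
  have h3 := M.bary_le_one h2 (s.2 + 1)
  have h4 := M.mem_cell_iff.1 h1 (s.2 + 1)
  have h5 : (M.bary s.1 (s.2 + 1)).linear (M.endB s - M.endA s) = -1 := by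
    rw [bary_linear_sub]
    unfold endA endB
    rw [bary_vert_self, bary_vert_of_ne _ _ (fin_three_add_one_ne_add_two _)]
    norm_num
  rw [bary_add, map_smul, h5] at h3 h4
  simp only [smul_eq_mul] at h3 h4
  have : r / l ≤ 1 := by linarith
  rwa [div_le_one hl] at this

/-- The inscribed discs are open, so they lie in the disjoint interiors of the triangles and can be
packed into `Z` only by volume. -/
theorem QuasiUniform.card_mul_volume_le {ρ : ℝ} (hM : M.QuasiUniform ρ)
    (S : Finset (Fin M.n)) (Z : Set Plane) (hS : ∀ K ∈ S, M.cell K ⊆ Z) :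
    (S.card : ENNReal) * volume (Metric.ball (0 : Plane) (ρ * M.h / 2)) ≤ volume Z := by
  choose z hz using hM
  have hdisj : Set.PairwiseDisjoint (S : Set (Fin M.n))
      (fun K => Metric.ball (z K) (ρ * M.h / 2)) := fun K _ L _ hKL =>
    (M.disjoint_interior K L hKL).mono (interior_maximal (hz K) Metric.isOpen_ball)
      (interior_maximal (hz L) Metric.isOpen_ball)
  calc (S.card : ENNReal) * volume (Metric.ball (0 : Plane) (ρ * M.h / 2))
      = ∑ K ∈ S, volume (Metric.ball (z K) (ρ * M.h / 2)) := by
        simp_rw [Measure.addHaar_ball_center volume (z _)]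
        rw [Finset.sum_const, nsmul_eq_mul]
    _ = volume (⋃ K ∈ S, Metric.ball (z K) (ρ * M.h / 2)) :=
        (measure_biUnion_finset hdisj fun _ _ => measurableSet_ball).symm
    _ ≤ volume Z := measure_mono (Set.iUnion₂_subset fun K hK => (hz K).trans (hS K hK))

/-- The number of triangles that meet a disc of radius `h` is bounded. -/
theorem QuasiUniform.card_near_le {ρ : ℝ} (hM : M.QuasiUniform ρ) (hρ : 0 < ρ)
    (S : Finset (Fin M.n)) (x : Plane) (hS : ∀ K ∈ S, ∃ y ∈ M.cell K, dist y x ≤ M.h) :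
    (S.card : ℝ) ≤ 16 / ρ ^ 2 := by
  have hh := M.h_pos
  have h1 := hM.card_mul_volume_le S (Metric.closedBall x (2 * M.h)) fun K hK w hw => by
    obtain ⟨y, hy, hyx⟩ := hS K hK
    rw [Metric.mem_closedBall]
    have := M.dist_le_h hw hy
    linarith [dist_triangle w y x]
  -- The constant is the ratio of areas `(2h)² / (ρh/2)² = 16 / ρ²`.
  rw [Measure.addHaar_closedBall _ _ (by positivity), Measure.addHaar_ball _ _ (by positivity),
    ← mul_assoc, ENNReal.mul_le_mul_iff_left (Metric.measure_ball_pos _ _ one_pos).ne'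
      measure_ball_lt_top.ne, finrank_euclideanSpace, Fintype.card_fin, ← ENNReal.ofReal_natCast,
    ← ENNReal.ofReal_mul (by positivity), ENNReal.ofReal_le_ofReal_iff (by positivity)] at h1
  rw [le_div_iff₀ (by positivity)]
  have h2 : 0 < M.h ^ 2 := by positivity
  nlinarith

end Mesh

end DynBC

/-! ### Coercivity of the interior penalty form -/

namespace DynBC

namespace Mesh

variable {R : Rect} {M : Mesh R} {p : ℕ}

theorem continuous_val (v : M.V p) (K : Fin M.n) : Continuous (val v K) :=
  continuous_eval_plane _

theorem continuous_grad (v : M.V p) (K : Fin M.n) : Continuous (grad v K) := by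
  unfold grad
  refine (PiLp.continuous_toLp 2 _).comp (continuous_pi fun i => ?_)
  fin_cases i
  · exact continuous_eval_plane _
  · exact continuous_eval_plane _

theorem continuous_tgrad (v : M.V p) (s : M.Side) : Continuous (tgrad v s) := by
  have := continuous_grad v s.1
  unfold tgrad
  fun_prop

theorem continuous_jump (v : M.V p) (τ : Plane) (s s' : M.Side) : Continuous (jump v τ s s') := by
  have h1 := continuous_val v s.1
  have h2 := continuous_val v s'.1
  unfold jump
  fun_prop

theorem continuous_avgGrad (v : M.V p) (τ : Plane) (s s' : M.Side) :
    Continuous (avgGrad v τ s s') := by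
  have h1 := continuous_grad v s.1
  have h2 := continuous_grad v s'.1
  unfold avgGrad
  fun_prop

/-! ### Integrals over the skeleton. -/

theorem intervalIntegrable_edge (τ : Plane) (s s' : M.Side) {φ : Plane → ℝ} (hφ : Continuous φ) :
    IntervalIntegrable (fun r : ℝ => open Classical in
      (fun x => if x + τ ∈ M.seg s' then φ x else 0)
        (AffineMap.lineMap (M.endA s) (M.endB s) r)) volume 0 1 := by
  classical
  have hc : Continuous fun r : ℝ => φ (AffineMap.lineMap (M.endA s) (M.endB s) r) :=
    hφ.comp AffineMap.lineMap_continuous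
  have hm : MeasurableSet {r : ℝ | AffineMap.lineMap (M.endA s) (M.endB s) r + τ ∈ M.seg s'} :=
    ((M.isClosed_seg s').preimage (by fun_prop)).measurableSet
  have := (hc.intervalIntegrable (μ := volume) 0 1).1.indicator hm
  rw [intervalIntegrable_iff_integrableOn_Ioc_of_le zero_le_one]
  refine Integrable.congr this (Filter.Eventually.of_forall fun r => ?_)
  simp [Set.indicator_apply]

theorem edgeIntegral_le_combination (τ : Plane) (s s' : M.Side) {φ ψ χ : Plane → ℝ} {c d : ℝ}
    (hφ : Continuous φ) (hψ : Continuous ψ) (hχ : Continuous χ)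
    (hle : ∀ x, φ x ≤ c * ψ x + d * χ x) :
    M.edgeIntegral τ s s' φ ≤ c * M.edgeIntegral τ s s' ψ + d * M.edgeIntegral τ s s' χ := by
  unfold edgeIntegral sideIntegral
  have i1 := intervalIntegrable_edge τ s s' hφ
  have i2 := intervalIntegrable_edge τ s s' hψ
  have i3 := intervalIntegrable_edge τ s s' hχ
  rw [mul_left_comm c, mul_left_comm d, ← mul_add]
  refine mul_le_mul_of_nonneg_left ?_ dist_nonneg
  rw [← intervalIntegral.integral_const_mul, ← intervalIntegral.integral_const_mul,
    ← intervalIntegral.integral_add (i2.const_mul c) (i3.const_mul d)]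
  refine intervalIntegral.integral_mono_on zero_le_one i1
    ((i2.const_mul c).add (i3.const_mul d)) fun r _ => ?_
  dsimp only
  split_ifs
  · exact hle _
  · simp

theorem skeletonSum_le_combination {φ ψ χ : Plane → M.Side → M.Side → Plane → ℝ} {c d : ℝ}
    (hφ : ∀ τ s s', Continuous (φ τ s s')) (hψ : ∀ τ s s', Continuous (ψ τ s s'))
    (hχ : ∀ τ s s', Continuous (χ τ s s'))
    (hle : ∀ τ s s' x, φ τ s s' x ≤ c * ψ τ s s' x + d * χ τ s s' x) :
    M.skeletonSum φ ≤ c * M.skeletonSum ψ + d * M.skeletonSum χ := by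
  have key : ∀ (τ : Plane) (Q : Finset (M.Side × M.Side)),
      ∑ q ∈ Q, M.edgeIntegral τ q.1 q.2 (φ τ q.1 q.2) ≤
        c * ∑ q ∈ Q, M.edgeIntegral τ q.1 q.2 (ψ τ q.1 q.2) +
          d * ∑ q ∈ Q, M.edgeIntegral τ q.1 q.2 (χ τ q.1 q.2) := fun τ Q => by
    rw [Finset.mul_sum, Finset.mul_sum, ← Finset.sum_add_distrib]
    exact Finset.sum_le_sum fun q _ => edgeIntegral_le_combination τ q.1 q.2 (hφ _ _ _) (hψ _ _ _)
      (hχ _ _ _) (hle _ _ _)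
  unfold skeletonSum
  linarith [key 0 M.interiorPairs, key R.period M.periodicPairs]

theorem sideIntegral_nonneg (s : M.Side) {φ : Plane → ℝ} (h : ∀ x, 0 ≤ φ x) :
    0 ≤ M.sideIntegral s φ :=
  mul_nonneg dist_nonneg (intervalIntegral.integral_nonneg zero_le_one fun _ _ => h _)

theorem edgeIntegral_nonneg (τ : Plane) (s s' : M.Side) {φ : Plane → ℝ} (h : ∀ x, 0 ≤ φ x) :
    0 ≤ M.edgeIntegral τ s s' φ :=
  sideIntegral_nonneg s fun x => by split_ifs; exacts [h x, le_rfl]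

theorem skeletonSum_nonneg {φ : Plane → M.Side → M.Side → Plane → ℝ}
    (h : ∀ τ s s' x, 0 ≤ φ τ s s' x) : 0 ≤ M.skeletonSum φ :=
  add_nonneg (Finset.sum_nonneg fun _ _ => edgeIntegral_nonneg _ _ _ (h _ _ _))
    (Finset.sum_nonneg fun _ _ => edgeIntegral_nonneg _ _ _ (h _ _ _))

theorem lineMap_mem_seg (s : M.Side) {r : ℝ} (hr : r ∈ Set.Icc (0 : ℝ) 1) :
    AffineMap.lineMap (M.endA s) (M.endB s) r ∈ M.seg s := by
  unfold seg
  rw [segment_eq_image_lineMap]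
  exact ⟨r, hr, rfl⟩

/-- An edge integral is bounded by a bound of the integrand times the mesh size. -/
theorem edgeIntegral_le (τ : Plane) (s s' : M.Side) {φ : Plane → ℝ} (hφ : Continuous φ) {c : ℝ}
    (hc : 0 ≤ c) (h : ∀ x ∈ M.seg s, x + τ ∈ M.seg s' → φ x ≤ c) :
    M.edgeIntegral τ s s' φ ≤ M.h * c := by
  unfold edgeIntegral sideIntegral
  have h1 : (∫ r in (0 : ℝ)..1, open Classical in
      (fun x => if x + τ ∈ M.seg s' then φ x else 0)
        (AffineMap.lineMap (M.endA s) (M.endB s) r)) ≤ ∫ r in (0 : ℝ)..1, c := by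
    refine intervalIntegral.integral_mono_on zero_le_one (intervalIntegrable_edge τ s s' hφ)
      intervalIntegrable_const fun r hr => ?_
    dsimp only
    split_ifs with hs
    · exact h _ (lineMap_mem_seg s hr) hs
    · exact hc
  rw [intervalIntegral.integral_const, sub_zero, one_smul] at h1
  calc _ ≤ dist (M.endA s) (M.endB s) * c := mul_le_mul_of_nonneg_left h1 dist_nonneg
    _ ≤ M.h * c := mul_le_mul_of_nonneg_right
      (M.dist_le_h (M.endA_mem_cell s) (M.endB_mem_cell s)) hc

theorem edgeIntegral_eq_zero (τ : Plane) (s s' : M.Side) (φ : Plane → ℝ)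
    (h : ∀ x ∈ M.seg s, x + τ ∉ M.seg s') : M.edgeIntegral τ s s' φ = 0 := by
  unfold edgeIntegral sideIntegral
  rw [mul_eq_zero]
  right
  rw [intervalIntegral.integral_congr (g := fun _ => 0), intervalIntegral.integral_zero]
  intro r hr
  rw [Set.uIcc_of_le zero_le_one] at hr
  simp [h _ (lineMap_mem_seg s hr)]

/-- A fixed first side is paired with sides of triangles that meet the shifted triangle of that
side. There are at most `16 / ρ²` such triangles, with three sides each. -/
theorem QuasiUniform.sum_fst_le {ρ : ℝ} (hM : M.QuasiUniform ρ) (hρ : 0 < ρ) (τ : Plane)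
    (Q : Finset (M.Side × M.Side)) (hQ : ∀ q ∈ Q, ∃ x ∈ M.cell q.1.1, x + τ ∈ M.cell q.2.1)
    (b : M.Side → ℝ) (hb : ∀ s, 0 ≤ b s) :
    ∑ q ∈ Q, b q.1 ≤ 48 / ρ ^ 2 * ∑ s, b s := by
  classical
  rw [← Finset.sum_fiberwise Q (fun q => q.1), Finset.mul_sum]
  refine Finset.sum_le_sum fun s _ => ?_
  rw [Finset.sum_congr rfl (g := fun _ => b s)
    (fun q hq => by rw [(Finset.mem_filter.1 hq).2]), Finset.sum_const, nsmul_eq_mul]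
  refine mul_le_mul_of_nonneg_right ?_ (hb s)
  let S : Finset (Fin M.n) :=
    Finset.univ.filter fun L => ∃ x ∈ M.cell s.1, x + τ ∈ M.cell L
  have h1 : (Q.filter fun q => q.1 = s).card ≤ (S ×ˢ (Finset.univ : Finset (Fin 3))).card := by
    refine Finset.card_le_card_of_injOn (fun q => q.2) (fun q hq => ?_) fun q hq q' hq' h => ?_
    · have hq := Finset.mem_filter.1 hq
      obtain ⟨x, hx, hx'⟩ := hQ q hq.1
      rw [hq.2] at hx
      simp only [Finset.coe_product, Set.mem_prod, Finset.mem_coe, S, Finset.mem_filter,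
        Finset.mem_univ, true_and, and_true]
      exact ⟨x, hx, hx'⟩
    · have hq := (Finset.mem_filter.1 hq).2
      have hq' := (Finset.mem_filter.1 hq').2
      exact Prod.ext (hq.trans hq'.symm) h
  have h2 := hM.card_near_le hρ S (M.endA s + τ) fun L hL => by
    obtain ⟨x, hx, hx'⟩ := (Finset.mem_filter.1 hL).2
    refine ⟨x + τ, hx', ?_⟩
    rw [dist_add_right]
    exact M.dist_le_h hx (M.endA_mem_cell s)
  rw [Finset.card_product, Finset.card_fin] at h1
  have h3 : ((Q.filter fun q => q.1 = s).card : ℝ) ≤ S.card * 3 := by exact_mod_cast h1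
  calc _ ≤ (S.card : ℝ) * 3 := h3
    _ ≤ 16 / ρ ^ 2 * 3 := by gcongr
    _ = 48 / ρ ^ 2 := by ring

/-- Every side meets a bounded number of other sides. -/
theorem QuasiUniform.sum_add_le {ρ : ℝ} (hM : M.QuasiUniform ρ) (hρ : 0 < ρ) (τ : Plane)
    (Q : Finset (M.Side × M.Side)) (hQ : ∀ q ∈ Q, ∃ x ∈ M.cell q.1.1, x + τ ∈ M.cell q.2.1)
    (b : M.Side → ℝ) (hb : ∀ s, 0 ≤ b s) :
    ∑ q ∈ Q, (b q.1 + b q.2) ≤ 96 / ρ ^ 2 * ∑ s, b s := by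
  classical
  have h1 := hM.sum_fst_le hρ τ Q hQ b hb
  -- The second components become first components when the pairs are swapped and the shift is
  -- reversed.
  have h2 := hM.sum_fst_le hρ (-τ) (Q.map (Equiv.prodComm _ _).toEmbedding) (fun q hq => by
    obtain ⟨q', hq', rfl⟩ := Finset.mem_map.1 hq
    obtain ⟨x, hx, hx'⟩ := hQ q' hq'
    exact ⟨x + τ, hx', by simpa using hx⟩) b hb
  rw [Finset.sum_map] at h2
  simp only [Equiv.coe_toEmbedding, Equiv.prodComm_apply, Prod.fst_swap] at h2
  rw [Finset.sum_add_distrib]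
  calc _ ≤ 48 / ρ ^ 2 * ∑ s, b s + 48 / ρ ^ 2 * ∑ s, b s := add_le_add h1 h2
    _ = _ := by ring

theorem norm_sq_eq_sum_two (x : Plane) : ‖x‖ ^ 2 = x 0 ^ 2 + x 1 ^ 2 := by
  rw [EuclideanSpace.norm_sq_eq, Fin.sum_univ_two]
  simp

theorem totalDegree_le (v : M.V p) (K : Fin M.n) :
    (v K : MvPolynomial (Fin 2) ℝ).totalDegree ≤ p :=
  (MvPolynomial.mem_restrictTotalDegree _ _ _).1 (v K).2

theorem integrableOn_cell {E : Type*} [NormedAddCommGroup E] {φ : Plane → E} (hφ : Continuous φ)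
    (K : Fin M.n) : IntegrableOn φ (M.cell K) :=
  hφ.continuousOn.integrableOn_compact (M.isCompact_cell K)

/-- Inverse estimate for the gradient on a triangle. -/
theorem exists_grad_sq_le (p : ℕ) {ρ : ℝ} (hρ : 0 < ρ) : ∃ C : ℝ, 0 < C ∧
    ∀ (R : Rect) (M : Mesh R), M.QuasiUniform ρ → ∀ (v : M.V p) (K : Fin M.n), ∀ y ∈ M.cell K,
      ‖grad v K y‖ ^ 2 ≤ C / M.h ^ 2 * ∫ x in M.cell K, ‖grad v K x‖ ^ 2 := by
  obtain ⟨C, hC, H⟩ := exists_mvPolynomial_sq_le p hρ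
  refine ⟨C, hC, fun R M hM v K y hy => ?_⟩
  obtain ⟨z, hz⟩ := hM K
  have hh := M.h_pos
  have hzK : z ∈ M.cell K := hz (Metric.mem_ball_self (by positivity))
  have key : ∀ i : Fin 2, (grad v K y i) ^ 2 ≤
      C / M.h ^ 2 * ∫ x in M.cell K, (grad v K x i) ^ 2 := fun i => by
    have := H (MvPolynomial.pderiv i (v K : MvPolynomial (Fin 2) ℝ))
      ((totalDegree_pderiv_le i _).trans (totalDegree_le v K)) M.h hh z (M.cell K)
      (M.isCompact_cell K) hz (fun x hx => M.dist_le_h hx hzK) y hy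
    fin_cases i <;> simpa [grad] using this
  have hi : ∀ i : Fin 2, IntegrableOn (fun x => (grad v K x i) ^ 2) (M.cell K) := fun i => by
    have h1 : Continuous fun x => grad v K x i :=
      (EuclideanSpace.proj (𝕜 := ℝ) i).continuous.comp (continuous_grad v K)
    exact integrableOn_cell (h1.pow 2) K
  simp_rw [norm_sq_eq_sum_two]
  rw [integral_add (hi 0) (hi 1), mul_add]
  exact add_le_add (key 0) (key 1)

theorem norm_avgGrad_sq_le (v : M.V p) (τ : Plane) (s s' : M.Side) (x : Plane) :
    ‖avgGrad v τ s s' x‖ ^ 2 ≤ ‖grad v s.1 x‖ ^ 2 + ‖grad v s'.1 (x + τ)‖ ^ 2 := by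
  unfold avgGrad
  rw [norm_smul, mul_pow]
  have := norm_add_le (grad v s.1 x) (grad v s'.1 (x + τ))
  have h2 : ‖grad v s.1 x + grad v s'.1 (x + τ)‖ ^ 2 ≤
      (‖grad v s.1 x‖ + ‖grad v s'.1 (x + τ)‖) ^ 2 := by gcongr
  norm_num
  nlinarith [sq_nonneg (‖grad v s.1 x‖ - ‖grad v s'.1 (x + τ)‖)]

/-- The averages of the gradient on the skeleton are controlled by the gradient. -/
theorem exists_skeletonSum_avgGrad_le (p : ℕ) {ρ : ℝ} (hρ : 0 < ρ) : ∃ C : ℝ, 0 < C ∧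
    ∀ (R : Rect) (M : Mesh R), M.QuasiUniform ρ → ∀ v : M.V p,
      M.skeletonSum (fun τ s s' x => ‖avgGrad v τ s s' x‖ ^ 2) ≤
        C / M.h * ∑ K, ∫ x in M.cell K, ‖grad v K x‖ ^ 2 := by
  classical
  obtain ⟨C, hC, H⟩ := exists_grad_sq_le p hρ
  -- Here `576 = 2 · 3 · 96`: the counting bound `96 / ρ²`, three sides per triangle, and one
  -- contribution each from the interior and the periodic pairs.
  refine ⟨C * (576 / ρ ^ 2), by positivity, fun R M hM v => ?_⟩
  have hh := M.h_pos
  set D : Fin M.n → ℝ := fun K => ∫ x in M.cell K, ‖grad v K x‖ ^ 2 with hD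
  have hD0 : ∀ K, 0 ≤ D K := fun K => integral_nonneg fun _ => sq_nonneg _
  have hsum : ∑ s : M.Side, D s.1 = 3 * ∑ K, D K := by
    rw [Fintype.sum_prod_type, Finset.mul_sum]
    simp
  have key : ∀ (τ : Plane) (Q : Finset (M.Side × M.Side)),
      ∑ q ∈ Q, M.edgeIntegral τ q.1 q.2 (fun x => ‖avgGrad v τ q.1 q.2 x‖ ^ 2) ≤
        C / M.h * (288 / ρ ^ 2 * ∑ K, D K) := fun τ Q => by
    -- Pairs of sides that do not meet contribute nothing to the integrals, and only pairs that meet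
    -- can be counted.
    let Q' := Q.filter fun q => ∃ x ∈ M.seg q.1, x + τ ∈ M.seg q.2
    have h1 : ∑ q ∈ Q, M.edgeIntegral τ q.1 q.2 (fun x => ‖avgGrad v τ q.1 q.2 x‖ ^ 2) =
        ∑ q ∈ Q', M.edgeIntegral τ q.1 q.2 (fun x => ‖avgGrad v τ q.1 q.2 x‖ ^ 2) := by
      symm
      refine Finset.sum_subset (Finset.filter_subset _ _) fun q hq hq' => ?_
      refine edgeIntegral_eq_zero _ _ _ _ fun x hx hx' => hq' (Finset.mem_filter.2 ⟨hq, x, hx, hx'⟩)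
    have h2 : ∀ q ∈ Q', M.edgeIntegral τ q.1 q.2 (fun x => ‖avgGrad v τ q.1 q.2 x‖ ^ 2) ≤
        C / M.h * (D q.1.1 + D q.2.1) := fun q hq => by
      have hc := continuous_avgGrad v τ q.1 q.2
      have := edgeIntegral_le τ q.1 q.2 (φ := fun x => ‖avgGrad v τ q.1 q.2 x‖ ^ 2) (by fun_prop)
        (c := C / M.h ^ 2 * (D q.1.1 + D q.2.1))
        (mul_nonneg (by positivity) (add_nonneg (hD0 _) (hD0 _))) fun x hx hx' => by
          rw [mul_add]
          exact (norm_avgGrad_sq_le v τ q.1 q.2 x).trans (add_le_add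
            (H R M hM v _ _ (M.seg_subset_cell _ hx)) (H R M hM v _ _ (M.seg_subset_cell _ hx')))
      refine this.trans (le_of_eq ?_)
      field_simp
    have h3 := hM.sum_add_le hρ τ Q' (fun q hq => by
      obtain ⟨x, hx, hx'⟩ := (Finset.mem_filter.1 hq).2
      exact ⟨x, M.seg_subset_cell _ hx, M.seg_subset_cell _ hx'⟩) (fun s => D s.1) fun s => hD0 _
    rw [h1]
    refine (Finset.sum_le_sum h2).trans ?_
    rw [← Finset.mul_sum]
    refine mul_le_mul_of_nonneg_left (h3.trans (le_of_eq ?_)) (by positivity)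
    rw [hsum]; ring
  have k1 := key 0 M.interiorPairs
  have k2 := key R.period M.periodicPairs
  unfold skeletonSum
  calc _ ≤ C / M.h * (288 / ρ ^ 2 * ∑ K, D K) + C / M.h * (288 / ρ ^ 2 * ∑ K, D K) :=
        add_le_add k1 k2
    _ = _ := by ring

theorem real_inner_le_young (a b : Plane) {σ : ℝ} (hσ : 0 < σ) :
    (inner ℝ a b : ℝ) ≤ σ / 4 * ‖a‖ ^ 2 + 1 / σ * ‖b‖ ^ 2 := by
  have h1 := real_inner_le_norm a b
  have h2 : ‖a‖ * ‖b‖ ≤ σ / 4 * ‖a‖ ^ 2 + 1 / σ * ‖b‖ ^ 2 := by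
    have h3 : σ / 4 * ‖a‖ ^ 2 + 1 / σ * ‖b‖ ^ 2 - ‖a‖ * ‖b‖ =
        (σ / 2 * ‖a‖ - ‖b‖) ^ 2 / σ := by field_simp; ring
    have h4 : 0 ≤ (σ / 2 * ‖a‖ - ‖b‖) ^ 2 / σ := by positivity
    linarith
  exact h1.trans h2

/-- Coercivity in the bulk. -/
theorem exists_bulk_coercive (p : ℕ) {ρ : ℝ} (hρ : 0 < ρ) : ∃ γ₀ : ℝ, 0 < γ₀ ∧
    ∀ (R : Rect) (M : Mesh R), M.QuasiUniform ρ → ∀ γ, γ₀ ≤ γ → ∀ v : M.V p,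
      1 / 2 * bulkNormSq (γ / M.h) v ≤ bulkForm (γ / M.h) v v := by
  obtain ⟨C, hC, H⟩ := exists_skeletonSum_avgGrad_le p hρ
  -- Write `D`, `J`, `G` for the gradient, jump and average terms. Young's inequality leaves `D +
  -- σJ/2 - 2G/σ` in the form, so half of the norm is reached as soon as `G/σ ≤ D/5`; the factor
  -- `10` gives `D/10`.
  refine ⟨10 * C, by positivity, fun R M hM γ hγ v => ?_⟩
  have hh := M.h_pos
  have hγ0 : 0 < γ := lt_of_lt_of_le (by positivity) hγ
  have hσ : 0 < γ / M.h := by positivity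
  set σ := γ / M.h with hσd
  have hX := skeletonSum_le_combination (M := M) (c := σ / 4) (d := 1 / σ)
    (φ := fun τ s s' x => inner ℝ (jump v τ s s' x) (avgGrad v τ s s' x))
    (ψ := fun τ s s' x => ‖jump v τ s s' x‖ ^ 2)
    (χ := fun τ s s' x => ‖avgGrad v τ s s' x‖ ^ 2)
    (fun τ s s' => by
      have h1 := continuous_jump v τ s s'
      have h2 := continuous_avgGrad v τ s s'
      fun_prop)
    (fun τ s s' => by have h1 := continuous_jump v τ s s'; fun_prop)
    (fun τ s s' => by have h1 := continuous_avgGrad v τ s s'; fun_prop)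
    (fun τ s s' x => real_inner_le_young _ _ hσ)
  have hG := H R M hM v
  have hJ0 : 0 ≤ M.skeletonSum (fun τ s s' x => ‖jump v τ s s' x‖ ^ 2) :=
    skeletonSum_nonneg fun _ _ _ _ => sq_nonneg _
  have hD0 : 0 ≤ ∑ K, ∫ x in M.cell K, ‖grad v K x‖ ^ 2 :=
    Finset.sum_nonneg fun _ _ => integral_nonneg fun _ => sq_nonneg _
  unfold bulkForm bulkNormSq
  simp only [real_inner_self_eq_norm_sq]
  set D := ∑ K, ∫ x in M.cell K, ‖grad v K x‖ ^ 2
  set J := M.skeletonSum (fun τ s s' x => ‖jump v τ s s' x‖ ^ 2)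
  set G := M.skeletonSum (fun τ s s' x => ‖avgGrad v τ s s' x‖ ^ 2)
  have hG' : 1 / σ * G ≤ 1 / 10 * D := by
    calc 1 / σ * G ≤ 1 / σ * (C / M.h * D) := by gcongr
      _ = C / γ * D := by rw [hσd]; field_simp
      _ ≤ 1 / 10 * D := by
        refine mul_le_mul_of_nonneg_right ?_ hD0
        rw [div_le_div_iff₀ hγ0 (by norm_num)]
        linarith
  have hσJ : 0 ≤ σ * J := by positivity
  linarith

/-! #### Coercivity on the boundary -/

theorem grad_apply (v : M.V p) (K : Fin M.n) (x : Plane) (i : Fin 2) : grad v K x i =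
    MvPolynomial.eval (fun i => x i) (MvPolynomial.pderiv i (v K : MvPolynomial (Fin 2) ℝ)) := by
  fin_cases i <;> rfl

/-- The normal is constant along a side, so the tangential projection only forms linear combinations
of the partial derivatives. This makes the one-dimensional inverse estimate applicable to each
component. -/
theorem exists_tgrad_eq_eval (v : M.V p) (s : M.Side) (i : Fin 2) :
    ∃ q : MvPolynomial (Fin 2) ℝ, q.totalDegree ≤ p ∧
      ∀ x, tgrad v s x i = MvPolynomial.eval (fun i => x i) q := by
  have hmem : ∀ j, MvPolynomial.pderiv j (v s.1 : MvPolynomial (Fin 2) ℝ) ∈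
      MvPolynomial.restrictTotalDegree (Fin 2) ℝ p := fun j =>
    (MvPolynomial.mem_restrictTotalDegree _ _ _).2
      ((totalDegree_pderiv_le j _).trans (totalDegree_le v s.1))
  refine ⟨MvPolynomial.pderiv i (v s.1 : MvPolynomial (Fin 2) ℝ) -
    ((M.normal s i * M.normal s 0) • MvPolynomial.pderiv 0 (v s.1 : MvPolynomial (Fin 2) ℝ) +
      (M.normal s i * M.normal s 1) • MvPolynomial.pderiv 1 (v s.1 : MvPolynomial (Fin 2) ℝ)),
    (MvPolynomial.mem_restrictTotalDegree _ _ _).1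
      (sub_mem (hmem i) (add_mem (Submodule.smul_mem _ _ (hmem 0))
        (Submodule.smul_mem _ _ (hmem 1)))), fun x => ?_⟩
  unfold tgrad
  rw [PiLp.sub_apply, PiLp.smul_apply, grad_apply, PiLp.inner_apply, Fin.sum_univ_two]
  simp only [grad_apply, RCLike.inner_apply, conj_trivial, smul_eq_mul, map_sub, map_add,
    MvPolynomial.smul_eval]
  ring

theorem exists_polynomial_eval_lineMap (A B : Plane) (q : MvPolynomial (Fin 2) ℝ) :
    ∃ P : Polynomial ℝ, P.natDegree ≤ q.totalDegree ∧
      ∀ r : ℝ, MvPolynomial.eval (fun i => (AffineMap.lineMap A B r : Plane) i) q = P.eval r := by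
  refine ⟨MvPolynomial.aeval
    (fun i => (Polynomial.C (A i) + Polynomial.C (B i - A i) * Polynomial.X)) q, ?_, fun r => ?_⟩
  · have := MvPolynomial.aeval_natDegree_le (n := 1) q le_rfl
      (fun i => (Polynomial.C (A i) + Polynomial.C (B i - A i) * Polynomial.X)) fun i => by
        refine (Polynomial.natDegree_add_le _ _).trans (max_le (by simp) ?_)
        exact (Polynomial.natDegree_C_mul_le _ _).trans Polynomial.natDegree_X_le
    rwa [mul_one] at this
  · induction q using MvPolynomial.induction_on with
    | C a => simp
    | add a b ha hb => rw [map_add, map_add, Polynomial.eval_add, ha, hb]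
    | mul_X a i ha =>
      rw [map_mul, map_mul, Polynomial.eval_mul, ha]
      simp [AffineMap.lineMap_apply]
      left; ring

/-- Inverse estimate for the tangential gradient on a side. -/
theorem exists_tgrad_sq_le (p : ℕ) {ρ : ℝ} (hρ : 0 < ρ) : ∃ C : ℝ, 0 < C ∧
    ∀ (R : Rect) (M : Mesh R), M.QuasiUniform ρ → ∀ (v : M.V p) (s : M.Side), ∀ y ∈ M.seg s,
      ‖tgrad v s y‖ ^ 2 ≤ C / M.h * M.sideIntegral s (fun x => ‖tgrad v s x‖ ^ 2) := by
  obtain ⟨C, hC, H⟩ := exists_polynomial_sq_le p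
  refine ⟨C * (2 / ρ), by positivity, fun R M hM v s y hy => ?_⟩
  have hh := M.h_pos
  unfold seg at hy
  rw [segment_eq_image_lineMap] at hy
  obtain ⟨t, ht, rfl⟩ := hy
  have hcont : Continuous fun r : ℝ => tgrad v s (AffineMap.lineMap (M.endA s) (M.endB s) r) :=
    (continuous_tgrad v s).comp AffineMap.lineMap_continuous
  have key : ∀ i : Fin 2, (tgrad v s (AffineMap.lineMap (M.endA s) (M.endB s) t) i) ^ 2 ≤
      C * ∫ r in (0 : ℝ)..1, (tgrad v s (AffineMap.lineMap (M.endA s) (M.endB s) r) i) ^ 2 :=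
    fun i => by
      obtain ⟨q, hq, hev⟩ := exists_tgrad_eq_eval v s i
      obtain ⟨P, hP, hPe⟩ := exists_polynomial_eval_lineMap (M.endA s) (M.endB s) q
      simp_rw [hev, hPe]
      exact H P (hP.trans hq) t ht
  have h1 : ‖tgrad v s (AffineMap.lineMap (M.endA s) (M.endB s) t)‖ ^ 2 ≤
      C * ∫ r in (0 : ℝ)..1, ‖tgrad v s (AffineMap.lineMap (M.endA s) (M.endB s) r)‖ ^ 2 := by
    simp_rw [norm_sq_eq_sum_two]
    rw [intervalIntegral.integral_add
      (Continuous.intervalIntegrable (by fun_prop) 0 1)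
      (Continuous.intervalIntegrable (by fun_prop) 0 1), mul_add]
    exact add_le_add (key 0) (key 1)
  refine h1.trans ?_
  -- The passage from the parameter interval to arc length divides by the length of the side, which
  -- is at least `ρ h / 2`.
  unfold sideIntegral
  have hl := hM.le_dist hρ s
  set I := ∫ r in (0 : ℝ)..1, ‖tgrad v s (AffineMap.lineMap (M.endA s) (M.endB s) r)‖ ^ 2
  have hI : 0 ≤ I := intervalIntegral.integral_nonneg zero_le_one fun _ _ => sq_nonneg _
  calc C * I = C * (2 / ρ) / M.h * (ρ * M.h / 2 * I) := by field_simp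
    _ ≤ _ := by gcongr

theorem Γ₁Sides_height {s : M.Side} (hs : s ∈ M.Γ₁Sides) :
    (M.endA s 1 = R.c ∨ M.endA s 1 = R.d) ∧ M.endA s 1 = M.endB s 1 := by
  classical
  have hsub : M.seg s ⊆ R.Γ₁ := (Finset.mem_filter.1 hs).2
  have h1 := (hsub (left_mem_segment ℝ (M.endA s) (M.endB s))).2.2
  have h2 := (hsub (right_mem_segment ℝ (M.endA s) (M.endB s))).2.2
  -- The midpoint excludes a segment that runs from the bottom to the top: its height would be
  -- strictly between `c` and `d`.
  have h3 := (hsub (lineMap_mem_seg s (r := 1 / 2) (by norm_num))).2.2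
  have hcd := R.hcd
  refine ⟨h1, ?_⟩
  simp [AffineMap.lineMap_apply] at h3
  rcases h1 with h1 | h1 <;> rcases h2 with h2 | h2 <;> rcases h3 with h3 | h3 <;> linarith

theorem leftEnd_rightEnd_mem_seg {s : M.Side} (hs : s ∈ M.Γ₁Sides) :
    M.leftEnd s ∈ M.seg s ∧ M.rightEnd s ∈ M.seg s := by
  have hAB := (Γ₁Sides_height hs).2
  have e1 : (!₂[M.endA s 0, M.endA s 1] : Plane) = M.endA s := by
    ext i; fin_cases i <;> rfl
  have e2 : (!₂[M.endB s 0, M.endA s 1] : Plane) = M.endB s := by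
    ext i; fin_cases i
    · rfl
    · exact hAB
  have hAm : M.endA s ∈ M.seg s := left_mem_segment ℝ _ _
  have hBm : M.endB s ∈ M.seg s := right_mem_segment ℝ _ _
  unfold leftEnd rightEnd
  rcases le_total (M.endA s 0) (M.endB s 0) with h | h
  · rw [min_eq_left h, max_eq_right h, e1, e2]; exact ⟨hAm, hBm⟩
  · rw [min_eq_right h, max_eq_left h, e1, e2]; exact ⟨hBm, hAm⟩

theorem norm_ridgeAvg_sq_le (v : M.V p) (q : M.Side × M.Side) :
    ‖ridgeAvg v q‖ ^ 2 ≤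
      ‖tgrad v q.1 (M.rightEnd q.1)‖ ^ 2 + ‖tgrad v q.2 (M.leftEnd q.2)‖ ^ 2 := by
  unfold ridgeAvg
  rw [norm_smul, mul_pow]
  have := norm_add_le (tgrad v q.1 (M.rightEnd q.1)) (tgrad v q.2 (M.leftEnd q.2))
  have h2 : ‖tgrad v q.1 (M.rightEnd q.1) + tgrad v q.2 (M.leftEnd q.2)‖ ^ 2 ≤
      (‖tgrad v q.1 (M.rightEnd q.1)‖ + ‖tgrad v q.2 (M.leftEnd q.2)‖) ^ 2 := by gcongr
  norm_num
  nlinarith [sq_nonneg (‖tgrad v q.1 (M.rightEnd q.1)‖ - ‖tgrad v q.2 (M.leftEnd q.2)‖)]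

/-- The averages of the tangential gradient at the ridges are controlled by the tangential
gradient. -/
theorem exists_sum_ridgeAvg_le (p : ℕ) {ρ : ℝ} (hρ : 0 < ρ) : ∃ C : ℝ, 0 < C ∧
    ∀ (R : Rect) (M : Mesh R), M.QuasiUniform ρ → ∀ v : M.V p,
      ∑ q ∈ M.ridges, ‖ridgeAvg v q‖ ^ 2 ≤
        C / M.h * ∑ s ∈ M.Γ₁Sides, M.sideIntegral s (fun x => ‖tgrad v s x‖ ^ 2) := by
  classical
  obtain ⟨C, hC, H⟩ := exists_tgrad_sq_le p hρ
  refine ⟨C * (192 / ρ ^ 2), by positivity, fun R M hM v => ?_⟩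
  have hh := M.h_pos
  -- The integrals are extended by zero to all sides, since the counting bound sums over all of
  -- them.
  set b : M.Side → ℝ := fun s =>
    if s ∈ M.Γ₁Sides then M.sideIntegral s (fun x => ‖tgrad v s x‖ ^ 2) else 0 with hb
  have hb0 : ∀ s, 0 ≤ b s := fun s => by
    simp only [hb]; split_ifs
    · exact sideIntegral_nonneg s fun _ => sq_nonneg _
    · exact le_rfl
  have hbsum : ∑ s, b s = ∑ s ∈ M.Γ₁Sides, M.sideIntegral s (fun x => ‖tgrad v s x‖ ^ 2) := by
    simp [hb, Finset.sum_ite_mem]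
  have h1 : ∀ q ∈ M.ridges, ‖ridgeAvg v q‖ ^ 2 ≤ C / M.h * (b q.1 + b q.2) := fun q hq => by
    have hq' := Finset.mem_product.1 (Finset.mem_filter.1 hq).1
    refine (norm_ridgeAvg_sq_le v q).trans ?_
    rw [mul_add]
    simp only [hb, if_pos hq'.1, if_pos hq'.2]
    exact add_le_add (H R M hM v _ _ (leftEnd_rightEnd_mem_seg hq'.1).2)
      (H R M hM v _ _ (leftEnd_rightEnd_mem_seg hq'.2).1)
  refine (Finset.sum_le_sum h1).trans ?_
  rw [← Finset.mul_sum]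
  let Q (τ : Plane) : Finset (M.Side × M.Side) :=
    Finset.univ.filter fun q => ∃ x ∈ M.cell q.1.1, x + τ ∈ M.cell q.2.1
  have h2 : ∀ τ, ∑ q ∈ Q τ, (b q.1 + b q.2) ≤ 96 / ρ ^ 2 * ∑ s, b s := fun τ =>
    hM.sum_add_le hρ τ (Q τ) (fun q hq => (Finset.mem_filter.1 hq).2) b hb0
  -- A ridge joins triangles that touch either directly or after a shift by minus the period; each
  -- case costs `96 / ρ²`.
  have h3 : M.ridges ⊆ Q 0 ∪ Q (-R.period) := fun q hq => by
    have hq' := Finset.mem_product.1 (Finset.mem_filter.1 hq).1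
    have hr := M.seg_subset_cell _ (leftEnd_rightEnd_mem_seg hq'.1).2
    have hl := M.seg_subset_cell _ (leftEnd_rightEnd_mem_seg hq'.2).1
    rw [Finset.mem_union]
    rcases (Finset.mem_filter.1 hq).2 with h | h
    · exact Or.inl (Finset.mem_filter.2 ⟨Finset.mem_univ _, _, hr, by rw [add_zero, h]; exact hl⟩)
    · exact Or.inr (Finset.mem_filter.2 ⟨Finset.mem_univ _, _, hr, by
        rw [h.2, add_neg_cancel_right]; exact hl⟩)
  have h4 : ∑ q ∈ M.ridges, (b q.1 + b q.2) ≤ 192 / ρ ^ 2 * ∑ s, b s := by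
    have hn : ∀ q : M.Side × M.Side, 0 ≤ b q.1 + b q.2 := fun q => add_nonneg (hb0 _) (hb0 _)
    calc _ ≤ ∑ q ∈ Q 0 ∪ Q (-R.period), (b q.1 + b q.2) :=
          Finset.sum_le_sum_of_subset_of_nonneg h3 fun q _ _ => hn q
      _ ≤ ∑ q ∈ Q 0, (b q.1 + b q.2) + ∑ q ∈ Q (-R.period), (b q.1 + b q.2) := by
          rw [← Finset.sum_union_inter]
          exact le_add_of_nonneg_right (Finset.sum_nonneg fun q _ => hn q)
      _ ≤ 96 / ρ ^ 2 * ∑ s, b s + 96 / ρ ^ 2 * ∑ s, b s := add_le_add (h2 _) (h2 _)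
      _ = _ := by ring
  rw [← hbsum]
  calc _ ≤ C / M.h * (192 / ρ ^ 2 * ∑ s, b s) := mul_le_mul_of_nonneg_left h4 (by positivity)
    _ = _ := by ring

/-- Coercivity on `Γ₁`. -/
theorem exists_boundary_coercive (p : ℕ) {ρ : ℝ} (hρ : 0 < ρ) : ∃ γ₀ : ℝ, 0 < γ₀ ∧
    ∀ (R : Rect) (M : Mesh R), M.QuasiUniform ρ → ∀ γ, γ₀ ≤ γ → ∀ v : M.V p,
      1 / 2 * ((∑ s ∈ M.Γ₁Sides, M.sideIntegral s (fun x => ‖tgrad v s x‖ ^ 2)) +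
          γ / M.h * (∑ q ∈ M.ridges, ‖ridgeJump v q‖ ^ 2) +
          1 / (γ / M.h) * (∑ q ∈ M.ridges, ‖ridgeAvg v q‖ ^ 2)) ≤
        boundaryForm (γ / M.h) v v := by
  obtain ⟨C, hC, H⟩ := exists_sum_ridgeAvg_le p hρ
  refine ⟨10 * C, by positivity, fun R M hM γ hγ v => ?_⟩
  have hh := M.h_pos
  have hγ0 : 0 < γ := lt_of_lt_of_le (by positivity) hγ
  have hσ : 0 < γ / M.h := by positivity
  set σ := γ / M.h with hσd
  have hX : ∑ q ∈ M.ridges, (inner ℝ (ridgeJump v q) (ridgeAvg v q) : ℝ) ≤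
      σ / 4 * ∑ q ∈ M.ridges, ‖ridgeJump v q‖ ^ 2 + 1 / σ * ∑ q ∈ M.ridges, ‖ridgeAvg v q‖ ^ 2 := by
    rw [Finset.mul_sum, Finset.mul_sum, ← Finset.sum_add_distrib]
    exact Finset.sum_le_sum fun q _ => real_inner_le_young _ _ hσ
  have hG := H R M hM v
  have hJ0 : 0 ≤ ∑ q ∈ M.ridges, ‖ridgeJump v q‖ ^ 2 := Finset.sum_nonneg fun _ _ => sq_nonneg _
  have hD0 : 0 ≤ ∑ s ∈ M.Γ₁Sides, M.sideIntegral s (fun x => ‖tgrad v s x‖ ^ 2) :=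
    Finset.sum_nonneg fun s _ => sideIntegral_nonneg s fun _ => sq_nonneg _
  unfold boundaryForm
  simp only [real_inner_self_eq_norm_sq]
  set D := ∑ s ∈ M.Γ₁Sides, M.sideIntegral s (fun x => ‖tgrad v s x‖ ^ 2)
  set J := ∑ q ∈ M.ridges, ‖ridgeJump v q‖ ^ 2
  set G := ∑ q ∈ M.ridges, ‖ridgeAvg v q‖ ^ 2
  have hG' : 1 / σ * G ≤ 1 / 10 * D := by
    calc 1 / σ * G ≤ 1 / σ * (C / M.h * D) := by gcongr
      _ = C / γ * D := by rw [hσd]; field_simp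
      _ ≤ 1 / 10 * D := by
        refine mul_le_mul_of_nonneg_right ?_ hD0
        rw [div_le_div_iff₀ hγ0 (by norm_num)]
        linarith
  have hσJ : 0 ≤ σ * J := by positivity
  linarith

theorem innerΓ₁_self_nonneg (v : M.V p) : 0 ≤ innerΓ₁ v v :=
  Finset.sum_nonneg fun s _ => sideIntegral_nonneg s fun _ => mul_self_nonneg _

/-- Coercivity of the discrete bilinear form. -/
theorem exists_dgForm_coercive (p : ℕ) {ρ : ℝ} (hρ : 0 < ρ) : ∃ γ₀ : ℝ, 0 < γ₀ ∧
    ∀ (R : Rect) (M : Mesh R), M.QuasiUniform ρ → ∀ γ, γ₀ ≤ γ → ∀ α β : ℝ, 0 ≤ α → 0 ≤ β →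
      ∀ v : M.V p, 1 / 2 * energyNormSq α β γ v ≤ dgForm α β γ v v := by
  obtain ⟨γ₁, h₁, H₁⟩ := exists_bulk_coercive p hρ
  obtain ⟨γ₂, h₂, H₂⟩ := exists_boundary_coercive p hρ
  refine ⟨max γ₁ γ₂, lt_max_of_lt_left h₁, fun R M hM γ hγ α β hα hβ v => ?_⟩
  have k1 := H₁ R M hM γ ((le_max_left _ _).trans hγ) v
  have k2 := mul_le_mul_of_nonneg_left (H₂ R M hM γ ((le_max_right _ _).trans hγ) v) hβ
  have k3 := mul_nonneg hα (innerΓ₁_self_nonneg v)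
  unfold energyNormSq dgForm
  rw [div_eq_mul_one_div β]
  linarith

end Mesh

end DynBC

/-! ### Vertical sections of the mesh -/

namespace DynBC

/-- The point with the given coordinates. -/
noncomputable def pt (x y : ℝ) : Plane := !₂[x, y]

@[simp] theorem pt_zero (x y : ℝ) : pt x y 0 = x := rfl
@[simp] theorem pt_one (x y : ℝ) : pt x y 1 = y := rfl

theorem pt_eta (x : Plane) : pt (x 0) (x 1) = x := by
  ext i; fin_cases i <;> rfl

theorem pt_add (x y t : ℝ) : pt x (y + t) = pt x y + t • pt 0 1 := by
  ext i; fin_cases i <;> simp [pt]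

theorem continuous_pt : Continuous fun z : ℝ × ℝ => pt z.1 z.2 := by
  refine (PiLp.continuous_toLp 2 _).comp (continuous_pi fun i => ?_)
  fin_cases i
  · exact continuous_fst
  · exact continuous_snd

theorem continuous_pt_right (x : ℝ) : Continuous fun y => pt x y :=
  continuous_pt.comp (by fun_prop : Continuous fun y : ℝ => (x, y))

theorem measurePreserving_pt : MeasurePreserving (fun z : ℝ × ℝ => pt z.1 z.2) := by
  have h1 := (volume_preserving_finTwoArrow ℝ).symm
  have h2 := (EuclideanSpace.volume_preserving_symm_measurableEquiv_toLp (Fin 2)).symm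
  have h3 := h2.comp h1
  have e : (fun z : ℝ × ℝ => pt z.1 z.2) = (MeasurableEquiv.toLp 2 (Fin 2 → ℝ)) ∘
      (MeasurableEquiv.finTwoArrow (α := ℝ)).symm := rfl
  rw [e]
  exact h3

theorem measurableEmbedding_pt : MeasurableEmbedding (fun z : ℝ × ℝ => pt z.1 z.2) := by
  have h3 := (MeasurableEquiv.toLp 2 (Fin 2 → ℝ)).measurableEmbedding.comp
    (MeasurableEquiv.finTwoArrow (α := ℝ)).symm.measurableEmbedding
  have e : (fun z : ℝ × ℝ => pt z.1 z.2) = (MeasurableEquiv.toLp 2 (Fin 2 → ℝ)) ∘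
      (MeasurableEquiv.finTwoArrow (α := ℝ)).symm := rfl
  rw [e]
  exact h3

/-- Fubini's theorem in the plane. -/
theorem setIntegral_eq_iterated {s : Set Plane} (hs : MeasurableSet s) {φ : Plane → ℝ}
    (hφ : IntegrableOn φ s) :
    Integrable (fun x => ∫ y in {y | pt x y ∈ s}, φ (pt x y)) ∧
      ∫ x in s, φ x = ∫ x, ∫ y in {y | pt x y ∈ s}, φ (pt x y) := by
  have h1 : Integrable (fun z : ℝ × ℝ => s.indicator φ (pt z.1 z.2)) (volume.prod volume) := by
    have := (integrable_indicator_iff hs).2 hφ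
    exact (measurePreserving_pt.integrable_comp_emb measurableEmbedding_pt).2 this
  have h2 : ∀ x, ∫ y in {y | pt x y ∈ s}, φ (pt x y) = ∫ y, s.indicator φ (pt x y) := fun x => by
    have hm : MeasurableSet {y | pt x y ∈ s} := (continuous_pt_right x).measurable hs
    rw [← integral_indicator hm]
    rfl
  simp_rw [h2]
  refine ⟨h1.integral_prod_left, ?_⟩
  rw [← integral_indicator hs, ← measurePreserving_pt.integral_comp measurableEmbedding_pt]
  exact integral_prod _ h1

theorem hasDerivAt_eval_pt (q : MvPolynomial (Fin 2) ℝ) (x y : ℝ) :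
    HasDerivAt (fun y => MvPolynomial.eval (fun i => pt x y i) q)
      (MvPolynomial.eval (fun i => pt x y i) (MvPolynomial.pderiv 1 q)) y := by
  induction q using MvPolynomial.induction_on with
  | C a => simpa using hasDerivAt_const y a
  | add a b ha hb =>
    simp only [map_add]
    exact ha.add hb
  | mul_X a i ha =>
    have hX : HasDerivAt (fun y => pt x y i)
        (MvPolynomial.eval (fun i => pt x y i) (MvPolynomial.pderiv 1 (MvPolynomial.X i))) y := by
      fin_cases i
      · simpa [MvPolynomial.pderiv_X] using hasDerivAt_const y x
      · simpa [MvPolynomial.pderiv_X] using hasDerivAt_id' y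
    have := ha.mul hX
    simp only [MvPolynomial.pderiv_mul, map_add, map_mul, MvPolynomial.eval_X]
    exact this

/-- Intervals are stacked from the level `c` upwards, and `m` may grow by `a K` when the interval
`K` is entered. Every step down strictly lowers the upper end, so no interval is charged twice; the
induction is on the number of intervals whose upper end is not above the current one. -/
theorem chain_bound {ι : Type*} (S : Finset ι) (lo hi m a : ι → ℝ) (B c : ℝ)
    (hlt : ∀ K ∈ S, lo K < hi K) (ha : ∀ K ∈ S, 0 ≤ a K)
    (h0 : ∀ K ∈ S, lo K = c → m K ≤ B + a K)
    (hstep : ∀ K ∈ S, lo K ≠ c → ∃ K' ∈ S, hi K' = lo K ∧ m K ≤ m K' + a K) :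
    ∀ K ∈ S, m K ≤ B + ∑ L ∈ S, a L := by
  classical
  have key : ∀ n : ℕ, ∀ K ∈ S, (S.filter fun L => hi L ≤ hi K).card = n →
      m K ≤ B + ∑ L ∈ S.filter (fun L => hi L ≤ hi K), a L := by
    intro n
    induction n using Nat.strong_induction_on with
    | _ n ih =>
      intro K hK hn
      have hmem : K ∈ S.filter fun L => hi L ≤ hi K := Finset.mem_filter.2 ⟨hK, le_rfl⟩
      have hnn : ∀ L ∈ S.filter (fun L => hi L ≤ hi K), 0 ≤ a L := fun L hL =>
        ha L (Finset.mem_filter.1 hL).1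
      by_cases hc : lo K = c
      · have := Finset.single_le_sum hnn hmem
        linarith [h0 K hK hc]
      · obtain ⟨K', hK', hhi, hm⟩ := hstep K hK hc
        have hlt' : hi K' < hi K := hhi ▸ hlt K hK
        have hsub : insert K (S.filter fun L => hi L ≤ hi K') ⊆ S.filter fun L => hi L ≤ hi K := by
          refine Finset.insert_subset hmem fun L hL => ?_
          have := Finset.mem_filter.1 hL
          exact Finset.mem_filter.2 ⟨this.1, this.2.trans hlt'.le⟩
        have hnot : K ∉ S.filter fun L => hi L ≤ hi K' := fun h =>
          absurd (Finset.mem_filter.1 h).2 (not_le.2 hlt')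
        have hcard := Finset.card_le_card hsub
        rw [Finset.card_insert_of_notMem hnot, hn] at hcard
        have h1 := ih _ (by omega) K' hK' rfl
        have h2 := Finset.sum_le_sum_of_subset_of_nonneg hsub fun L hL _ => hnn L hL
        rw [Finset.sum_insert hnot] at h2
        linarith
  intro K hK
  refine (key _ K hK rfl).trans ?_
  have := Finset.sum_le_sum_of_subset_of_nonneg (Finset.filter_subset (fun L => hi L ≤ hi K) S)
    fun L hL _ => ha L hL
  linarith

namespace Mesh

variable {R : Rect} (M : Mesh R)

/-- The lower end of the section of a triangle by a vertical line. -/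
noncomputable def lo (t : ℝ) (K : Fin M.n) : ℝ := sInf {y | pt t y ∈ M.cell K}

/-- The upper end of the section of a triangle by a vertical line. -/
noncomputable def hi (t : ℝ) (K : Fin M.n) : ℝ := sSup {y | pt t y ∈ M.cell K}

/-- The vertical line at `t` contains no vertex. -/
def Generic (t : ℝ) : Prop := ∀ K i, M.vert K i 0 ≠ t

theorem ae_generic : ∀ᵐ t : ℝ, M.Generic t := by
  have : {t | ¬ M.Generic t} ⊆ Set.range fun q : Fin M.n × Fin 3 => M.vert q.1 q.2 0 := by
    intro t ht
    simp only [Generic, Set.mem_ofPred_eq, not_forall, not_not] at ht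
    obtain ⟨K, i, h⟩ := ht
    exact ⟨(K, i), h⟩
  exact measure_mono_null this ((Set.finite_range _).measure_zero _)

theorem isCompact_section (t : ℝ) (K : Fin M.n) : IsCompact {y | pt t y ∈ M.cell K} := by
  have hc : IsClosed {y | pt t y ∈ M.cell K} :=
    (M.isCompact_cell K).isClosed.preimage (continuous_pt_right t)
  have hsub : {y | pt t y ∈ M.cell K} ⊆ (fun x : Plane => x 1) '' M.cell K :=
    fun y hy => ⟨pt t y, hy, rfl⟩
  exact ((M.isCompact_cell K).image (by fun_prop)).of_isClosed_subset hc hsub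

variable {M} {t : ℝ}

theorem bary_pt_add (K : Fin M.n) (i : Fin 3) (y s : ℝ) :
    M.bary K i (pt t (y + s)) = M.bary K i (pt t y) + s * (M.bary K i).linear (pt 0 1) := by
  rw [pt_add, bary_add, map_smul, smul_eq_mul]

/-- A point of a triangle at which two barycentric coordinates vanish is a vertex, and a generic
line contains none. -/
theorem Generic.bary_pos (ht : M.Generic t) {K : Fin M.n} {y : ℝ} (hy : pt t y ∈ M.cell K)
    {i : Fin 3} (hi : M.bary K i (pt t y) = 0) : ∀ j, j ≠ i → 0 < M.bary K j (pt t y) := by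
  intro j hj
  refine lt_of_le_of_ne (M.mem_cell_iff.1 hy j) fun h => ?_
  obtain ⟨k, hk⟩ := M.eq_vert_of_bary_eq_zero hj h.symm hi
  exact ht K k (by rw [← hk]; rfl)

/-- A generic line does not run along a side. If the vertical derivative vanished, the coordinate
would depend on the first variable alone, and its zeros, among them the end points of the side,
would all lie above `t`. -/
theorem Generic.linear_ne_zero (ht : M.Generic t) {K : Fin M.n} {y : ℝ} {i : Fin 3}
    (hi : M.bary K i (pt t y) = 0) : (M.bary K i).linear (pt 0 1) ≠ 0 := by
  intro h0
  have hdec : ∀ w : Plane, (M.bary K i).linear w = w 0 * (M.bary K i).linear (pt 1 0) := fun w => by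
    have : w = w 0 • pt 1 0 + w 1 • pt 0 1 := by
      ext i; fin_cases i <;> simp [pt]
    conv_lhs => rw [this]
    rw [map_add, map_smul, map_smul, h0]
    simp
  have h1 := M.bary_linear_sub K i (pt t y) (M.endA (K, i))
  rw [hi, M.bary_endA (K, i), hdec] at h1
  have h2 := M.bary_linear_sub K i (M.vert K i) (M.endA (K, i))
  rw [M.bary_vert_self, M.bary_endA (K, i), hdec] at h2
  have h3 : (M.bary K i).linear (pt 1 0) ≠ 0 := fun h => by rw [h] at h2; simp at h2
  have h4 : (pt t y - M.endA (K, i)) 0 = 0 := by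
    rcases mul_eq_zero.1 (h1.trans (sub_zero 0)) with h | h
    · exact h
    · exact absurd h h3
  rw [PiLp.sub_apply, pt_zero] at h4
  exact ht K (i + 1) (by change M.endA (K, i) 0 = t; linarith)

theorem eventually_pt_mem_cell {K : Fin M.n} {y : ℝ} (hy : pt t y ∈ interior (M.cell K)) :
    ∀ᶠ z in nhds y, pt t z ∈ M.cell K :=
  (continuous_pt_right t).continuousAt (mem_interior_iff_mem_nhds.1 hy)

theorem section_eq_Icc {K : Fin M.n} {y : ℝ} (hy : pt t y ∈ M.cell K) :
    {y | pt t y ∈ M.cell K} = Set.Icc (M.lo t K) (M.hi t K) := by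
  refine eq_Icc_of_connected_compact ⟨⟨y, hy⟩, ?_⟩ (M.isCompact_section t K)
  refine Convex.isPreconnected fun a ha b hb u v hu hv huv => ?_
  have := M.convex_cell K ha hb hu hv huv
  have e : pt t (u • a + v • b) = u • pt t a + v • pt t b := by
    ext i; fin_cases i
    · simp [pt, ← add_mul, huv]
    · simp [pt]
  change pt t (u • a + v • b) ∈ M.cell K
  rwa [e]

theorem pt_mem_cell_iff {K : Fin M.n} {y : ℝ} (hy : pt t y ∈ M.cell K) (z : ℝ) :
    pt t z ∈ M.cell K ↔ z ∈ Set.Icc (M.lo t K) (M.hi t K) := by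
  rw [← section_eq_Icc hy]; rfl

theorem Generic.lo_lt_hi (ht : M.Generic t) {K : Fin M.n} {y : ℝ} (hy : pt t y ∈ M.cell K) :
    M.lo t K < M.hi t K := by
  have hy' := (pt_mem_cell_iff hy y).1 hy
  suffices ∃ z, z ≠ y ∧ pt t z ∈ M.cell K by
    obtain ⟨z, hz, hzK⟩ := this
    have hz' := (pt_mem_cell_iff hy z).1 hzK
    rcases lt_or_gt_of_ne hz with h | h
    · exact lt_of_le_of_lt hz'.1 (lt_of_lt_of_le h hy'.2)
    · exact lt_of_le_of_lt hy'.1 (lt_of_lt_of_le h hz'.2)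
  by_cases h_int : pt t y ∈ interior (M.cell K)
  · obtain ⟨z, hz, hne⟩ := ((eventually_pt_mem_cell h_int).filter_mono
      (nhdsWithin_le_nhds (s := {y}ᶜ))).and self_mem_nhdsWithin |>.exists
    exact ⟨z, hne, hz⟩
  · rw [mem_interior_cell_iff] at h_int
    push Not at h_int
    obtain ⟨i, hi⟩ := h_int
    have hi0 : M.bary K i (pt t y) = 0 := le_antisymm hi (M.mem_cell_iff.1 hy i)
    have hpos := ht.bary_pos hy hi0
    have hlin := ht.linear_ne_zero hi0
    set l := (M.bary K i).linear (pt 0 1)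
    -- The factor `l` selects the one of the two vertical directions that points into the triangle.
    have hw : 0 < (M.bary K i).linear (l • pt 0 1) := by
      rw [map_smul, smul_eq_mul]
      exact mul_self_pos.2 hlin
    have h1 := M.eventually_add_smul_mem_interior (s := (K, i)) hi0 hpos
      ((M.bary_linear_pos_iff (K, i) _).1 hw)
    obtain ⟨ε, hε, hε0⟩ := (h1.and self_mem_nhdsWithin).exists
    refine ⟨y + ε * l, ?_, ?_⟩
    · have : ε * l ≠ 0 := mul_ne_zero (ne_of_gt hε0) hlin
      simpa using this
    · rw [pt_add, mul_smul]
      exact interior_subset hε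

/-- Along the line a barycentric coordinate is affine and nonnegative at both ends of the section. A
zero strictly between them would force its slope to vanish. -/
theorem Generic.pt_mem_interior (ht : M.Generic t) {K : Fin M.n} {y : ℝ}
    (hy : pt t y ∈ M.cell K) {z : ℝ} (hz : z ∈ Set.Ioo (M.lo t K) (M.hi t K)) :
    pt t z ∈ interior (M.cell K) := by
  have hlh := ht.lo_lt_hi hy
  rw [mem_interior_cell_iff]
  intro i
  have hzc := (pt_mem_cell_iff hy z).2 (Set.Ioo_subset_Icc_self hz)
  refine lt_of_le_of_ne (M.mem_cell_iff.1 hzc i) fun h0 => ?_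
  have h1 := M.mem_cell_iff.1 ((pt_mem_cell_iff hy (M.lo t K)).2 ⟨le_rfl, hlh.le⟩) i
  have h2 := M.mem_cell_iff.1 ((pt_mem_cell_iff hy (M.hi t K)).2 ⟨hlh.le, le_rfl⟩) i
  rw [show M.lo t K = z + (M.lo t K - z) by ring, bary_pt_add, ← h0] at h1
  rw [show M.hi t K = z + (M.hi t K - z) by ring, bary_pt_add, ← h0] at h2
  apply ht.linear_ne_zero h0.symm
  have h3 : M.lo t K - z < 0 := by linarith [hz.1]
  have h4 : 0 < M.hi t K - z := by linarith [hz.2]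
  nlinarith

/-- An end point of a vertical section lies on a side. -/
theorem exists_bary_eq_zero {K : Fin M.n} {y z : ℝ} (hy : pt t y ∈ M.cell K)
    (hz : z = M.lo t K ∨ z = M.hi t K) (hzK : pt t z ∈ M.cell K) :
    ∃ i, M.bary K i (pt t z) = 0 := by
  by_contra hne
  push Not at hne
  have h_int : pt t z ∈ interior (M.cell K) := M.mem_interior_cell_iff.2 fun i =>
    lt_of_le_of_ne (M.mem_cell_iff.1 hzK i) (hne i).symm
  have hev := eventually_pt_mem_cell h_int
  rcases hz with rfl | rfl
  · obtain ⟨w, hw, hlt⟩ := ((hev.filter_mono (nhdsWithin_le_nhds (s := Set.Iio (M.lo t K)))).and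
      self_mem_nhdsWithin).exists
    exact absurd ((pt_mem_cell_iff hy w).1 hw).1 (not_le.2 hlt)
  · obtain ⟨w, hw, hlt⟩ := ((hev.filter_mono (nhdsWithin_le_nhds (s := Set.Ioi (M.hi t K)))).and
      self_mem_nhdsWithin).exists
    exact absurd ((pt_mem_cell_iff hy w).1 hw).2 (not_le.2 hlt)

theorem mem_closure_Ω_iff {x : Plane} :
    x ∈ closure R.Ω ↔ R.a ≤ x 0 ∧ x 0 ≤ R.b ∧ R.c ≤ x 1 ∧ x 1 ≤ R.d := by
  have hab := R.hab
  have hcd := R.hcd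
  constructor
  · intro hx
    have hcl : IsClosed {x : Plane | R.a ≤ x 0 ∧ x 0 ≤ R.b ∧ R.c ≤ x 1 ∧ x 1 ≤ R.d} := by
      have h0 : Continuous fun x : Plane => x 0 := by fun_prop
      have h1 : Continuous fun x : Plane => x 1 := by fun_prop
      exact (isClosed_le continuous_const h0).inter ((isClosed_le h0 continuous_const).inter
        ((isClosed_le continuous_const h1).inter (isClosed_le h1 continuous_const)))
    refine closure_minimal (fun x hx => ?_) hcl hx
    exact ⟨hx.1.le, hx.2.1.le, hx.2.2.1.le, hx.2.2.2.le⟩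
  -- A point of the closed rectangle is the limit of points moved slightly towards the centre, which
  -- lie in the open rectangle.
  · rintro ⟨h1, h2, h3, h4⟩
    have hm : ∀ ε : ℝ, 0 < ε → ε < 1 →
        x + ε • (pt ((R.a + R.b) / 2) ((R.c + R.d) / 2) - x) ∈ R.Ω := fun ε h0 h1' => by
      simp only [Rect.Ω, Set.mem_ofPred_eq, PiLp.add_apply, PiLp.smul_apply, PiLp.sub_apply,
        pt_zero, pt_one, smul_eq_mul]
      refine ⟨?_, ?_, ?_, ?_⟩ <;> nlinarith
    have hc : Continuous fun ε : ℝ => x + ε • (pt ((R.a + R.b) / 2) ((R.c + R.d) / 2) - x) := by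
      fun_prop
    have ht : Filter.Tendsto (fun ε : ℝ => x + ε • (pt ((R.a + R.b) / 2) ((R.c + R.d) / 2) - x))
        (nhdsWithin 0 (Set.Ioi 0)) (nhds x) := by
      have := hc.tendsto 0
      simp only [zero_smul, add_zero] at this
      exact this.mono_left nhdsWithin_le_nhds
    refine mem_closure_of_tendsto ht ?_
    filter_upwards [Ioo_mem_nhdsGT (zero_lt_one' ℝ)] with ε hε
    exact hm ε hε.1 hε.2

theorem cell_subset (K : Fin M.n) : M.cell K ⊆ closure R.Ω := by
  rw [← M.cover]
  exact Set.subset_iUnion (fun K => convexHull ℝ (Set.range (M.vert K))) K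

theorem exists_mem_cell {x : Plane} (hx : x ∈ closure R.Ω) : ∃ K, x ∈ M.cell K := by
  rw [← M.cover] at hx
  exact Set.mem_iUnion.1 hx

/-- Below each section that does not start on the bottom there is another one. -/
theorem Generic.exists_below (ht : M.Generic t) {K : Fin M.n} {y : ℝ} (hy : pt t y ∈ M.cell K)
    (hlo : M.lo t K ≠ R.c) : ∃ L, (∃ z, pt t z ∈ M.cell L) ∧ L ≠ K ∧ M.hi t L = M.lo t K := by
  have hlh := ht.lo_lt_hi hy
  have hloK := (pt_mem_cell_iff hy (M.lo t K)).2 ⟨le_rfl, hlh.le⟩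
  obtain ⟨ha, hb, hc, hd⟩ := mem_closure_Ω_iff.1 (cell_subset K hloK)
  simp only [pt_zero, pt_one] at ha hb hc hd
  have hc' : R.c < M.lo t K := lt_of_le_of_ne hc (Ne.symm hlo)
  have h1 : M.lo t K ∈ closure (Set.Ioo R.c (M.lo t K)) := by
    rw [closure_Ioo hc'.ne]; exact ⟨hc, le_rfl⟩
  -- Finitely many closed sections cover the part of the line just below, so one of them has points
  -- below that accumulate at `M.lo t K`.
  have h2 : Set.Ioo R.c (M.lo t K) ⊆
      ⋃ L : Fin M.n, ({y | pt t y ∈ M.cell L} ∩ Set.Ioo R.c (M.lo t K)) := fun z hz => by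
    obtain ⟨L, hL⟩ := M.exists_mem_cell (x := pt t z)
      (mem_closure_Ω_iff.2 ⟨ha, hb, hz.1.le, hz.2.le.trans hd⟩)
    exact Set.mem_iUnion.2 ⟨L, hL, hz⟩
  have h3 := closure_mono h2 h1
  rw [closure_iUnion_of_finite] at h3
  obtain ⟨L, hL⟩ := Set.mem_iUnion.1 h3
  have hLmem : pt t (M.lo t K) ∈ M.cell L := by
    have := closure_mono (Set.inter_subset_left) hL
    rwa [(M.isCompact_section t L).isClosed.closure_eq] at this
  obtain ⟨z, hz⟩ := closure_nonempty_iff.1 ⟨_, hL⟩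
  have hzL : pt t z ∈ M.cell L := hz.1
  have hLlh := ht.lo_lt_hi hLmem
  have hz1 := (pt_mem_cell_iff hLmem z).1 hzL
  have hK1 := (pt_mem_cell_iff hLmem _).1 hLmem
  have hLK : L ≠ K := by
    rintro rfl
    exact absurd hz1.1 (not_le.2 hz.2.2)
  refine ⟨L, ⟨z, hzL⟩, hLK, le_antisymm ?_ hK1.2⟩
  by_contra hlt
  push Not at hlt
  -- If the section of `L` continued above the lower end of `K`, the interiors of the two triangles
  -- would share a point.
  obtain ⟨w, hw1, hw2⟩ := exists_between (lt_min hlt hlh)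
  have hwK := ht.pt_mem_interior hy (z := w) ⟨hw1, lt_of_lt_of_le hw2 (min_le_right _ _)⟩
  have hwL := ht.pt_mem_interior hLmem (z := w)
    ⟨(hz1.1.trans_lt hz.2.2).trans hw1, lt_of_lt_of_le hw2 (min_le_left _ _)⟩
  exact Set.disjoint_left.1 (M.disjoint_interior L K hLK) hwL hwK

/-- The number of triangles that meet a vertical line. -/
theorem QuasiUniform.card_line_le {ρ : ℝ} (hM : M.QuasiUniform ρ) (hρ : 0 < ρ)
    (S : Finset (Fin M.n)) (t : ℝ) (hS : ∀ K ∈ S, ∃ y, pt t y ∈ M.cell K) :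
    (S.card : ℝ) ≤ 8 * (R.d - R.c) / ρ ^ 2 / M.h := by
  have hh := M.h_pos
  have hcd := R.hcd
  -- Triangles that meet the line lie in a strip of area `2h (d - c)`. Packing the inscribed discs,
  -- with `π` bounded below by 1, gives the constant.
  let Z : Set (ℝ × ℝ) := Set.Icc (t - M.h) (t + M.h) ×ˢ Set.Icc R.c R.d
  have h1 := hM.card_mul_volume_le S ((fun z : ℝ × ℝ => pt z.1 z.2) '' Z) fun K hK x hx => by
    obtain ⟨y, hy⟩ := hS K hK
    refine ⟨(x 0, x 1), ⟨?_, ?_⟩, pt_eta x⟩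
    · have h2 := M.dist_le_h hx hy
      have h3 : |x 0 - t| ≤ dist x (pt t y) := by
        rw [dist_eq_norm]
        exact PiLp.norm_apply_le (x - pt t y) 0
      have := abs_le.1 (h3.trans h2)
      constructor <;> dsimp only <;> linarith
    · exact ⟨(mem_closure_Ω_iff.1 (cell_subset K hx)).2.2.1,
        (mem_closure_Ω_iff.1 (cell_subset K hx)).2.2.2⟩
  have h2 : volume ((fun z : ℝ × ℝ => pt z.1 z.2) '' Z) = ENNReal.ofReal (2 * M.h * (R.d - R.c)) := by
    have hinj : Function.Injective (fun z : ℝ × ℝ => pt z.1 z.2) := measurableEmbedding_pt.injective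
    rw [← measurePreserving_pt.measure_preimage_emb measurableEmbedding_pt,
      Set.preimage_image_eq _ hinj, Measure.volume_eq_prod, Measure.prod_prod, Real.volume_Icc,
      Real.volume_Icc, ← ENNReal.ofReal_mul (by linarith)]
    congr 1; ring
  rw [h2, EuclideanSpace.volume_ball_fin_two, ← ENNReal.ofReal_pow (by positivity),
    ← ENNReal.ofReal_natCast,
    ← ENNReal.ofReal_mul (by positivity), ← ENNReal.ofReal_mul (by positivity),
    ENNReal.ofReal_le_ofReal_iff (mul_nonneg (by positivity) (by linarith))] at h1
  rw [div_div, le_div_iff₀ (by positivity)]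
  have h3 : (S.card : ℝ) * (ρ * M.h / 2) ^ 2 ≤ 2 * M.h * (R.d - R.c) := by
    have : (S.card : ℝ) * (ρ * M.h / 2) ^ 2 * 1 ≤ (S.card : ℝ) * (ρ * M.h / 2) ^ 2 * Real.pi := by
      gcongr
      linarith [Real.pi_gt_three]
    nlinarith
  nlinarith

/-- The value of `φ` at the point of a side above `t`. -/
noncomputable def sideAt (s : M.Side) (φ : Plane → ℝ) (t : ℝ) : ℝ :=
  (Set.Ioo (0 : ℝ) 1).indicator (fun r => φ (AffineMap.lineMap (M.endA s) (M.endB s) r))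
    ((t - M.endA s 0) / (M.endB s 0 - M.endA s 0))

theorem sideAt_nonneg (s : M.Side) {φ : Plane → ℝ} (hφ : ∀ x, 0 ≤ φ x) (t : ℝ) :
    0 ≤ sideAt s φ t := Set.indicator_nonneg (fun _ _ => hφ _) _

theorem Generic.sideAt_eq (ht : M.Generic t) {s : M.Side} {y : ℝ} (hy : pt t y ∈ M.seg s)
    (φ : Plane → ℝ) : sideAt s φ t = φ (pt t y) := by
  unfold seg at hy
  rw [segment_eq_image_lineMap] at hy
  obtain ⟨r, hr, he⟩ := hy
  have hA : M.endA s 0 ≠ t := ht s.1 (s.2 + 1)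
  have hB : M.endB s 0 ≠ t := ht s.1 (s.2 + 2)
  have h0 : t = M.endA s 0 + r * (M.endB s 0 - M.endA s 0) := by
    have := congrArg (fun x : Plane => x 0) he
    simp [AffineMap.lineMap_apply] at this
    linarith
  have hne : M.endB s 0 - M.endA s 0 ≠ 0 := fun h => hA (by rw [h] at h0; linarith)
  have hrr : (t - M.endA s 0) / (M.endB s 0 - M.endA s 0) = r := by
    rw [div_eq_iff hne]; linarith
  have hr' : r ∈ Set.Ioo (0 : ℝ) 1 := by
    refine ⟨lt_of_le_of_ne hr.1 fun h => hA ?_, lt_of_le_of_ne hr.2 fun h => hB ?_⟩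
    · rw [← h] at h0; linarith
    · rw [h] at h0; linarith
  unfold sideAt
  rw [hrr, Set.indicator_of_mem hr', he]

theorem integrable_sideAt (s : M.Side) {φ : Plane → ℝ}
    (hφ : IntervalIntegrable (fun r => φ (AffineMap.lineMap (M.endA s) (M.endB s) r)) volume 0 1) :
    Integrable (sideAt s φ) := by
  by_cases hk : M.endB s 0 - M.endA s 0 = 0
  -- For a vertical side the quotient is a division by zero with value `0`, which lies outside the
  -- open interval.
  · have : sideAt s φ = fun _ => 0 := by
      ext t; simp [sideAt, hk]
    rw [this]; exact integrable_zero _ _ _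
  · have h1 : Integrable ((Set.Ioo (0 : ℝ) 1).indicator
        (fun r => φ (AffineMap.lineMap (M.endA s) (M.endB s) r))) := by
      rw [integrable_indicator_iff measurableSet_Ioo]
      rw [intervalIntegrable_iff_integrableOn_Ioo_of_le zero_le_one] at hφ
      exact hφ
    exact (h1.comp_div hk).comp_sub_right (M.endA s 0)

theorem integral_sideAt (s : M.Side) (φ : Plane → ℝ) :
    ∫ t, sideAt s φ t = |M.endB s 0 - M.endA s 0| *
      ∫ r in (0 : ℝ)..1, φ (AffineMap.lineMap (M.endA s) (M.endB s) r) := by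
  by_cases hk : M.endB s 0 - M.endA s 0 = 0
  · have : sideAt s φ = fun _ => 0 := by
      ext t; simp [sideAt, hk]
    rw [this, hk]; simp
  · unfold sideAt
    rw [integral_sub_right_eq_self (fun t => (Set.Ioo (0 : ℝ) 1).indicator
      (fun r => φ (AffineMap.lineMap (M.endA s) (M.endB s) r))
      (t / (M.endB s 0 - M.endA s 0))) (M.endA s 0), Measure.integral_comp_div, smul_eq_mul,
      integral_indicator measurableSet_Ioo, intervalIntegral.integral_of_le zero_le_one,
      integral_Ioc_eq_integral_Ioo]

/-- The projection of a side to the first axis is not longer than the side. -/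
theorem integral_sideAt_le (s : M.Side) {φ : Plane → ℝ} (hφ : ∀ x, 0 ≤ φ x) :
    ∫ t, sideAt s φ t ≤ M.sideIntegral s φ := by
  rw [integral_sideAt]
  unfold sideIntegral
  refine mul_le_mul_of_nonneg_right ?_
    (intervalIntegral.integral_nonneg zero_le_one fun _ _ => hφ _)
  rw [dist_comm, dist_eq_norm]
  exact PiLp.norm_apply_le (M.endB s - M.endA s) 0

end Mesh

end DynBC

/-! ### A broken Poincaré inequality -/

namespace DynBC

namespace Mesh

variable {R : Rect} {M : Mesh R} {p : ℕ} {t : ℝ}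

theorem norm_jump_eq {s s' : M.Side} (v : M.V p) {x : Plane} (h : M.normal s' = -M.normal s) :
    ‖jump v 0 s s' x‖ ^ 2 = (val v s.1 x - val v s'.1 x) ^ 2 := by
  unfold jump
  rw [h, add_zero, smul_neg, ← sub_eq_add_neg, ← sub_smul, norm_smul, norm_normal, mul_one,
    Real.norm_eq_abs, sq_abs]

/-- The squared jump on an interior edge, extended by zero. -/
noncomputable def edgeJumpSq (v : M.V p) (q : M.Side × M.Side) (x : Plane) : ℝ :=
  -- The summand `0` matches the integrand of `edgeIntegral` for zero shift.
  open Classical in if x + 0 ∈ M.seg q.2 then ‖jump v 0 q.1 q.2 x‖ ^ 2 else 0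

theorem edgeJumpSq_nonneg (v : M.V p) (q : M.Side × M.Side) (x : Plane) :
    0 ≤ edgeJumpSq v q x := by
  unfold edgeJumpSq
  split_ifs
  · exact sq_nonneg _
  · exact le_rfl

/-- At a generic common point the normals are opposite, so the vector jump reduces to the difference
of the two values. The sum keeps only pairs that involve `K`, so that each pair is charged to at
most two triangles later. -/
theorem Generic.jump_sq_le (ht : M.Generic t) (v : M.V p) {K L : Fin M.n} (hKL : L ≠ K) {y : ℝ}
    (hyK : pt t y ∈ M.cell K) (hyL : pt t y ∈ M.cell L) {i j : Fin 3}
    (hi : M.bary K i (pt t y) = 0) (hj : M.bary L j (pt t y) = 0) :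
    (val v K (pt t y) - val v L (pt t y)) ^ 2 ≤
      ∑ q ∈ M.interiorPairs, if q.1.1 = K ∨ q.2.1 = K then sideAt q.1 (edgeJumpSq v q) t else 0 := by
  have hsK : pt t y ∈ M.seg (K, i) := M.mem_seg_iff.2 ⟨hyK, hi⟩
  have hsL : pt t y ∈ M.seg (L, j) := M.mem_seg_iff.2 ⟨hyL, hj⟩
  have hn := M.normal_eq_neg (s := (K, i)) (s' := (L, j)) hKL.symm hi (ht.bary_pos hyK hi) hj
    (ht.bary_pos hyL hj)
  have key : ∀ q : M.Side × M.Side, q ∈ M.interiorPairs → (q.1.1 = K ∨ q.2.1 = K) →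
      sideAt q.1 (edgeJumpSq v q) t = (val v K (pt t y) - val v L (pt t y)) ^ 2 →
      (val v K (pt t y) - val v L (pt t y)) ^ 2 ≤ ∑ q ∈ M.interiorPairs,
        if q.1.1 = K ∨ q.2.1 = K then sideAt q.1 (edgeJumpSq v q) t else 0 := fun q hq hK he => by
    rw [← he]
    refine le_trans (le_of_eq ?_) (Finset.single_le_sum (f := fun q : M.Side × M.Side =>
      if q.1.1 = K ∨ q.2.1 = K then sideAt q.1 (edgeJumpSq v q) t else 0) (fun q _ => ?_) hq)
    · rw [if_pos hK]
    · split_ifs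
      · exact sideAt_nonneg _ (edgeJumpSq_nonneg v q) t
      · exact le_rfl
  rcases lt_or_gt_of_ne hKL with h | h
  · refine key ((L, j), (K, i)) (Finset.mem_filter.2 ⟨Finset.mem_univ _, h⟩) (Or.inr rfl) ?_
    rw [ht.sideAt_eq hsL, edgeJumpSq, add_zero, if_pos hsK,
      norm_jump_eq v (by rw [hn, neg_neg])]
    ring
  · refine key ((K, i), (L, j)) (Finset.mem_filter.2 ⟨Finset.mem_univ _, h⟩) (Or.inl rfl) ?_
    rw [ht.sideAt_eq hsK, edgeJumpSq, add_zero, if_pos hsL, norm_jump_eq v hn]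

/-- The point is a mean, with positive weights, of the end points of its side. These have heights at
least `c`, so both have height `c` and the side belongs to `Γ₁`. -/
theorem Generic.bottom_sq_le (ht : M.Generic t) (v : M.V p) {K : Fin M.n}
    (hK : pt t R.c ∈ M.cell K) {i : Fin 3} (hi : M.bary K i (pt t R.c) = 0) :
    (val v K (pt t R.c)) ^ 2 ≤
      ∑ s ∈ M.Γ₁Sides, sideAt s (fun x => val v s.1 x * val v s.1 x) t := by
  classical
  have hs : pt t R.c ∈ M.seg (K, i) := M.mem_seg_iff.2 ⟨hK, hi⟩
  have hpos := ht.bary_pos hK hi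
  have hbox := fun k => mem_closure_Ω_iff.1 (cell_subset K (M.vert_mem_cell K k))
  have h1 := M.sum_bary K (pt t R.c)
  have h2 := congrArg (fun x : Plane => x 1) (M.sum_bary_smul_vert K (pt t R.c))
  rw [sum_fin_three _ i, hi, zero_add] at h1
  rw [sum_fin_three _ i, hi, zero_smul, zero_add] at h2
  simp only [PiLp.add_apply, PiLp.smul_apply, smul_eq_mul, pt_one] at h2
  have hp1 := hpos (i + 1) (fin_three_ne_add_one i).symm
  have hp2 := hpos (i + 2) (fin_three_ne_add_two i).symm
  have a1 := (hbox (i + 1)).2.2.1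
  have a2 := (hbox (i + 2)).2.2.1
  set l1 := M.bary K (i + 1) (pt t R.c)
  set l2 := M.bary K (i + 2) (pt t R.c)
  have m1 := mul_nonneg hp1.le (sub_nonneg.2 a1)
  have m2 := mul_nonneg hp2.le (sub_nonneg.2 a2)
  have h3 : l1 * (M.vert K (i + 1) 1 - R.c) + l2 * (M.vert K (i + 2) 1 - R.c) = 0 := by
    linear_combination h2 - R.c * h1
  have hA : M.endA (K, i) 1 = R.c := by
    have : l1 * (M.vert K (i + 1) 1 - R.c) = 0 := by linarith
    exact sub_eq_zero.1 ((mul_eq_zero.1 this).resolve_left hp1.ne')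
  have hB : M.endB (K, i) 1 = R.c := by
    have : l2 * (M.vert K (i + 2) 1 - R.c) = 0 := by linarith
    exact sub_eq_zero.1 ((mul_eq_zero.1 this).resolve_left hp2.ne')
  have hmem : (K, i) ∈ M.Γ₁Sides := by
    refine Finset.mem_filter.2 ⟨Finset.mem_univ _, fun x hx => ?_⟩
    obtain ⟨a, b, c, -⟩ := mem_closure_Ω_iff.1 (cell_subset K (M.seg_subset_cell _ hx))
    refine ⟨a, b, Or.inl ?_⟩
    unfold seg at hx
    rw [segment_eq_image_lineMap] at hx
    obtain ⟨r, -, rfl⟩ := hx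
    simp [AffineMap.lineMap_apply, hA, hB]
  refine le_trans (le_of_eq ?_) (Finset.single_le_sum
    (f := fun s => sideAt s (fun x => val v s.1 x * val v s.1 x) t)
    (fun s _ => sideAt_nonneg s (fun _ => mul_self_nonneg _) t) hmem)
  dsimp only
  rw [ht.sideAt_eq hs, sq]

theorem abs_val_sub_le (v : M.V p) (K : Fin M.n) (t : ℝ) {a b y z : ℝ} (hy : y ∈ Set.Icc a b)
    (hz : z ∈ Set.Icc a b) (hyz : y ≤ z) :
    |val v K (pt t z) - val v K (pt t y)| ≤ ∫ w in a..b, ‖grad v K (pt t w)‖ := by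
  have hc : Continuous fun w => grad v K (pt t w) :=
    (continuous_grad v K).comp (continuous_pt_right t)
  have hc1 : Continuous fun w => grad v K (pt t w) 1 :=
    (EuclideanSpace.proj (𝕜 := ℝ) (1 : Fin 2)).continuous.comp hc
  have h1 : ∫ w in y..z, grad v K (pt t w) 1 = val v K (pt t z) - val v K (pt t y) :=
    intervalIntegral.integral_eq_sub_of_hasDerivAt
      (fun w _ => hasDerivAt_eval_pt (v K : MvPolynomial (Fin 2) ℝ) t w)
      (hc1.intervalIntegrable y z)
  rw [← h1]
  calc |∫ w in y..z, grad v K (pt t w) 1| ≤ ∫ w in y..z, ‖grad v K (pt t w)‖ := by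
        refine intervalIntegral.norm_integral_le_of_norm_le hyz
          (Filter.Eventually.of_forall fun w _ => PiLp.norm_apply_le (grad v K (pt t w)) 1)
          (hc.norm.intervalIntegrable y z)
    _ ≤ ∫ w in a..b, ‖grad v K (pt t w)‖ :=
        intervalIntegral.integral_mono_interval hy.1 hyz hz.2
          (Filter.Eventually.of_forall fun _ => norm_nonneg _) (hc.norm.intervalIntegrable a b)

/-- Cauchy-Schwarz, obtained by expanding the nonnegative integral of `(φ - m) ^ 2` with `m` the
mean of `φ`. -/
theorem sq_intervalIntegral_le {φ : ℝ → ℝ} (hφ : Continuous φ) {a b : ℝ} (hab : a < b) :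
    (∫ w in a..b, φ w) ^ 2 ≤ (b - a) * ∫ w in a..b, φ w ^ 2 := by
  set I := ∫ w in a..b, φ w
  set m := I / (b - a)
  have hba : 0 < b - a := sub_pos.2 hab
  have h0 : 0 ≤ ∫ w in a..b, (φ w - m) ^ 2 :=
    intervalIntegral.integral_nonneg hab.le fun _ _ => sq_nonneg _
  have h1 : ∫ w in a..b, (φ w - m) ^ 2 = (∫ w in a..b, φ w ^ 2) - 2 * m * I + (b - a) * m ^ 2 := by
    have e : ∀ w, (φ w - m) ^ 2 = φ w ^ 2 - 2 * m * φ w + m ^ 2 := fun w => by ring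
    simp_rw [e]
    have i1 : IntervalIntegrable (fun w => φ w ^ 2) volume a b := (hφ.pow 2).intervalIntegrable a b
    have i2 := (hφ.const_mul (2 * m)).intervalIntegrable (μ := volume) a b
    rw [intervalIntegral.integral_add (i1.sub i2) intervalIntegrable_const,
      intervalIntegral.integral_sub i1 i2, intervalIntegral.integral_const_mul,
      intervalIntegral.integral_const, smul_eq_mul]
  have h2 : m * (b - a) = I := div_mul_cancel₀ _ hba.ne'
  nlinarith

theorem hi_sub_lo_le {K : Fin M.n} {y : ℝ} (hy : pt t y ∈ M.cell K)
    (hlh : M.lo t K ≤ M.hi t K) : M.hi t K - M.lo t K ≤ M.h := by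
  have h1 := M.dist_le_h ((pt_mem_cell_iff hy (M.hi t K)).2 ⟨hlh, le_rfl⟩)
    ((pt_mem_cell_iff hy (M.lo t K)).2 ⟨le_rfl, hlh⟩)
  refine le_trans ?_ h1
  rw [dist_eq_norm]
  exact (le_abs_self _).trans (PiLp.norm_apply_le (pt t (M.hi t K) - pt t (M.lo t K)) 1)

/-- The Poincaré inequality on a vertical line. -/
theorem QuasiUniform.line_bound {ρ : ℝ} (hM : M.QuasiUniform ρ) (hρ : 0 < ρ) (v : M.V p)
    (ht : M.Generic t) {C : ℝ} (hC : C = 8 * (R.d - R.c) / ρ ^ 2) :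
    ∑ K, ∫ y in {y | pt t y ∈ M.cell K}, val v K (pt t y) ^ 2 ≤
      C * (2 * ∑ s ∈ M.Γ₁Sides, sideAt s (fun x => val v s.1 x * val v s.1 x) t +
        4 * C * (∑ K, ∫ y in {y | pt t y ∈ M.cell K}, ‖grad v K (pt t y)‖ ^ 2) +
        8 * C / M.h * ∑ q ∈ M.interiorPairs, sideAt q.1 (edgeJumpSq v q) t) := by
  classical
  have hh := M.h_pos
  have hcd := R.hcd
  have hC0 : 0 < C := by
    rw [hC]; exact div_pos (by linarith) (by positivity)
  let S : Finset (Fin M.n) := Finset.univ.filter fun K => ∃ y, pt t y ∈ M.cell K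
  have hS : ∀ K ∈ S, ∃ y, pt t y ∈ M.cell K := fun K hK => (Finset.mem_filter.1 hK).2
  have hN : (S.card : ℝ) ≤ C / M.h := by rw [hC]; exact hM.card_line_le hρ S t hS
  have hlh : ∀ K ∈ S, M.lo t K < M.hi t K := fun K hK => by
    obtain ⟨y, hy⟩ := hS K hK
    exact ht.lo_lt_hi hy
  have hlen : ∀ K ∈ S, M.hi t K - M.lo t K ≤ M.h := fun K hK => by
    obtain ⟨y, hy⟩ := hS K hK
    exact hi_sub_lo_le hy (hlh K hK).le
  have hsec : ∀ K ∈ S, {y | pt t y ∈ M.cell K} = Set.Icc (M.lo t K) (M.hi t K) := fun K hK => by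
    obtain ⟨y, hy⟩ := hS K hK
    exact section_eq_Icc hy
  have hloK : ∀ K ∈ S, pt t (M.lo t K) ∈ M.cell K := fun K hK => by
    have : M.lo t K ∈ {y | pt t y ∈ M.cell K} := by
      rw [hsec K hK]; exact ⟨le_rfl, (hlh K hK).le⟩
    exact this
  have hhiK : ∀ K ∈ S, pt t (M.hi t K) ∈ M.cell K := fun K hK => by
    have : M.hi t K ∈ {y | pt t y ∈ M.cell K} := by
      rw [hsec K hK]; exact ⟨(hlh K hK).le, le_rfl⟩
    exact this
  have hrestrict : ∀ φ : Fin M.n → ℝ → ℝ,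
      ∑ K, ∫ y in {y | pt t y ∈ M.cell K}, φ K y = ∑ K ∈ S, ∫ y in M.lo t K..M.hi t K, φ K y := by
    intro φ
    rw [← Finset.sum_subset (Finset.filter_subset _ _ : S ⊆ Finset.univ)]
    · refine Finset.sum_congr rfl fun K hK => ?_
      rw [hsec K hK, intervalIntegral.integral_of_le (hlh K hK).le, integral_Icc_eq_integral_Ioc]
    · intro K _ hK
      have : {y | pt t y ∈ M.cell K} = ∅ := by
        rw [Set.eq_empty_iff_forall_notMem]
        exact fun y hy => hK (Finset.mem_filter.2 ⟨Finset.mem_univ _, y, hy⟩)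
      rw [this]; simp
  rw [hrestrict, hrestrict]
  set BB := ∑ s ∈ M.Γ₁Sides, sideAt s (fun x => val v s.1 x * val v s.1 x) t
  have hBB : 0 ≤ BB := Finset.sum_nonneg fun s _ => sideAt_nonneg s (fun _ => mul_self_nonneg _) t
  set d : Fin M.n → ℝ := fun K => ∫ w in M.lo t K..M.hi t K, ‖grad v K (pt t w)‖ with hd
  set JJ : Fin M.n → ℝ := fun K => ∑ q ∈ M.interiorPairs,
    if q.1.1 = K ∨ q.2.1 = K then sideAt q.1 (edgeJumpSq v q) t else 0 with hJJ
  have hJ0 : ∀ q : M.Side × M.Side, 0 ≤ sideAt q.1 (edgeJumpSq v q) t := fun q =>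
    sideAt_nonneg _ (edgeJumpSq_nonneg v q) t
  have hJJ0 : ∀ K, 0 ≤ JJ K := fun K => Finset.sum_nonneg fun q _ => by
    split_ifs
    · exact hJ0 q
    · exact le_rfl
  have hd0 : ∀ K ∈ S, 0 ≤ d K := fun K hK =>
    intervalIntegral.integral_nonneg (hlh K hK).le fun _ _ => norm_nonneg _
  have hval : ∀ K ∈ S, ∀ y ∈ Set.Icc (M.lo t K) (M.hi t K),
      |val v K (pt t y)| ≤ |val v K (pt t (M.lo t K))| + d K := fun K hK y hy => by
    have h1 := abs_val_sub_le v K t (y := M.lo t K) (z := y) ⟨le_rfl, (hlh K hK).le⟩ hy hy.1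
    have h2 := abs_sub_abs_le_abs_sub (val v K (pt t y)) (val v K (pt t (M.lo t K)))
    linarith
  -- `|val v K (pt t (M.lo t K))| + d K` bounds `|v|` on the section of `K`. Entering `K` from below
  -- costs the jump at its lower end plus the variation `d K`; on the bottom side the trace supplies
  -- the start.
  have hchain := chain_bound S (M.lo t) (M.hi t) (fun K => |val v K (pt t (M.lo t K))| + d K)
    (fun K => d K + √(JJ K)) √BB R.c hlh
    (fun K hK => add_nonneg (hd0 K hK) (Real.sqrt_nonneg _))
    (fun K hK hc => by
      obtain ⟨y, hy⟩ := hS K hK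
      have hmem := hloK K hK
      obtain ⟨i, hi⟩ := exists_bary_eq_zero hy (Or.inl rfl) hmem
      rw [hc] at hmem hi
      have h1 := Real.abs_le_sqrt (ht.bottom_sq_le v hmem hi)
      rw [hc]
      linarith [Real.sqrt_nonneg (JJ K)])
    (fun K hK hc => by
      obtain ⟨y, hy⟩ := hS K hK
      obtain ⟨L, hL, hLK, hhi⟩ := ht.exists_below hy hc
      have hLS : L ∈ S := Finset.mem_filter.2 ⟨Finset.mem_univ _, hL⟩
      refine ⟨L, hLS, hhi, ?_⟩
      have hmK := hloK K hK
      have hmL := hhiK L hLS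
      obtain ⟨i, hi⟩ := exists_bary_eq_zero hy (Or.inl rfl) hmK
      obtain ⟨z, hz⟩ := hL
      obtain ⟨j, hj⟩ := exists_bary_eq_zero hz (Or.inr rfl) hmL
      have h2 := hval L hLS (M.hi t L) ⟨(hlh L hLS).le, le_rfl⟩
      rw [hhi] at hmL hj h2
      have h1 := Real.abs_le_sqrt (ht.jump_sq_le v hLK hmK hmL hi hj)
      have h3 := abs_sub_abs_le_abs_sub (val v K (pt t (M.lo t K))) (val v L (pt t (M.lo t K)))
      linarith)
  set A := ∑ L ∈ S, (d L + √(JJ L)) with hA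
  -- At most `C / h` terms are summed. For the gradient part the factor `1 / h` is compensated by
  -- the section length in `hdsq`; for the jumps it remains.
  have hsq : A ^ 2 ≤ C / M.h * ∑ L ∈ S, (2 * d L ^ 2 + 2 * JJ L) := by
    calc A ^ 2 ≤ S.card * ∑ L ∈ S, (d L + √(JJ L)) ^ 2 := sq_sum_le_card_mul_sum_sq
      _ ≤ C / M.h * ∑ L ∈ S, (2 * d L ^ 2 + 2 * JJ L) := by
        refine mul_le_mul hN (Finset.sum_le_sum fun L _ => ?_)
          (Finset.sum_nonneg fun _ _ => sq_nonneg _) (by positivity)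
        nlinarith [Real.sq_sqrt (hJJ0 L), sq_nonneg (d L - √(JJ L))]
  have hdsq : ∀ L ∈ S, d L ^ 2 ≤
      M.h * ∫ y in M.lo t L..M.hi t L, ‖grad v L (pt t y)‖ ^ 2 := fun L hL => by
    have hc : Continuous fun w => ‖grad v L (pt t w)‖ :=
      ((continuous_grad v L).comp (continuous_pt_right t)).norm
    refine (sq_intervalIntegral_le hc (hlh L hL)).trans ?_
    exact mul_le_mul_of_nonneg_right (hlen L hL)
      (intervalIntegral.integral_nonneg (hlh L hL).le fun _ _ => sq_nonneg _)
  have hJsum : ∑ L ∈ S, JJ L ≤ 2 * ∑ q ∈ M.interiorPairs, sideAt q.1 (edgeJumpSq v q) t := by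
    calc ∑ L ∈ S, JJ L ≤ ∑ L, JJ L :=
          Finset.sum_le_sum_of_subset_of_nonneg (Finset.filter_subset _ _) fun L _ _ => hJJ0 L
      _ = ∑ q ∈ M.interiorPairs, ∑ L,
          if q.1.1 = L ∨ q.2.1 = L then sideAt q.1 (edgeJumpSq v q) t else 0 := Finset.sum_comm
      _ ≤ ∑ q ∈ M.interiorPairs, 2 * sideAt q.1 (edgeJumpSq v q) t := by
          refine Finset.sum_le_sum fun q _ => ?_
          calc _ ≤ ∑ L, ((if q.1.1 = L then sideAt q.1 (edgeJumpSq v q) t else 0) +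
                (if q.2.1 = L then sideAt q.1 (edgeJumpSq v q) t else 0)) := by
                refine Finset.sum_le_sum fun L _ => ?_
                have := hJ0 q
                split_ifs <;> simp_all
            _ = _ := by rw [Finset.sum_add_distrib]; simp; ring
      _ = _ := by rw [← Finset.mul_sum]
  set GG := ∑ L ∈ S, ∫ y in M.lo t L..M.hi t L, ‖grad v L (pt t y)‖ ^ 2
  set QQ := ∑ q ∈ M.interiorPairs, sideAt q.1 (edgeJumpSq v q) t
  have hsq' : A ^ 2 ≤ 2 * C * GG + 4 * C / M.h * QQ := by
    refine hsq.trans ?_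
    rw [Finset.sum_add_distrib, ← Finset.mul_sum, ← Finset.mul_sum]
    have e1 : ∑ L ∈ S, d L ^ 2 ≤ M.h * GG := by
      rw [Finset.mul_sum]; exact Finset.sum_le_sum hdsq
    calc _ ≤ C / M.h * (2 * (M.h * GG) + 2 * (2 * QQ)) := by gcongr
      _ = _ := by field_simp; ring
  set E := 2 * BB + 4 * C * GG + 8 * C / M.h * QQ with hE
  have hpoint : ∀ K ∈ S, ∀ y ∈ Set.Icc (M.lo t K) (M.hi t K), val v K (pt t y) ^ 2 ≤ E :=
    fun K hK y hy => by
      have h1 := (hval K hK y hy).trans (hchain K hK)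
      have h2 : val v K (pt t y) ^ 2 ≤ (√BB + A) ^ 2 := by
        rw [← sq_abs]
        gcongr
      have h3 : (√BB + A) ^ 2 ≤ 2 * BB + 2 * A ^ 2 := by
        nlinarith [Real.sq_sqrt hBB, sq_nonneg (√BB - A)]
      have h4 : E = 2 * BB + 2 * (2 * C * GG + 4 * C / M.h * QQ) := by rw [hE]; ring
      linarith
  have hE0 : 0 ≤ E := by
    have : 0 ≤ 2 * C * GG + 4 * C / M.h * QQ := (sq_nonneg A).trans hsq'
    have e : E = 2 * BB + 2 * (2 * C * GG + 4 * C / M.h * QQ) := by rw [hE]; ring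
    rw [e]; positivity
  calc ∑ K ∈ S, ∫ y in M.lo t K..M.hi t K, val v K (pt t y) ^ 2 ≤ ∑ K ∈ S, M.h * E := by
        refine Finset.sum_le_sum fun K hK => ?_
        have hc : Continuous fun w => val v K (pt t w) ^ 2 :=
          ((continuous_val v K).comp (continuous_pt_right t)).pow 2
        calc _ ≤ ∫ y in M.lo t K..M.hi t K, E :=
              intervalIntegral.integral_mono_on (hlh K hK).le (hc.intervalIntegrable _ _)
                intervalIntegrable_const (hpoint K hK)
          _ = (M.hi t K - M.lo t K) * E := by simp
          _ ≤ M.h * E := mul_le_mul_of_nonneg_right (hlen K hK) hE0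
    -- The pointwise bound `E` is summed over at most `C / h` sections of length at most `h`.
    _ = S.card * (M.h * E) := by rw [Finset.sum_const, nsmul_eq_mul]
    _ ≤ C / M.h * (M.h * E) := by gcongr
    _ = C * E := by field_simp

/-- The broken Poincaré inequality. -/
theorem QuasiUniform.poincare {ρ : ℝ} (hM : M.QuasiUniform ρ) (hρ : 0 < ρ) (v : M.V p)
    {C : ℝ} (hC : C = 8 * (R.d - R.c) / ρ ^ 2) :
    innerΩ v v ≤ C * (2 * innerΓ₁ v v +
        4 * C * (∑ K, ∫ x in M.cell K, ‖grad v K x‖ ^ 2) +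
        8 * C / M.h * M.skeletonSum (fun τ s s' x => ‖jump v τ s s' x‖ ^ 2)) := by
  have hh := M.h_pos
  have hcd := R.hcd
  have hC0 : 0 < C := by
    rw [hC]; exact div_pos (by linarith) (by positivity)
  have f1 := fun K => setIntegral_eq_iterated (M.measurableSet_cell K)
    (φ := fun x => val v K x ^ 2) (integrableOn_cell ((continuous_val v K).pow 2) K)
  have f2 := fun K => setIntegral_eq_iterated (M.measurableSet_cell K)
    (φ := fun x => ‖grad v K x‖ ^ 2) (integrableOn_cell ((continuous_grad v K).norm.pow 2) K)
  have i3 : ∀ s : M.Side, Integrable (sideAt s (fun x => val v s.1 x * val v s.1 x)) := fun s =>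
    integrable_sideAt s (Continuous.intervalIntegrable
      (((continuous_val v s.1).mul (continuous_val v s.1)).comp AffineMap.lineMap_continuous) 0 1)
  have i4 : ∀ q : M.Side × M.Side, Integrable (sideAt q.1 (edgeJumpSq v q)) := fun q =>
    integrable_sideAt q.1 (intervalIntegrable_edge 0 q.1 q.2
      ((continuous_jump v 0 q.1 q.2).norm.pow 2))
  have I1 : Integrable fun t => ∑ K, ∫ y in {y | pt t y ∈ M.cell K}, val v K (pt t y) ^ 2 :=
    integrable_finsetSum _ fun K _ => (f1 K).1
  have I2 : Integrable fun t => ∑ K, ∫ y in {y | pt t y ∈ M.cell K}, ‖grad v K (pt t y)‖ ^ 2 :=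
    integrable_finsetSum _ fun K _ => (f2 K).1
  have I3 : Integrable fun t =>
      ∑ s ∈ M.Γ₁Sides, sideAt s (fun x => val v s.1 x * val v s.1 x) t :=
    integrable_finsetSum _ fun s _ => i3 s
  have I4 : Integrable fun t => ∑ q ∈ M.interiorPairs, sideAt q.1 (edgeJumpSq v q) t :=
    integrable_finsetSum _ fun q _ => i4 q
  have J2 := I3.const_mul 2
  have J3 := I2.const_mul (4 * C)
  have J4 := I4.const_mul (8 * C / M.h)
  -- The line bound holds for almost every `t` and is integrated over all vertical lines.
  have hmono := integral_mono_ae I1 (((J2.fun_add J3).fun_add J4).const_mul C)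
    (M.ae_generic.mono fun t ht => hM.line_bound hρ v ht hC)
  rw [integral_const_mul, integral_add (J2.fun_add J3) J4, integral_add J2 J3,
    integral_const_mul, integral_const_mul, integral_const_mul,
    integral_finsetSum _ fun K _ => (f1 K).1, integral_finsetSum _ fun K _ => (f2 K).1,
    integral_finsetSum _ fun s _ => i3 s, integral_finsetSum _ fun q _ => i4 q] at hmono
  simp only [← (f1 _).2, ← (f2 _).2] at hmono
  have e1 : innerΩ v v = ∑ K, ∫ x in M.cell K, val v K x ^ 2 := by
    unfold innerΩ; simp only [sq]
  have e2 : ∑ s ∈ M.Γ₁Sides, ∫ t, sideAt s (fun x => val v s.1 x * val v s.1 x) t ≤ innerΓ₁ v v :=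
    Finset.sum_le_sum fun s _ => integral_sideAt_le s fun _ => mul_self_nonneg _
  have e3 : ∑ q ∈ M.interiorPairs, ∫ t, sideAt q.1 (edgeJumpSq v q) t ≤
      M.skeletonSum (fun τ s s' x => ‖jump v τ s s' x‖ ^ 2) := by
    unfold skeletonSum
    -- The vertical lines cross interior edges only; the periodic part of the skeleton is
    -- nonnegative and is added for free.
    refine le_add_of_le_of_nonneg (Finset.sum_le_sum fun q _ => ?_)
      (Finset.sum_nonneg fun q _ => edgeIntegral_nonneg _ _ _ fun _ => sq_nonneg _)
    exact integral_sideAt_le q.1 (edgeJumpSq_nonneg v q)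
  rw [e1]
  refine hmono.trans ?_
  gcongr

end Mesh

end DynBC

/-! ### Bilinear forms along absolutely continuous curves -/

namespace DynBC

/-- `B` is a bilinear form. -/
def IsBilin {E : Type*} [AddCommGroup E] [Module ℝ E] (B : E → E → ℝ) : Prop :=
  ∃ L : LinearMap.BilinForm ℝ E, ∀ v w, B v w = L v w

section Bilinear

variable {E : Type*} [AddCommGroup E] [Module ℝ E]

theorem IsBilin.add {B B' : E → E → ℝ} (h : IsBilin B) (h' : IsBilin B') :
    IsBilin fun v w => B v w + B' v w := by
  obtain ⟨L, hL⟩ := h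
  obtain ⟨L', hL'⟩ := h'
  exact ⟨L + L', fun v w => by simp [hL, hL']⟩

theorem IsBilin.const_mul {B : E → E → ℝ} (h : IsBilin B) (c : ℝ) :
    IsBilin fun v w => c * B v w := by
  obtain ⟨L, hL⟩ := h
  exact ⟨c • L, fun v w => by simp [hL]⟩

theorem IsBilin.sum {ι : Type*} (s : Finset ι) {B : ι → E → E → ℝ} (h : ∀ i, IsBilin (B i)) :
    IsBilin fun v w => ∑ i ∈ s, B i v w := by
  choose L hL using h
  exact ⟨∑ i ∈ s, L i, fun v w => by simp [hL, LinearMap.sum_apply]⟩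

theorem isBilin_inner {F : Type*} [NormedAddCommGroup F] [InnerProductSpace ℝ F] {l : E → F}
    (hl : IsLinearMap ℝ l) : IsBilin fun v w => (inner ℝ (l v) (l w) : ℝ) :=
  ⟨LinearMap.mk₂ ℝ (fun v w => (inner ℝ (l v) (l w) : ℝ))
    (fun v v' w => by rw [hl.map_add, inner_add_left])
    (fun c v w => by rw [hl.map_smul, real_inner_smul_left, smul_eq_mul])
    (fun v w w' => by rw [hl.map_add, inner_add_right])
    (fun c v w => by rw [hl.map_smul, real_inner_smul_right, smul_eq_mul]), fun v w => rfl⟩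

theorem isBilin_integral {X F : Type*} [MeasurableSpace X] (μ : Measure X)
    [NormedAddCommGroup F] [InnerProductSpace ℝ F] {l : E → X → F}
    (hl : ∀ x, IsLinearMap ℝ fun v => l v x)
    (h_int : ∀ v w, Integrable (fun x => (inner ℝ (l v x) (l w x) : ℝ)) μ) :
    IsBilin fun v w => ∫ x, (inner ℝ (l v x) (l w x) : ℝ) ∂μ := by
  refine ⟨LinearMap.mk₂ ℝ (fun v w => ∫ x, (inner ℝ (l v x) (l w x) : ℝ) ∂μ)
    (fun v v' w => ?_) (fun c v w => ?_) (fun v w w' => ?_) (fun c v w => ?_), fun v w => rfl⟩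
  · rw [← integral_add (h_int v w) (h_int v' w)]
    simp only [(hl _).map_add, inner_add_left]
  · rw [smul_eq_mul, ← integral_const_mul]
    simp only [(hl _).map_smul, inner_smul_left, conj_trivial]
  · rw [← integral_add (h_int v w) (h_int v w')]
    simp only [(hl _).map_add, inner_add_right]
  · rw [smul_eq_mul, ← integral_const_mul]
    simp only [(hl _).map_smul, inner_smul_right]

/-- The expansion in coordinates reduces statements about forms along a curve to products of two
scalar functions. -/
theorem IsBilin.eq_sum [FiniteDimensional ℝ E] {B : E → E → ℝ} (h : IsBilin B) (v w : E) :
    B v w = ∑ i, ∑ j, B (Module.finBasis ℝ E i) (Module.finBasis ℝ E j) *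
      ((Module.finBasis ℝ E).coord i v * (Module.finBasis ℝ E).coord j w) := by
  obtain ⟨L, hL⟩ := h
  simp only [hL]
  set b := Module.finBasis ℝ E
  conv_lhs => rw [← b.sum_repr v, ← b.sum_repr w]
  simp only [map_sum, LinearMap.sum_apply, map_smul, LinearMap.smul_apply, smul_eq_mul,
    Module.Basis.coord_apply]
  simp only [Finset.mul_sum]
  rw [Finset.sum_comm]
  refine Finset.sum_congr rfl fun i _ => ?_
  refine Finset.sum_congr rfl fun j _ => ?_
  ring

end Bilinear

/-- Integration by parts for primitives of integrable functions. -/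
theorem integral_mul_add_mul_eq {a b α β : ℝ → ℝ} {a₀ b₀ T : ℝ} (hT : 0 < T)
    (hα : IntervalIntegrable α volume 0 T) (hβ : IntervalIntegrable β volume 0 T)
    (ha : ∀ t ∈ Set.Icc 0 T, a t = a₀ + ∫ r in (0 : ℝ)..t, α r)
    (hb : ∀ t ∈ Set.Icc 0 T, b t = b₀ + ∫ r in (0 : ℝ)..t, β r) :
    ContinuousOn a (Set.Icc 0 T) ∧
    IntervalIntegrable (fun t => α t * b t + a t * β t) volume 0 T ∧
    ∫ t in (0 : ℝ)..T, (α t * b t + a t * β t) = a T * b T - a₀ * b₀ := by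
  have key : ∀ {a α : ℝ → ℝ} {a₀ : ℝ}, IntervalIntegrable α volume 0 T →
      (∀ t ∈ Set.Icc 0 T, a t = a₀ + ∫ r in (0 : ℝ)..t, α r) →
      AbsolutelyContinuousOnInterval (fun t => a₀ + ∫ r in (0 : ℝ)..t, α r) 0 T ∧
      ContinuousOn a (Set.Icc 0 T) ∧
      ∀ᵐ t, t ∈ Set.uIoc 0 T → deriv (fun t => a₀ + ∫ r in (0 : ℝ)..t, α r) t = α t := by
    intro a α a₀ hα ha
    -- The function `a` is prescribed only on `[0, T]`, so the explicit primitive, which is defined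
    -- everywhere, is differentiated in its place.
    have hac : AbsolutelyContinuousOnInterval (fun t => a₀ + ∫ r in (0 : ℝ)..t, α r) 0 T := by
      have h1 : AbsolutelyContinuousOnInterval (fun _ : ℝ => a₀) 0 T :=
        (LipschitzWith.const a₀).lipschitzOnWith.absolutelyContinuousOnInterval
      exact h1.add (hα.absolutelyContinuousOnInterval_intervalIntegral (by simp))
    refine ⟨hac, ?_, ?_⟩
    · have := hac.continuousOn
      rw [Set.uIcc_of_le hT.le] at this
      exact this.congr ha
    · filter_upwards [hα.ae_hasDerivAt_integral] with t ht htm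
      have := ht (Set.uIoc_subset_uIcc htm) 0 (by simp)
      exact (this.const_add a₀).deriv
  obtain ⟨acA, cA, dA⟩ := key hα ha
  obtain ⟨acB, cB, dB⟩ := key hβ hb
  have hu : Set.uIcc 0 T = Set.Icc 0 T := Set.uIcc_of_le hT.le
  refine ⟨cA, (hα.mul_continuousOn (hu ▸ cB)).add (hβ.continuousOn_mul (hu ▸ cA)), ?_⟩
  have h1 := acA.integral_deriv_mul_eq_sub acB
  rw [← ha T ⟨hT.le, le_rfl⟩, ← hb T ⟨hT.le, le_rfl⟩] at h1
  simp only [intervalIntegral.integral_same, add_zero] at h1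
  rw [← h1]
  refine intervalIntegral.integral_congr_ae ?_
  filter_upwards [dA, dB] with t h2 h3 ht
  have htm : t ∈ Set.Icc 0 T := hu ▸ Set.uIoc_subset_uIcc ht
  rw [h2 ht, h3 ht, ← ha t htm, ← hb t htm]

/-- `u` is a primitive of `w` on `[0, T]`, tested with linear functionals. -/
def IsPrimitive {E : Type*} [AddCommGroup E] [Module ℝ E] (T : ℝ) (u₀ : E) (u w : ℝ → E)
    (φ : Module.Dual ℝ E) : Prop :=
  IntervalIntegrable (fun t => φ (w t)) volume 0 T ∧
    ∀ t ∈ Set.Icc 0 T, φ (u t) = φ u₀ + ∫ r in (0 : ℝ)..t, φ (w r)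

section Primitive

variable {E : Type*} [AddCommGroup E] [Module ℝ E] [FiniteDimensional ℝ E] {T : ℝ} {u₀ : E}
  {u w : ℝ → E}

/-- It suffices to test with a separating family of functionals. -/
theorem isPrimitive_of_separating {S : Set (Module.Dual ℝ E)}
    (hS : ∀ v, (∀ φ ∈ S, φ v = 0) → v = 0) (h : ∀ φ ∈ S, IsPrimitive T u₀ u w φ) :
    ∀ φ, IsPrimitive T u₀ u w φ := by
  -- A subspace of the dual of a finite-dimensional space is determined by its common zeros, here
  -- only the zero vector.
  have hspan : Submodule.span ℝ S = ⊤ := by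
    have h1 : (Submodule.span ℝ S).dualCoannihilator = ⊥ := by
      rw [eq_bot_iff]
      intro v hv
      rw [Submodule.mem_dualCoannihilator] at hv
      exact hS v fun φ hφ => hv φ (Submodule.subset_span hφ)
    have h2 := Subspace.dualCoannihilator_dualAnnihilator_eq (W := Submodule.span ℝ S)
    rw [h1, Submodule.dualAnnihilator_bot] at h2
    exact h2.symm
  have hsub : ∀ t ∈ Set.Icc 0 T, Set.uIcc 0 t ⊆ Set.uIcc 0 T := fun t ht => by
    rw [Set.uIcc_of_le ht.1, Set.uIcc_of_le (ht.1.trans ht.2)]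
    exact Set.Icc_subset_Icc_right ht.2
  intro φ
  have hφ : φ ∈ Submodule.span ℝ S := hspan ▸ Submodule.mem_top
  induction hφ using Submodule.span_induction with
  | mem φ hφ => exact h φ hφ
  | zero => exact ⟨by simp, fun t _ => by simp⟩
  | add φ ψ _ _ hφ hψ =>
    refine ⟨hφ.1.add hψ.1, fun t ht => ?_⟩
    simp only [LinearMap.add_apply]
    rw [hφ.2 t ht, hψ.2 t ht, intervalIntegral.integral_add (hφ.1.mono_set (hsub t ht))
      (hψ.1.mono_set (hsub t ht))]
    ring
  | smul c φ _ hφ =>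
    refine ⟨hφ.1.const_mul c, fun t ht => ?_⟩
    simp only [LinearMap.smul_apply, smul_eq_mul]
    rw [hφ.2 t ht, intervalIntegral.integral_const_mul]
    ring

theorem IsBilin.continuousOn {B : E → E → ℝ} (hB : IsBilin B) (hT : 0 < T)
    (h : ∀ φ, IsPrimitive T u₀ u w φ) : ContinuousOn (fun t => B (u t) (u t)) (Set.Icc 0 T) := by
  simp_rw [hB.eq_sum (u _) (u _)]
  have hc : ∀ φ : Module.Dual ℝ E, ContinuousOn (fun t => φ (u t)) (Set.Icc 0 T) := fun φ =>
    (integral_mul_add_mul_eq hT (h φ).1 (h φ).1 (h φ).2 (h φ).2).1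
  exact continuousOn_finsetSum _ fun i _ => continuousOn_finsetSum _ fun j _ =>
    continuousOn_const.mul ((hc _).mul (hc _))

/-- The fundamental theorem of calculus for a quadratic form along a curve. -/
theorem IsBilin.integral_eq {B : E → E → ℝ} (hB : IsBilin B) (hT : 0 < T)
    (h : ∀ φ, IsPrimitive T u₀ u w φ) :
    IntervalIntegrable (fun t => B (w t) (u t) + B (u t) (w t)) volume 0 T ∧
      ∫ t in (0 : ℝ)..T, (B (w t) (u t) + B (u t) (w t)) = B (u T) (u T) - B u₀ u₀ := by
  set b := Module.finBasis ℝ E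
  have hp := fun i j => integral_mul_add_mul_eq hT (h (b.coord i)).1 (h (b.coord j)).1
    (h (b.coord i)).2 (h (b.coord j)).2
  have e : ∀ t, B (w t) (u t) + B (u t) (w t) = ∑ i, ∑ j, B (b i) (b j) *
      (b.coord i (w t) * b.coord j (u t) + b.coord i (u t) * b.coord j (w t)) := fun t => by
    rw [hB.eq_sum (w t) (u t), hB.eq_sum (u t) (w t), ← Finset.sum_add_distrib]
    refine Finset.sum_congr rfl fun i _ => ?_
    rw [← Finset.sum_add_distrib]
    exact Finset.sum_congr rfl fun j _ => by ring
  simp_rw [e]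
  have hi : ∀ i j, IntervalIntegrable (fun t => B (b i) (b j) *
      (b.coord i (w t) * b.coord j (u t) + b.coord i (u t) * b.coord j (w t))) volume 0 T :=
    fun i j => (hp i j).2.1.const_mul _
  have hi' : ∀ i, IntervalIntegrable (fun t => ∑ j, B (b i) (b j) *
      (b.coord i (w t) * b.coord j (u t) + b.coord i (u t) * b.coord j (w t))) volume 0 T :=
    fun i => by
      have := IntervalIntegrable.sum Finset.univ fun j (_ : j ∈ Finset.univ) => hi i j
      simpa only [Finset.sum_fn] using this
  constructor
  · have := IntervalIntegrable.sum Finset.univ fun i (_ : i ∈ Finset.univ) => hi' i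
    simpa only [Finset.sum_fn] using this
  · rw [intervalIntegral.integral_finsetSum fun i _ => hi' i, hB.eq_sum (u T), hB.eq_sum u₀,
      ← Finset.sum_sub_distrib]
    refine Finset.sum_congr rfl fun i _ => ?_
    rw [intervalIntegral.integral_finsetSum fun j _ => hi i j, ← Finset.sum_sub_distrib]
    refine Finset.sum_congr rfl fun j _ => ?_
    rw [intervalIntegral.integral_const_mul, (hp i j).2.2]
    ring

end Primitive

namespace Mesh

variable {R : Rect} {M : Mesh R} {p : ℕ}

/-! ### Bilinearity of the discrete forms. -/

theorem isLinearMap_val (K : Fin M.n) (x : Plane) :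
    IsLinearMap ℝ fun v : M.V p => val v K x :=
  ⟨fun v w => by simp [val], fun c v => by simp [val]⟩

theorem isLinearMap_grad (K : Fin M.n) (x : Plane) :
    IsLinearMap ℝ fun v : M.V p => grad v K x := by
  constructor
  · intro v w
    ext i
    simp [grad_apply]
  · intro c v
    ext i
    simp [grad_apply]

theorem isLinearMap_tgrad (s : M.Side) (x : Plane) :
    IsLinearMap ℝ fun v : M.V p => tgrad v s x := by
  have h := isLinearMap_grad (p := p) s.1 x
  constructor
  · intro v w
    simp only [tgrad, h.map_add, inner_add_right]
    module
  · intro c v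
    simp only [tgrad, h.map_smul, inner_smul_right]
    module

theorem isLinearMap_jump (τ : Plane) (s s' : M.Side) (x : Plane) :
    IsLinearMap ℝ fun v : M.V p => jump v τ s s' x := by
  have h := isLinearMap_val (p := p) s.1 x
  have h' := isLinearMap_val (p := p) s'.1 (x + τ)
  constructor
  · intro v w
    simp only [jump, h.map_add, h'.map_add]
    module
  · intro c v
    simp only [jump, h.map_smul, h'.map_smul, smul_eq_mul]
    module

theorem isLinearMap_avgGrad (τ : Plane) (s s' : M.Side) (x : Plane) :
    IsLinearMap ℝ fun v : M.V p => avgGrad v τ s s' x := by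
  have h := isLinearMap_grad (p := p) s.1 x
  have h' := isLinearMap_grad (p := p) s'.1 (x + τ)
  constructor
  · intro v w
    simp only [avgGrad, h.map_add, h'.map_add]
    module
  · intro c v
    simp only [avgGrad, h.map_smul, h'.map_smul]
    module

theorem isLinearMap_ridgeJump (q : M.Side × M.Side) :
    IsLinearMap ℝ fun v : M.V p => ridgeJump v q := by
  have h := isLinearMap_val (p := p) q.1.1 (M.rightEnd q.1)
  have h' := isLinearMap_val (p := p) q.2.1 (M.leftEnd q.2)
  constructor
  · intro v w
    simp only [ridgeJump, h.map_add, h'.map_add]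
    module
  · intro c v
    simp only [ridgeJump, h.map_smul, h'.map_smul, smul_eq_mul]
    module

theorem isLinearMap_ridgeAvg (q : M.Side × M.Side) :
    IsLinearMap ℝ fun v : M.V p => ridgeAvg v q := by
  have h := isLinearMap_tgrad (p := p) q.1 (M.rightEnd q.1)
  have h' := isLinearMap_tgrad (p := p) q.2 (M.leftEnd q.2)
  constructor
  · intro v w
    simp only [ridgeAvg, h.map_add, h'.map_add]
    module
  · intro c v
    simp only [ridgeAvg, h.map_smul, h'.map_smul]
    module

theorem isBilin_sideIntegral {F : Type*} [NormedAddCommGroup F] [InnerProductSpace ℝ F]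
    (s : M.Side) {l : M.V p → Plane → F} (hl : ∀ x, IsLinearMap ℝ fun v => l v x)
    (hc : ∀ v, Continuous (l v)) :
    IsBilin fun v w => M.sideIntegral s fun x => (inner ℝ (l v x) (l w x) : ℝ) := by
  unfold sideIntegral
  refine IsBilin.const_mul ?_ _
  simp only [intervalIntegral.integral_of_le zero_le_one]
  refine isBilin_integral (volume.restrict (Set.Ioc (0 : ℝ) 1))
    (l := fun v r => l v (AffineMap.lineMap (M.endA s) (M.endB s) r)) (fun r => hl _)
    fun v w => ?_
  have : Continuous fun r : ℝ => (inner ℝ (l v (AffineMap.lineMap (M.endA s) (M.endB s) r))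
      (l w (AffineMap.lineMap (M.endA s) (M.endB s) r)) : ℝ) :=
    ((hc v).comp AffineMap.lineMap_continuous).inner ((hc w).comp AffineMap.lineMap_continuous)
  exact (this.intervalIntegrable 0 1).1

theorem isBilin_edgeIntegral (τ : Plane) (s s' : M.Side) {l : M.V p → Plane → Plane}
    (hl : ∀ x, IsLinearMap ℝ fun v => l v x) (hc : ∀ v, Continuous (l v)) :
    IsBilin fun v w => M.edgeIntegral τ s s' fun x => (inner ℝ (l v x) (l w x) : ℝ) := by
  classical
  unfold edgeIntegral sideIntegral
  refine IsBilin.const_mul ?_ _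
  simp only [intervalIntegral.integral_of_le zero_le_one]
  have hb := isBilin_integral (E := M.V p) ((volume.restrict (Set.Ioc (0 : ℝ) 1)).restrict
      {r | AffineMap.lineMap (M.endA s) (M.endB s) r + τ ∈ M.seg s'})
    (l := fun v r => l v (AffineMap.lineMap (M.endA s) (M.endB s) r)) (fun r => hl _)
    fun v w => by
      have : Continuous fun r : ℝ => (inner ℝ (l v (AffineMap.lineMap (M.endA s) (M.endB s) r))
          (l w (AffineMap.lineMap (M.endA s) (M.endB s) r)) : ℝ) :=
        ((hc v).comp AffineMap.lineMap_continuous).inner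
          ((hc w).comp AffineMap.lineMap_continuous)
      exact ((this.intervalIntegrable (μ := volume) 0 1).1).integrable.mono_measure
        Measure.restrict_le_self
  convert hb using 3 with v w
  have hm : MeasurableSet {r : ℝ | AffineMap.lineMap (M.endA s) (M.endB s) r + τ ∈ M.seg s'} :=
    ((M.isClosed_seg s').preimage (by fun_prop)).measurableSet
  rw [← integral_indicator hm]
  refine integral_congr_ae (Filter.Eventually.of_forall fun r => ?_)
  simp [Set.indicator_apply]

theorem isBilin_skeletonSum {l : M.V p → Plane → M.Side → M.Side → Plane → Plane}
    (hl : ∀ τ s s' x, IsLinearMap ℝ fun v => l v τ s s' x)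
    (hc : ∀ v τ s s', Continuous (l v τ s s')) :
    IsBilin fun v w => M.skeletonSum
      fun τ s s' x => (inner ℝ (l v τ s s' x) (l w τ s s' x) : ℝ) := by
  have h : ∀ (τ : Plane) (Q : Finset (M.Side × M.Side)), IsBilin fun v w : M.V p => ∑ q ∈ Q,
      M.edgeIntegral τ q.1 q.2 fun x => (inner ℝ (l v τ q.1 q.2 x) (l w τ q.1 q.2 x) : ℝ) :=
    fun τ Q => IsBilin.sum Q fun q => isBilin_edgeIntegral τ q.1 q.2
      (l := fun v x => l v τ q.1 q.2 x) (fun x => hl τ q.1 q.2 x) fun v => hc v τ q.1 q.2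
  exact (h 0 M.interiorPairs).add (h R.period M.periodicPairs)

theorem isBilin_innerΩ : IsBilin (innerΩ (M := M) (p := p)) := by
  have : IsBilin fun v w : M.V p => ∑ K, ∫ x in M.cell K, (inner ℝ (val v K x) (val w K x) : ℝ) :=
    IsBilin.sum _ fun K => isBilin_integral _ (isLinearMap_val K) fun v w =>
      integrableOn_cell ((continuous_val v K).inner (continuous_val w K)) K
  convert this using 5 with v w K x
  unfold innerΩ
  simp [mul_comm]

theorem isBilin_innerΓ₁ : IsBilin (innerΓ₁ (M := M) (p := p)) := by
  have : IsBilin fun v w : M.V p => ∑ s ∈ M.Γ₁Sides,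
      M.sideIntegral s fun x => (inner ℝ (val v s.1 x) (val w s.1 x) : ℝ) :=
    IsBilin.sum _ fun s => isBilin_sideIntegral s (isLinearMap_val s.1)
      fun v => continuous_val v s.1
  convert this using 5 with v w
  unfold innerΓ₁
  simp [mul_comm]

/-- As the diagonal of a bilinear form, the squared energy norm is continuous along the solution,
hence integrable in time. -/
theorem exists_isBilin_energyNormSq (α β γ : ℝ) :
    ∃ B : M.V p → M.V p → ℝ, IsBilin B ∧ ∀ v, energyNormSq α β γ v = B v v := by
  have b1 : IsBilin fun v w : M.V p =>
      ∑ K, ∫ x in M.cell K, (inner ℝ (grad v K x) (grad w K x) : ℝ) :=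
    IsBilin.sum _ fun K => isBilin_integral _ (isLinearMap_grad K) fun v w =>
      integrableOn_cell ((continuous_grad v K).inner (continuous_grad w K)) K
  have b2 := isBilin_skeletonSum (M := M) (p := p) (l := fun v τ s s' x => jump v τ s s' x)
    isLinearMap_jump continuous_jump
  have b3 := isBilin_skeletonSum (M := M) (p := p) (l := fun v τ s s' x => avgGrad v τ s s' x)
    isLinearMap_avgGrad continuous_avgGrad
  have b4 : IsBilin fun v w : M.V p => ∑ s ∈ M.Γ₁Sides,
      M.sideIntegral s fun x => (inner ℝ (tgrad v s x) (tgrad w s x) : ℝ) :=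
    IsBilin.sum _ fun s => isBilin_sideIntegral s (isLinearMap_tgrad s)
      fun v => continuous_tgrad v s
  have b5 : IsBilin fun v w : M.V p =>
      ∑ q ∈ M.ridges, (inner ℝ (ridgeJump v q) (ridgeJump w q) : ℝ) :=
    IsBilin.sum _ fun q => isBilin_inner (isLinearMap_ridgeJump q)
  have b6 : IsBilin fun v w : M.V p =>
      ∑ q ∈ M.ridges, (inner ℝ (ridgeAvg v q) (ridgeAvg w q) : ℝ) :=
    IsBilin.sum _ fun q => isBilin_inner (isLinearMap_ridgeAvg q)
  refine ⟨_, (((((b1.add (b2.const_mul (γ / M.h))).add (b3.const_mul (1 / (γ / M.h)))).add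
    (isBilin_innerΓ₁.const_mul α)).add (b4.const_mul β)).add
    (b5.const_mul (β * (γ / M.h)))).add (b6.const_mul (β / (γ / M.h))), fun v => ?_⟩
  unfold energyNormSq bulkNormSq
  simp only [real_inner_self_eq_norm_sq]

/-- The coefficients determine a piecewise polynomial. -/
theorem isPrimitive_of_coeff {T : ℝ} {u₀ : M.V p} {u w : ℝ → M.V p}
    (hw : ∀ K m, IntervalIntegrable
      (fun t => MvPolynomial.coeff m (w t K : MvPolynomial (Fin 2) ℝ)) volume 0 T)
    (hu : ∀ t ∈ Set.Icc 0 T, ∀ K m,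
      MvPolynomial.coeff m (u t K : MvPolynomial (Fin 2) ℝ) =
        MvPolynomial.coeff m (u₀ K : MvPolynomial (Fin 2) ℝ) +
          (∫ r in (0 : ℝ)..t, MvPolynomial.coeff m (w r K : MvPolynomial (Fin 2) ℝ))) :
    ∀ φ, IsPrimitive T u₀ u w φ := by
  refine isPrimitive_of_separating
    (S := Set.range fun q : Fin M.n × (Fin 2 →₀ ℕ) => (MvPolynomial.lcoeff ℝ q.2) ∘ₗ
      (MvPolynomial.restrictTotalDegree (Fin 2) ℝ p).subtype ∘ₗ (LinearMap.proj q.1)) ?_ ?_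
  · intro v hv
    funext K
    apply Subtype.ext
    ext m
    exact hv _ ⟨(K, m), rfl⟩
  · rintro _ ⟨⟨K, m⟩, rfl⟩
    exact ⟨hw K m, fun t ht => hu t ht K m⟩

end Mesh

end DynBC

/-! ### Estimates of the loads -/

namespace DynBC

theorem Rect.isOpen_Ω (R : Rect) : IsOpen R.Ω := by
  have h0 : Continuous fun x : Plane => x 0 := by fun_prop
  have h1 : Continuous fun x : Plane => x 1 := by fun_prop
  exact (isOpen_lt continuous_const h0).inter ((isOpen_lt h0 continuous_const).inter
    ((isOpen_lt continuous_const h1).inter (isOpen_lt h1 continuous_const)))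

theorem Rect.convex_Ω (R : Rect) : Convex ℝ R.Ω := by
  have h0 : IsLinearMap ℝ fun x : Plane => x 0 := ⟨fun _ _ => rfl, fun _ _ => rfl⟩
  have h1 : IsLinearMap ℝ fun x : Plane => x 1 := ⟨fun _ _ => rfl, fun _ _ => rfl⟩
  exact (convex_halfSpace_gt h0 _).inter ((convex_halfSpace_lt h0 _).inter
    ((convex_halfSpace_gt h1 _).inter (convex_halfSpace_lt h1 _)))

theorem Rect.closure_Ω_ae_eq (R : Rect) : closure R.Ω =ᵐ[volume] R.Ω := by
  have h := R.convex_Ω.addHaar_frontier volume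
  rw [R.isOpen_Ω.frontier_eq] at h
  exact (ae_eq_set).2 ⟨h, by rw [Set.sdiff_eq_empty.2 subset_closure]; simp⟩

instance Rect.isFiniteMeasure_μΓ₁ (R : Rect) : IsFiniteMeasure R.μΓ₁ := by
  unfold Rect.μΓ₁
  infer_instance

theorem integral_μΓ₁ (R : Rect) {φ : Plane → ℝ} (hφ : Integrable φ R.μΓ₁) :
    IntegrableOn (fun t => φ (pt t R.c)) (Set.Ioo R.a R.b) ∧
    IntegrableOn (fun t => φ (pt t R.d)) (Set.Ioo R.a R.b) ∧
    ∫ x, φ x ∂(R.μΓ₁) = (∫ t in Set.Ioo R.a R.b, φ (pt t R.c)) +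
      ∫ t in Set.Ioo R.a R.b, φ (pt t R.d) := by
  have hm : ∀ y : ℝ, Measurable fun t : ℝ => pt t y := fun y =>
    (continuous_pt.comp (by fun_prop : Continuous fun t : ℝ => (t, y))).measurable
  unfold Rect.μΓ₁ at hφ ⊢
  obtain ⟨h1, h2⟩ := integrable_add_measure.1 hφ
  refine ⟨h1.comp_measurable (hm R.c), h2.comp_measurable (hm R.d), ?_⟩
  rw [integral_add_measure h1 h2]
  exact congrArg₂ (· + ·)
    (integral_map (hm R.c).aemeasurable h1.aestronglyMeasurable)
    (integral_map (hm R.d).aemeasurable h2.aestronglyMeasurable)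

namespace Mesh

variable {R : Rect} {M : Mesh R} {p : ℕ}

theorem interior_cell_ae_eq (K : Fin M.n) : interior (M.cell K) =ᵐ[volume] M.cell K := by
  have h := (M.convex_cell K).addHaar_frontier volume
  rw [(M.isCompact_cell K).isClosed.frontier_eq] at h
  exact (ae_eq_set).2 ⟨by rw [Set.sdiff_eq_empty.2 interior_subset]; simp, h⟩

/-- The triangles may overlap on their boundaries, but by convexity these are null sets, and the
interiors are disjoint. -/
theorem sum_setIntegral_cell_le {φ : Plane → ℝ} (hφ : IntegrableOn φ R.Ω) (h0 : ∀ x, 0 ≤ φ x) :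
    (∀ K : Fin M.n, IntegrableOn φ (M.cell K)) ∧
      ∑ K, ∫ x in M.cell K, φ x ≤ ∫ x in R.Ω, φ x := by
  have hφ' : IntegrableOn φ (closure R.Ω) := hφ.congr_set_ae R.closure_Ω_ae_eq
  have hi : ∀ K : Fin M.n, IntegrableOn φ (M.cell K) := fun K => hφ'.mono_set (cell_subset K)
  refine ⟨hi, ?_⟩
  have hU := integral_iUnion_fintype (μ := volume) (f := φ)
    (s := fun K : Fin M.n => interior (M.cell K)) (fun K => isOpen_interior.measurableSet)
    (fun K L hKL => M.disjoint_interior K L hKL) (fun K => (hi K).mono_set interior_subset)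
  rw [← Finset.sum_congr rfl fun K _ => setIntegral_congr_set (f := φ) (interior_cell_ae_eq K),
    ← hU, setIntegral_congr_set R.closure_Ω_ae_eq.symm]
  exact setIntegral_mono_set hφ' (Filter.Eventually.of_forall h0)
    (Set.iUnion_subset fun K => interior_subset.trans (cell_subset K)).eventuallyLE

theorem abs_mul_le_young (a b : ℝ) {δ : ℝ} (hδ : 0 < δ) :
    |a * b| ≤ δ * (b * b) + 1 / (4 * δ) * a ^ 2 := by
  have h3 : ∀ s : ℝ, s ^ 2 = 1 → s * (a * b) ≤ δ * (b * b) + 1 / (4 * δ) * a ^ 2 := fun s hs => by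
    have h4 : δ * (b * b) + 1 / (4 * δ) * a ^ 2 - s * (a * b) =
        (2 * δ * b - s * a) ^ 2 / (4 * δ) + (1 - s ^ 2) * a ^ 2 / (4 * δ) := by field_simp; ring
    rw [hs, sub_self, zero_mul, zero_div, add_zero] at h4
    have h5 : 0 ≤ (2 * δ * b - s * a) ^ 2 / (4 * δ) := by positivity
    linarith
  refine abs_le'.2 ⟨?_, ?_⟩
  · simpa using h3 1 (by norm_num)
  · simpa using h3 (-1) (by norm_num)

theorem loadΩ_le {f : Plane → ℝ} (hf : IntegrableOn (fun x => f x ^ 2) R.Ω) (v : M.V p) {δ : ℝ}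
    (hδ : 0 < δ) : loadΩ f v ≤ δ * innerΩ v v + 1 / (4 * δ) * ∫ x in R.Ω, f x ^ 2 := by
  obtain ⟨hi, hsum⟩ := sum_setIntegral_cell_le (M := M) hf fun _ => sq_nonneg _
  have h1 : ∀ K, ∫ x in M.cell K, f x * val v K x ≤
      δ * (∫ x in M.cell K, val v K x * val v K x) + 1 / (4 * δ) * ∫ x in M.cell K, f x ^ 2 :=
    fun K => by
      have iv : IntegrableOn (fun x => val v K x * val v K x) (M.cell K) :=
        integrableOn_cell ((continuous_val v K).mul (continuous_val v K)) K
      rw [← integral_const_mul, ← integral_const_mul,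
        ← integral_add (iv.const_mul δ) ((hi K).const_mul _)]
      -- An integrable majorant suffices: if `f v` were not integrable, its integral would be zero
      -- by convention.
      exact (Real.le_norm_self _).trans (norm_integral_le_of_norm_le
        ((iv.const_mul δ).add ((hi K).const_mul (1 / (4 * δ))))
        (Filter.Eventually.of_forall fun x => abs_mul_le_young _ _ hδ))
  unfold loadΩ innerΩ
  refine (Finset.sum_le_sum fun K _ => h1 K).trans ?_
  rw [Finset.sum_add_distrib, ← Finset.mul_sum, ← Finset.mul_sum]
  gcongr

/-- The projection to the first axis of the relative interior of a side. -/
def shadow (s : M.Side) : Set ℝ :=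
  {t | (t - M.endA s 0) / (M.endB s 0 - M.endA s 0) ∈ Set.Ioo (0 : ℝ) 1}

theorem measurableSet_shadow (s : M.Side) : MeasurableSet (shadow s) := by
  have : Measurable fun t : ℝ => (t - M.endA s 0) / (M.endB s 0 - M.endA s 0) := by fun_prop
  exact this measurableSet_Ioo

theorem pt_of_mem_shadow {s : M.Side} (hs : s ∈ M.Γ₁Sides) {t : ℝ} (ht : t ∈ shadow s) :
    AffineMap.lineMap (M.endA s) (M.endB s) ((t - M.endA s 0) / (M.endB s 0 - M.endA s 0)) =
      pt t (M.endA s 1) := by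
  have hne : M.endB s 0 - M.endA s 0 ≠ 0 := fun h => by
    have := ht.1
    simp [h] at this
  ext i
  fin_cases i
  · simp [AffineMap.lineMap_apply, div_mul_cancel₀ _ hne]
  · simp [AffineMap.lineMap_apply, (Γ₁Sides_height hs).2]

theorem sideAt_eq_indicator {s : M.Side} (hs : s ∈ M.Γ₁Sides) (φ : Plane → ℝ) :
    sideAt s φ = (shadow s).indicator fun t => φ (pt t (M.endA s 1)) := by
  ext t
  by_cases ht : t ∈ shadow s
  · rw [Set.indicator_of_mem ht, ← pt_of_mem_shadow hs ht]
    exact Set.indicator_of_mem (s := Set.Ioo (0 : ℝ) 1) ht _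
  · rw [Set.indicator_of_notMem ht]
    exact Set.indicator_of_notMem (s := Set.Ioo (0 : ℝ) 1) ht _

theorem pt_mem_cell_of_mem_shadow {s : M.Side} (hs : s ∈ M.Γ₁Sides) {t : ℝ} (ht : t ∈ shadow s) :
    pt t (M.endA s 1) ∈ M.cell s.1 := by
  rw [← pt_of_mem_shadow hs ht]
  exact M.seg_subset_cell s (lineMap_mem_seg s (Set.Ioo_subset_Icc_self ht))

theorem shadow_subset (s : M.Side) : shadow s ⊆ Set.Ioo R.a R.b := by
  intro t ht
  have hA := mem_closure_Ω_iff.1 (cell_subset _ (M.endA_mem_cell s))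
  have hB := mem_closure_Ω_iff.1 (cell_subset _ (M.endB_mem_cell s))
  have hne : M.endB s 0 - M.endA s 0 ≠ 0 := fun h => by
    have := ht.1
    simp [h] at this
  obtain ⟨h1, h2⟩ := ht
  set r := (t - M.endA s 0) / (M.endB s 0 - M.endA s 0) with hr
  have htr : t = (1 - r) * M.endA s 0 + r * M.endB s 0 := by
    have : r * (M.endB s 0 - M.endA s 0) = t - M.endA s 0 := div_mul_cancel₀ _ hne
    linarith
  rcases lt_or_gt_of_ne hne with h | h
  · constructor <;> nlinarith [hA.1, hA.2.1, hB.1, hB.2.1]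
  · constructor <;> nlinarith [hA.1, hA.2.1, hB.1, hB.2.1]

theorem sideIntegral_eq_integral_sideAt {s : M.Side} (hs : s ∈ M.Γ₁Sides) (φ : Plane → ℝ) :
    M.sideIntegral s φ = ∫ t, sideAt s φ t := by
  have hd : dist (M.endA s) (M.endB s) = |M.endB s 0 - M.endA s 0| := by
    rw [dist_comm, EuclideanSpace.dist_eq, Fin.sum_univ_two, (Γ₁Sides_height hs).2, dist_self]
    simp [Real.dist_eq, Real.sqrt_sq_eq_abs]
  rw [integral_sideAt, sideIntegral, hd]

/-- Only a bound for the multiplicity with which the sides cover `Γ₁` is needed: at most `16 / ρ²`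
triangles contain each of the two points above `t`, and each triangle has three sides, so `96 = (16
+ 16) · 3`. -/
theorem QuasiUniform.sum_sideAt_le {ρ : ℝ} (hM : M.QuasiUniform ρ) (hρ : 0 < ρ) {φ : Plane → ℝ}
    (h0 : ∀ x, 0 ≤ φ x) (t : ℝ) :
    ∑ s ∈ M.Γ₁Sides, sideAt s φ t ≤ 96 / ρ ^ 2 *
      (Set.Ioo R.a R.b).indicator (fun t => φ (pt t R.c) + φ (pt t R.d)) t := by
  classical
  set X := (Set.Ioo R.a R.b).indicator (fun t => φ (pt t R.c) + φ (pt t R.d)) t with hX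
  have hX0 : 0 ≤ X := Set.indicator_nonneg (fun t _ => add_nonneg (h0 _) (h0 _)) t
  let S := M.Γ₁Sides.filter fun s => t ∈ shadow s
  have h1 : ∑ s ∈ M.Γ₁Sides, sideAt s φ t ≤ ∑ s ∈ M.Γ₁Sides, if t ∈ shadow s then X else 0 := by
    refine Finset.sum_le_sum fun s hs => ?_
    rw [sideAt_eq_indicator hs]
    split_ifs with ht
    · rw [Set.indicator_of_mem ht, hX, Set.indicator_of_mem (shadow_subset s ht)]
      rcases (Γ₁Sides_height hs).1 with h | h <;> rw [h]
      · exact le_add_of_nonneg_right (h0 _)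
      · exact le_add_of_nonneg_left (h0 _)
    · rw [Set.indicator_of_notMem ht]
  refine h1.trans ?_
  rw [← Finset.sum_filter, Finset.sum_const, nsmul_eq_mul]
  refine mul_le_mul_of_nonneg_right ?_ hX0
  let N (y : ℝ) : Finset (Fin M.n) := Finset.univ.filter fun K => pt t y ∈ M.cell K
  have hN : ∀ y, ((N y).card : ℝ) ≤ 16 / ρ ^ 2 := fun y =>
    hM.card_near_le hρ (N y) (pt t y) fun K hK =>
      ⟨_, (Finset.mem_filter.1 hK).2, by rw [dist_self]; exact M.h_pos.le⟩
  have h2 : S ⊆ (N R.c ∪ N R.d) ×ˢ (Finset.univ : Finset (Fin 3)) := fun s hs => by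
    obtain ⟨hs, ht⟩ := Finset.mem_filter.1 hs
    have := pt_mem_cell_of_mem_shadow hs ht
    refine Finset.mem_product.2 ⟨Finset.mem_union.2 ?_, Finset.mem_univ _⟩
    rcases (Γ₁Sides_height hs).1 with h | h <;> rw [h] at this
    · exact Or.inl (Finset.mem_filter.2 ⟨Finset.mem_univ _, this⟩)
    · exact Or.inr (Finset.mem_filter.2 ⟨Finset.mem_univ _, this⟩)
  have h3 := Finset.card_le_card h2
  rw [Finset.card_product, Finset.card_fin] at h3
  have h4 : S.card ≤ ((N R.c).card + (N R.d).card) * 3 :=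
    h3.trans (Nat.mul_le_mul_right _ (Finset.card_union_le _ _))
  have h5 : (S.card : ℝ) ≤ ((N R.c).card + (N R.d).card) * 3 := by exact_mod_cast h4
  calc (S.card : ℝ) ≤ ((N R.c).card + (N R.d).card) * 3 := h5
    _ ≤ (16 / ρ ^ 2 + 16 / ρ ^ 2) * 3 := by gcongr <;> exact hN _
    _ = 96 / ρ ^ 2 := by ring

theorem QuasiUniform.loadΓ₁_le {ρ : ℝ} (hM : M.QuasiUniform ρ) (hρ : 0 < ρ) {g : Plane → ℝ}
    (hg : Integrable (fun x => g x ^ 2) R.μΓ₁) (v : M.V p) {δ : ℝ} (hδ : 0 < δ) :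
    loadΓ₁ g v ≤ δ * innerΓ₁ v v + 24 / (ρ ^ 2 * δ) * ∫ x, g x ^ 2 ∂(R.μΓ₁) := by
  obtain ⟨hc, hd, heq⟩ := integral_μΓ₁ R hg
  have ig : ∀ s ∈ M.Γ₁Sides, Integrable (sideAt s fun x => g x ^ 2) := fun s hs => by
    rw [sideAt_eq_indicator hs, integrable_indicator_iff (measurableSet_shadow s)]
    rcases (Γ₁Sides_height hs).1 with h | h <;> rw [h]
    · exact hc.mono_set (shadow_subset s)
    · exact hd.mono_set (shadow_subset s)
  have iv : ∀ s : M.Side, Integrable (sideAt s (fun x => val v s.1 x * val v s.1 x)) := fun s =>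
    integrable_sideAt s (Continuous.intervalIntegrable
      (((continuous_val v s.1).mul (continuous_val v s.1)).comp AffineMap.lineMap_continuous) 0 1)
  have h1 : ∀ s ∈ M.Γ₁Sides, M.sideIntegral s (fun x => g x * val v s.1 x) ≤
      δ * M.sideIntegral s (fun x => val v s.1 x * val v s.1 x) +
        1 / (4 * δ) * ∫ t, sideAt s (fun x => g x ^ 2) t := fun s hs => by
    rw [sideIntegral_eq_integral_sideAt hs, sideIntegral_eq_integral_sideAt hs,
      ← integral_const_mul, ← integral_const_mul,
      ← integral_add ((iv s).const_mul δ) ((ig s hs).const_mul _)]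
    refine (Real.le_norm_self _).trans (norm_integral_le_of_norm_le
      (((iv s).const_mul δ).add ((ig s hs).const_mul (1 / (4 * δ))))
      (Filter.Eventually.of_forall fun t => ?_))
    simp only [sideAt_eq_indicator hs]
    by_cases ht : t ∈ shadow s
    · simp only [Set.indicator_of_mem ht]
      exact abs_mul_le_young _ _ hδ
    · simp [Set.indicator_of_notMem ht]
  have h2 : ∑ s ∈ M.Γ₁Sides, ∫ t, sideAt s (fun x => g x ^ 2) t ≤
      96 / ρ ^ 2 * ∫ x, g x ^ 2 ∂(R.μΓ₁) := by
    rw [← integral_finsetSum _ ig, heq, ← integral_add hc hd, ← integral_indicator measurableSet_Ioo,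
      ← integral_const_mul]
    refine integral_mono (integrable_finsetSum _ ig) (((integrable_indicator_iff
      measurableSet_Ioo).2 (hc.add hd)).const_mul _) fun t => ?_
    exact hM.sum_sideAt_le hρ (fun _ => sq_nonneg _) t
  unfold loadΓ₁ innerΓ₁
  refine (Finset.sum_le_sum h1).trans ?_
  rw [Finset.sum_add_distrib, ← Finset.mul_sum, ← Finset.mul_sum]
  have h3 : 1 / (4 * δ) * ∑ s ∈ M.Γ₁Sides, ∫ t, sideAt s (fun x => g x ^ 2) t ≤
      1 / (4 * δ) * (96 / ρ ^ 2 * ∫ x, g x ^ 2 ∂(R.μΓ₁)) :=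
    -- Young's weight `1 / (4δ)` times the multiplicity `96 / ρ²` is `24 / (ρ² δ)`.
    mul_le_mul_of_nonneg_left h2 (by positivity)
  have h4 : 1 / (4 * δ) * (96 / ρ ^ 2 * ∫ x, g x ^ 2 ∂(R.μΓ₁)) =
      24 / (ρ ^ 2 * δ) * ∫ x, g x ^ 2 ∂(R.μΓ₁) := by field_simp; ring
  linarith

/-! ### The energy norm controls the `L²` norms -/

theorem energyNormSq_bounds {α β γ : ℝ} (hα : 0 < α) (hβ : 0 < β) (hγ : 1 ≤ γ) (v : M.V p) :
    α * innerΓ₁ v v ≤ energyNormSq α β γ v ∧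
    (∑ K, ∫ x in M.cell K, ‖grad v K x‖ ^ 2) ≤ energyNormSq α β γ v ∧
    1 / M.h * M.skeletonSum (fun τ s s' x => ‖jump v τ s s' x‖ ^ 2) ≤ energyNormSq α β γ v := by
  have hh := M.h_pos
  have hγ0 : 0 < γ := by linarith
  have d0 : 0 ≤ ∑ K, ∫ x in M.cell K, ‖grad v K x‖ ^ 2 :=
    Finset.sum_nonneg fun _ _ => integral_nonneg fun _ => sq_nonneg _
  have j0 : 0 ≤ M.skeletonSum (fun τ s s' x => ‖jump v τ s s' x‖ ^ 2) :=
    skeletonSum_nonneg fun _ _ _ _ => sq_nonneg _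
  have a0 : 0 ≤ M.skeletonSum (fun τ s s' x => ‖avgGrad v τ s s' x‖ ^ 2) :=
    skeletonSum_nonneg fun _ _ _ _ => sq_nonneg _
  have t0 : 0 ≤ ∑ s ∈ M.Γ₁Sides, M.sideIntegral s (fun x => ‖tgrad v s x‖ ^ 2) :=
    Finset.sum_nonneg fun s _ => sideIntegral_nonneg s fun _ => sq_nonneg _
  have r0 : 0 ≤ ∑ q ∈ M.ridges, ‖ridgeJump v q‖ ^ 2 := Finset.sum_nonneg fun _ _ => sq_nonneg _
  have s0 : 0 ≤ ∑ q ∈ M.ridges, ‖ridgeAvg v q‖ ^ 2 := Finset.sum_nonneg fun _ _ => sq_nonneg _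
  have g0 := innerΓ₁_self_nonneg v
  have j1 : 1 / M.h * M.skeletonSum (fun τ s s' x => ‖jump v τ s s' x‖ ^ 2) ≤
      γ / M.h * M.skeletonSum (fun τ s s' x => ‖jump v τ s s' x‖ ^ 2) := by gcongr
  have e1 : 0 ≤ 1 / M.h * M.skeletonSum (fun τ s s' x => ‖jump v τ s s' x‖ ^ 2) := by positivity
  have e2 : 0 ≤ 1 / (γ / M.h) * M.skeletonSum (fun τ s s' x => ‖avgGrad v τ s s' x‖ ^ 2) := by
    positivity
  have e3 : 0 ≤ β * ∑ s ∈ M.Γ₁Sides, M.sideIntegral s (fun x => ‖tgrad v s x‖ ^ 2) := by positivity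
  have e4 : 0 ≤ β * (γ / M.h) * ∑ q ∈ M.ridges, ‖ridgeJump v q‖ ^ 2 := by positivity
  have e5 : 0 ≤ β / (γ / M.h) * ∑ q ∈ M.ridges, ‖ridgeAvg v q‖ ^ 2 := by positivity
  have e6 : 0 ≤ α * innerΓ₁ v v := by positivity
  unfold energyNormSq bulkNormSq
  refine ⟨?_, ?_, ?_⟩ <;> linarith

/-- The constant precedes the quantifiers over `γ` and `p`: the broken Poincaré inequality uses no
inverse estimate, and `γ ≥ 1` lets the penalty dominate the jump term of weight `1 / h`. -/
theorem exists_innerΩ_le (R : Rect) {α β ρ : ℝ} (hα : 0 < α) (hβ : 0 < β) (hρ : 0 < ρ) :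
    ∃ C : ℝ, 0 < C ∧ ∀ M : Mesh R, M.QuasiUniform ρ → ∀ γ : ℝ, 1 ≤ γ → ∀ (p : ℕ) (v : M.V p),
      innerΩ v v ≤ C * energyNormSq α β γ v := by
  have hcd := R.hcd
  set C := 8 * (R.d - R.c) / ρ ^ 2 with hC
  have hC0 : 0 < C := div_pos (by linarith) (by positivity)
  refine ⟨C * (2 / α + 12 * C), by positivity, fun M hM γ hγ p v => ?_⟩
  have hh := M.h_pos
  obtain ⟨h1, h2, h3⟩ := energyNormSq_bounds hα hβ hγ v
  refine (hM.poincare hρ v hC).trans ?_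
  rw [mul_assoc C]
  refine mul_le_mul_of_nonneg_left ?_ hC0.le
  have k1 : 2 * innerΓ₁ v v ≤ 2 / α * energyNormSq α β γ v := by
    rw [div_mul_eq_mul_div, le_div_iff₀ hα]
    linarith
  have k2 := mul_le_mul_of_nonneg_left h2 (by positivity : 0 ≤ 4 * C)
  have k3 := mul_le_mul_of_nonneg_left h3 (by positivity : 0 ≤ 8 * C)
  have k4 : 8 * C / M.h * M.skeletonSum (fun τ s s' x => ‖jump v τ s s' x‖ ^ 2) =
      8 * C * (1 / M.h * M.skeletonSum (fun τ s s' x => ‖jump v τ s s' x‖ ^ 2)) := by ring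
  rw [k4]
  linarith

theorem innerΩ_self_nonneg (v : M.V p) : 0 ≤ innerΩ v v :=
  Finset.sum_nonneg fun _ _ => integral_nonneg fun _ => mul_self_nonneg _

end Mesh

end DynBC

/-! ### The energy estimate. -/

theorem mainTheorem5 (R : DynBC.Rect) (α β lam : ℝ) (hα : 0 < α) (hβ : 0 < β) (hlam : 0 < lam)
    (ρ : ℝ) (hρ : 0 < ρ) :
    ∃ C : ℝ, 0 < C ∧ ∀ p : ℕ, 1 ≤ p → ∃ γ₀ : ℝ, 0 < γ₀ ∧ ∀ γ : ℝ, γ₀ ≤ γ →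
      ∀ M : DynBC.Mesh R, M.QuasiUniform ρ →
      ∀ T : ℝ, 0 < T →
      ∀ f g : ℝ → DynBC.Plane → ℝ,
        MemLp (Function.uncurry f) 2
          ((volume.restrict (Set.Ioc 0 T)).prod (volume.restrict R.Ω)) →
        MemLp (Function.uncurry g) 2 ((volume.restrict (Set.Ioc 0 T)).prod R.μΓ₁) →
      ∀ (u₀ : M.V p) (u : ℝ → M.V p),
        DynBC.Mesh.IsSemidiscreteSolution α β lam γ T f g u₀ u →
        DynBC.Mesh.lambdaNormSq lam (u T) +
            (∫ t in (0 : ℝ)..T, DynBC.Mesh.energyNormSq α β γ (u t)) ≤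
          C * (DynBC.Mesh.lambdaNormSq lam u₀ +
            ∫ t in (0 : ℝ)..T, ((∫ x in R.Ω, f t x ^ 2) + ∫ x, (g t x) ^ 2 ∂(R.μΓ₁))) := by
  obtain ⟨CP, hCP, HP⟩ := DynBC.Mesh.exists_innerΩ_le R hα hβ hρ
  -- These are twice the factors of the data in the two load estimates, added so that one constant
  -- serves `f` and `g`.
  set D : ℝ := 4 * CP + 384 / (ρ ^ 2 * α) with hD
  have hD0 : 0 < D := by positivity
  refine ⟨2 + 2 * D, by positivity, fun p _ => ?_⟩
  obtain ⟨γ₁, hγ₁, HC⟩ := DynBC.Mesh.exists_dgForm_coercive p hρ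
  -- Coercivity requires `γ₁ ≤ γ`; the bound of the `L²(Ω)` norm requires `1 ≤ γ`.
  refine ⟨max γ₁ 1, lt_max_of_lt_left hγ₁, fun γ hγ M hM T hT f g hf hg u₀ u hu => ?_⟩
  obtain ⟨w, hw, hprim, hsol⟩ := hu
  have hγ1 : γ₁ ≤ γ := (le_max_left _ _).trans hγ
  have hγ2 : 1 ≤ γ := (le_max_right _ _).trans hγ
  have hP : ∀ φ, DynBC.IsPrimitive T u₀ u w φ := DynBC.Mesh.isPrimitive_of_coeff
    (fun K m => (intervalIntegrable_iff_integrableOn_Ioc_of_le hT.le).2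
      ((hw K m).integrable one_le_two)) hprim
  have hB : DynBC.IsBilin fun v v' : M.V p =>
      DynBC.Mesh.innerΩ v v' + lam * DynBC.Mesh.innerΓ₁ v v' :=
    DynBC.Mesh.isBilin_innerΩ.add (DynBC.Mesh.isBilin_innerΓ₁.const_mul lam)
  obtain ⟨hBi, hBe⟩ := hB.integral_eq hT hP
  obtain ⟨E, hE, hEe⟩ := DynBC.Mesh.exists_isBilin_energyNormSq (M := M) (p := p) α β γ
  have hEc : IntervalIntegrable (fun t => DynBC.Mesh.energyNormSq α β γ (u t)) volume 0 T := by
    simp_rw [hEe]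
    refine ContinuousOn.intervalIntegrable ?_
    rw [Set.uIcc_of_le hT.le]
    exact hE.continuousOn hT hP
  have hf2 : Integrable (fun z : ℝ × DynBC.Plane => f z.1 z.2 ^ 2)
      ((volume.restrict (Set.Ioc 0 T)).prod (volume.restrict R.Ω)) := hf.integrable_sq
  have hg2 : Integrable (fun z : ℝ × DynBC.Plane => g z.1 z.2 ^ 2)
      ((volume.restrict (Set.Ioc 0 T)).prod R.μΓ₁) := hg.integrable_sq
  have hdata : IntervalIntegrable
      (fun t => (∫ x in R.Ω, f t x ^ 2) + ∫ x, (g t x) ^ 2 ∂(R.μΓ₁)) volume 0 T :=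
    (intervalIntegrable_iff_integrableOn_Ioc_of_le hT.le).2
      (hf2.integral_prod_left.add hg2.integral_prod_left)
  have key : ∀ᵐ t ∂(volume.restrict (Set.Ioc 0 T)),
      ((DynBC.Mesh.innerΩ (w t) (u t) + lam * DynBC.Mesh.innerΓ₁ (w t) (u t)) +
        (DynBC.Mesh.innerΩ (u t) (w t) + lam * DynBC.Mesh.innerΓ₁ (u t) (w t))) +
        1 / 2 * DynBC.Mesh.energyNormSq α β γ (u t) ≤
      D * ((∫ x in R.Ω, f t x ^ 2) + ∫ x, (g t x) ^ 2 ∂(R.μΓ₁)) := by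
    filter_upwards [hsol, hf2.prod_right_ae, hg2.prod_right_ae] with t h1 h2 h3
    have e1 := h1 (u t)
    -- With these `δ` each load costs an eighth of the energy. Of the half given by coercivity a
    -- quarter remains, and doubling the identity yields the `1 / 2` in `key`.
    have e2 := DynBC.Mesh.loadΩ_le (M := M) h2 (u t) (δ := 1 / (8 * CP)) (by positivity)
    have e3 := hM.loadΓ₁_le hρ h3 (u t) (δ := α / 8) (by positivity)
    have e4 := HC R M hM γ hγ1 α β hα.le hβ.le (u t)
    have e5 := HP M hM γ hγ2 p (u t)
    have e6 := (DynBC.Mesh.energyNormSq_bounds hα hβ hγ2 (u t)).1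
    have s1 : DynBC.Mesh.innerΩ (u t) (w t) = DynBC.Mesh.innerΩ (w t) (u t) := by
      unfold DynBC.Mesh.innerΩ; simp only [mul_comm]
    have s2 : DynBC.Mesh.innerΓ₁ (u t) (w t) = DynBC.Mesh.innerΓ₁ (w t) (u t) := by
      unfold DynBC.Mesh.innerΓ₁; simp only [mul_comm]
    rw [s1, s2]
    have nf : 0 ≤ ∫ x in R.Ω, f t x ^ 2 := integral_nonneg fun _ => sq_nonneg _
    have ng : 0 ≤ ∫ x, (g t x) ^ 2 ∂(R.μΓ₁) := integral_nonneg fun _ => sq_nonneg _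
    set F := ∫ x in R.Ω, f t x ^ 2
    set G := ∫ x, (g t x) ^ 2 ∂(R.μΓ₁)
    set N := DynBC.Mesh.energyNormSq α β γ (u t)
    have k1 : 1 / (8 * CP) * DynBC.Mesh.innerΩ (u t) (u t) ≤ 1 / 8 * N := by
      calc _ ≤ 1 / (8 * CP) * (CP * N) := by gcongr
        _ = 1 / 8 * N := by field_simp
    have k2 : 1 / (4 * (1 / (8 * CP))) * F = 2 * CP * F := by field_simp; ring
    have k3 : 24 / (ρ ^ 2 * (α / 8)) * G = 192 / (ρ ^ 2 * α) * G := by field_simp; ring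
    have k4 : 0 ≤ 4 * CP * G := by positivity
    have k5 : 0 ≤ 384 / (ρ ^ 2 * α) * F := by positivity
    have k6 : D * (F + G) = 2 * (2 * CP * F) + 2 * (192 / (ρ ^ 2 * α) * G) + 4 * CP * G +
        384 / (ρ ^ 2 * α) * F := by rw [hD]; ring
    rw [k6]
    linarith
  -- Integration in time turns the symmetrised mass term into the difference of the squared norms at
  -- `T` and `0`. Doubling the result to normalise the energy term gives `2 + 2D`, the surplus copy
  -- of the final norm being nonnegative.
  have h_int := integral_mono_ae
    (((intervalIntegrable_iff_integrableOn_Ioc_of_le hT.le).1 hBi).integrable.fun_add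
      (((intervalIntegrable_iff_integrableOn_Ioc_of_le hT.le).1 hEc).integrable.const_mul (1 / 2)))
    (((intervalIntegrable_iff_integrableOn_Ioc_of_le hT.le).1 hdata).integrable.const_mul D) key
  rw [integral_add ((intervalIntegrable_iff_integrableOn_Ioc_of_le hT.le).1 hBi).integrable
    (((intervalIntegrable_iff_integrableOn_Ioc_of_le hT.le).1 hEc).integrable.const_mul (1 / 2)),
    integral_const_mul, integral_const_mul, ← intervalIntegral.integral_of_le hT.le,
    ← intervalIntegral.integral_of_le hT.le, ← intervalIntegral.integral_of_le hT.le, hBe] at h_int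
  have n0 : ∀ v : M.V p, 0 ≤ DynBC.Mesh.lambdaNormSq lam v := fun v =>
    add_nonneg (DynBC.Mesh.innerΩ_self_nonneg v)
      (mul_nonneg hlam.le (DynBC.Mesh.innerΓ₁_self_nonneg v))
  have m1 := n0 (u T)
  have m2 := n0 u₀
  have m3 : 0 ≤ ∫ t in (0 : ℝ)..T, ((∫ x in R.Ω, f t x ^ 2) + ∫ x, (g t x) ^ 2 ∂(R.μΓ₁)) :=
    intervalIntegral.integral_nonneg hT.le fun t _ =>
      add_nonneg (integral_nonneg fun _ => sq_nonneg _) (integral_nonneg fun _ => sq_nonneg _)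
  unfold DynBC.Mesh.lambdaNormSq at m1 m2 ⊢
  have m4 := mul_nonneg hD0.le m2
  linarith
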